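/- Work with graded species, i.e. functors from the groupoid of finite sets to $\mathbb{Z}$-graded $\mathbb{Q}$-vector spaces with Koszul signs, and with the composite product $(P\circ Q)(I)=\bigoplus_n P(\{1,\dots,n\})\otimes_{S_n}\bigl(\bigoplus_{f:I\to\{1,\dots,n\}}\bigotimes_k Q(f^{-1}(k))\bigr)$; an operad is a monoid for $\circ$. Let $\operatorname{Det}$ be the suspended commutative associative operad: for $I\neq\emptyset$, $\operatorname{Det}(I)=\Lambda^{|I|}\mathbb{Q}I$ is placed in degree $|I|-1$ (and $\operatorname{Det}(\emptyset)=0$), with composition determined by $(x\wedge\star)\circ_\star y=x\wedge y$ and with generator $e_{i,j}=i\wedge j$. Let $\operatorname{Gri}$ be the operad, concentrated in degree $0$, such that $\operatorname{Gri}(I)$ has as basis the (non-planar) rooted binary trees with leaves bijectively labelled by $I$, with composition given by grafting; let $\omega_{i,j}$ be the tree with the two leaves $i,j$. A distributive law from $Q\circ P$ to $P\circ Q$, for operads $P$ and $Q$, is a morphism of graded species $\lambda:Q\circ P\to P\circ Q$ compatible with the units and the compositions of $P$ and $Q$ (Beck's four diagrams): $\lambda(1_Q\circ P)=P\circ 1_Q$,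 $\lambda(Q\circ 1_P)=1_P\circ Q$, $\lambda(\gamma_Q\circ P)=(P\circ\gamma_Q)(\lambda\circ Q)(Q\circ\lambda)$ and $\lambda(Q\circ\gamma_P)=(\gamma_P\circ Q)(P\circ\lambda)(\lambda\circ P)$, where the associativity isomorphisms of $\circ$ are omitted. Then $\operatorname{Det}$ and $\operatorname{Gri}$ are operads, and there is exactly one distributive law $\lambda:\operatorname{Gri}\circ\operatorname{Det}\to\operatorname{Det}\circ\operatorname{Gri}$ such that, for every three-element set $\{i,j,k\}$, $$\lambda(\omega_{i,\star}\circ_\star e_{j,k})=e_{j,\star}\circ_\star\omega_{i,k}-e_{k,\star}\circ_\star\omega_{i,j}.$$ Consequently the composition $$(\operatorname{Det}\circ\operatorname{Gri})\circ(\operatorname{Det}\circ\operatorname{Gri})\xrightarrow{\ \operatorname{Det}\circ\lambda\circ\operatorname{Gri}\ }(\operatorname{Det}\circ\operatorname{Det})\circ(\operatorname{Gri}\circ\operatorname{Gri})\xrightarrow{\ \gamma_{\operatorname{Det}}\circ\gamma_{\operatorname{Gri}}\ }\operatorname{Det}\circ\operatorname{Gri}$$ together with the unit $(1_{\operatorname{Det}};1_{\operatorname{Gri}})$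 makes $\operatorname{Det}\circ\operatorname{Gri}$ into an operad $B$. -/

import Mathlib

open scoped TensorProduct DirectSum

namespace BOperad

noncomputable section

/-- A graded species: a functor from the groupoid of finite sets to `ℤ`-graded `ℚ`-vector spaces.
`obj d I` is the component of degree `d` of the value at `I`. -/
structure GrSpecies where
  obj : ℤ → (I : Type) → [Finite I] → Type
  [addCommGroup : ∀ (d : ℤ) (I : Type) [Finite I], AddCommGroup (obj d I)]
  [module : ∀ (d : ℤ) (I : Type) [Finite I], Module ℚ (obj d I)]
  map : ∀ (d : ℤ) {I J : Type} [Finite I] [Finite J], (I ≃ J) → (obj d I →ₗ[ℚ] obj d J)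
  map_refl : ∀ (d : ℤ) (I : Type) [Finite I] (x : obj d I), map d (Equiv.refl I) x = x
  map_trans : ∀ (d : ℤ) {I J K : Type} [Finite I] [Finite J] [Finite K]
    (u : I ≃ J) (v : J ≃ K) (x : obj d I), map d (u.trans v) x = map d v (map d u x)

attribute [instance] GrSpecies.addCommGroup GrSpecies.module

/-- A morphism of graded species: degree-preserving linear maps, natural in the finite set. -/
@[ext]
structure Hom (P Q : GrSpecies) where
  app : ∀ (d : ℤ) (I : Type) [Finite I], P.obj d I →ₗ[ℚ] Q.obj d I
  naturality : ∀ (d : ℤ) {I J : Type} [Finite I] [Finite J] (u : I ≃ J) (x : P.obj d I),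
    app d J (P.map d u x) = Q.map d u (app d I x)

def Hom.id (P : GrSpecies) : Hom P P where
  app _ _ _ := LinearMap.id
  naturality _ _ _ _ _ _ _ := rfl

/-- Indexing data of the composite product `(P ∘ Q)(I)` in total degree `D`: a map `f : I → {0,…,n-1}`,
a degree `e` for the factor `P({0,…,n-1})` and degrees `d k` for the factors `Q(f⁻¹ k)`. -/
structure CompIdx (D : ℤ) (I : Type) where
  n : ℕ
  f : I → Fin n
  e : ℤ
  d : Fin n → ℤ
  deg : e + ∑ k, d k = D

namespace CompIdx

variable {D : ℤ} {I J : Type}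

/-- Transport of the indexing data along a bijection of the label sets. -/
abbrev map (u : I ≃ J) (x : CompIdx D I) : CompIdx D J :=
  ⟨x.n, x.f ∘ u.symm, x.e, x.d, x.deg⟩

def mapFib (u : I ≃ J) (x : CompIdx D I) (k : Fin x.n) :
    {i // x.f i = k} ≃ {j // (x.map u).f j = k} :=
  u.subtypeEquiv (fun i => by simp [map])

/-- Renumbering of the `n` inputs by a permutation. -/
abbrev perm (x : CompIdx D I) (s : Equiv.Perm (Fin x.n)) : CompIdx D I :=
  ⟨x.n, s ∘ x.f, x.e, x.d ∘ s.symm, by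
    exact (congrArg (x.e + ·) (Equiv.sum_comp s.symm x.d)).trans x.deg⟩

def permFib (x : CompIdx D I) (s : Equiv.Perm (Fin x.n)) (k : Fin x.n) :
    {i // x.f i = s.symm k} ≃ {i // (x.perm s).f i = k} :=
  Equiv.subtypeEquivRight (fun i => by simp [perm, Equiv.eq_symm_apply])

end CompIdx

variable (P Q : GrSpecies)

/-- The summand `P(n)_e ⊗ Q(f⁻¹ 0)_{d 0} ⊗ ⋯ ⊗ Q(f⁻¹ (n-1))_{d (n-1)}`. -/
abbrev CompSummand {D : ℤ} {I : Type} [Finite I] (x : CompIdx D I) : Type :=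
  P.obj x.e (Fin x.n) ⊗[ℚ] (⨂[ℚ] k, Q.obj (x.d k) {i // x.f i = k})

open Classical in
/-- The relations of the composite product: exchanging the neighbouring inputs `a`, `b = a + 1` acts
simultaneously on `P(n)` and on the tensor factors, with the Koszul sign `(-1)^{d a * d b}`.
Adjacent transpositions generate the symmetric group, so the quotient by these relations
is the tensor product over the symmetric group with the Koszul symmetry. -/
def compRel (D : ℤ) (I : Type) [Finite I] :
    Submodule ℚ (⨁ x : CompIdx D I, CompSummand P Q x) :=
  Submodule.span ℚ {z | ∃ (x : CompIdx D I) (a b : Fin x.n) (_ : a.val + 1 = b.val)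
    (p : P.obj x.e (Fin x.n)) (q : ∀ k, Q.obj (x.d k) {i // x.f i = k}),
    z = DirectSum.lof ℚ (CompIdx D I) (fun x => CompSummand P Q x) (x.perm (Equiv.swap a b))
          (P.map x.e (Equiv.swap a b) p ⊗ₜ[ℚ] PiTensorProduct.tprod ℚ (fun k =>
            Q.map _ (x.permFib (Equiv.swap a b) k) (q ((Equiv.swap a b).symm k))))
        - (x.d a * x.d b).negOnePow • DirectSum.lof ℚ (CompIdx D I) (fun x => CompSummand P Q x) x
          (p ⊗ₜ[ℚ] PiTensorProduct.tprod ℚ q)}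

/-- The degree `D` part of `(P ∘ Q)(I) = ⨁_n P(n) ⊗_{S_n} (⨁_{f : I → n} ⨂_k Q(f⁻¹ k))`. -/
abbrev CompObj (D : ℤ) (I : Type) [Finite I] : Type :=
  (⨁ x : CompIdx D I, CompSummand P Q x) ⧸ compRel P Q D I

open Classical in
/-- The canonical map from a summand to the composite. -/
def CompObj.inc {D : ℤ} {I : Type} [Finite I] (x : CompIdx D I) :
    CompSummand P Q x →ₗ[ℚ] CompObj P Q D I :=
  (compRel P Q D I).mkQ ∘ₗ DirectSum.lof ℚ (CompIdx D I) (fun x => CompSummand P Q x) x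

variable {P Q}

lemma CompObj.inc_swap {D : ℤ} {I : Type} [Finite I] (x : CompIdx D I) (a b : Fin x.n)
    (hab : a.val + 1 = b.val) (p : P.obj x.e (Fin x.n))
    (q : ∀ k, Q.obj (x.d k) {i // x.f i = k}) :
    CompObj.inc P Q (x.perm (Equiv.swap a b))
      (P.map x.e (Equiv.swap a b) p ⊗ₜ[ℚ] PiTensorProduct.tprod ℚ (fun k =>
            Q.map _ (x.permFib (Equiv.swap a b) k) (q ((Equiv.swap a b).symm k))))
      = (x.d a * x.d b).negOnePow • CompObj.inc P Q x (p ⊗ₜ[ℚ] PiTensorProduct.tprod ℚ q) := by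
  rw [← sub_eq_zero, Units.smul_def, ← map_zsmul]
  simp only [CompObj.inc, LinearMap.comp_apply, map_zsmul]
  rw [← map_zsmul, ← map_sub, Submodule.mkQ_apply, Submodule.Quotient.mk_eq_zero]
  exact Submodule.subset_span ⟨x, a, b, hab, p, q, rfl⟩

/-- Maps out of the composite, from maps on the summands that respect the relations. -/
def CompObj.lift {D : ℤ} {I : Type} [Finite I] {M : Type} [AddCommGroup M] [Module ℚ M]
    (F : ∀ x : CompIdx D I, CompSummand P Q x →ₗ[ℚ] M)
    (hF : ∀ (x : CompIdx D I) (a b : Fin x.n) (_ : a.val + 1 = b.val)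
      (p : P.obj x.e (Fin x.n)) (q : ∀ k, Q.obj (x.d k) {i // x.f i = k}),
      F (x.perm (Equiv.swap a b))
        (P.map x.e (Equiv.swap a b) p ⊗ₜ[ℚ] PiTensorProduct.tprod ℚ (fun k =>
            Q.map _ (x.permFib (Equiv.swap a b) k) (q ((Equiv.swap a b).symm k))))
        = (x.d a * x.d b).negOnePow • F x (p ⊗ₜ[ℚ] PiTensorProduct.tprod ℚ q)) :
    CompObj P Q D I →ₗ[ℚ] M := by
  classical
  exact (compRel P Q D I).liftQ (DirectSum.toModule ℚ (CompIdx D I) M F) (by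
    rw [compRel, Submodule.span_le]
    rintro z ⟨x, a, b, hab, p, q, rfl⟩
    simp only [SetLike.mem_coe, LinearMap.mem_ker, map_sub, Units.smul_def, map_zsmul]
    rw [DirectSum.toModule_lof, DirectSum.toModule_lof, hF x a b hab p q, Units.smul_def, sub_self])

@[simp]
lemma CompObj.lift_inc {D : ℤ} {I : Type} [Finite I] {M : Type} [AddCommGroup M] [Module ℚ M]
    (F : ∀ x : CompIdx D I, CompSummand P Q x →ₗ[ℚ] M) (hF) (x : CompIdx D I)
    (t : CompSummand P Q x) : CompObj.lift F hF (CompObj.inc P Q x t) = F x t := by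
  classical
  simp only [CompObj.lift, CompObj.inc, LinearMap.comp_apply, Submodule.mkQ_apply,
    Submodule.liftQ_apply]
  exact DirectSum.toModule_lof ℚ x t

lemma CompObj.hom_ext {D : ℤ} {I : Type} [Finite I] {M : Type} [AddCommGroup M] [Module ℚ M]
    {F G : CompObj P Q D I →ₗ[ℚ] M}
    (h : ∀ (x : CompIdx D I) (p : P.obj x.e (Fin x.n)) (q : ∀ k, Q.obj (x.d k) {i // x.f i = k}),
      F (CompObj.inc P Q x (p ⊗ₜ[ℚ] PiTensorProduct.tprod ℚ q))
        = G (CompObj.inc P Q x (p ⊗ₜ[ℚ] PiTensorProduct.tprod ℚ q))) : F = G := by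
  classical
  apply Submodule.linearMap_qext
  apply DirectSum.linearMap_ext
  intro x
  apply TensorProduct.ext
  ext p q
  exact h x p q

/-- Functoriality of the composite product in the finite set. -/
def compMap (P Q : GrSpecies) (D : ℤ) {I J : Type} [Finite I] [Finite J] (u : I ≃ J) :
    CompObj P Q D I →ₗ[ℚ] CompObj P Q D J :=
  CompObj.lift (fun x => CompObj.inc P Q (x.map u) ∘ₗ TensorProduct.map LinearMap.id
      (PiTensorProduct.map (fun k => Q.map (x.d k) (x.mapFib u k)))) (by
    intro x a b hab p q
    have := CompObj.inc_swap (P := P) (Q := Q) (x.map u) a b hab p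
      (fun k => Q.map (x.d k) (x.mapFib u k) (q k))
    simp only [LinearMap.comp_apply, TensorProduct.map_tmul, PiTensorProduct.map_tprod,
      LinearMap.id_apply]
    refine Eq.trans ?_ this
    congr 3
    funext k
    change Q.map _ _ (Q.map _ _ _) = Q.map _ _ (Q.map _ _ _)
    rw [← Q.map_trans, ← Q.map_trans]
    rfl)

lemma compMap_inc (P Q : GrSpecies) {D : ℤ} {I J : Type} [Finite I] [Finite J] (u : I ≃ J)
    (x : CompIdx D I) (p : P.obj x.e (Fin x.n)) (q : ∀ k, Q.obj (x.d k) {i // x.f i = k}) :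
    compMap P Q D u (CompObj.inc P Q x (p ⊗ₜ[ℚ] PiTensorProduct.tprod ℚ q)) =
      CompObj.inc P Q (x.map u) (p ⊗ₜ[ℚ] PiTensorProduct.tprod ℚ
        (fun k => Q.map (x.d k) (x.mapFib u k) (q k))) := by
  simp only [compMap, CompObj.lift_inc, LinearMap.comp_apply, TensorProduct.map_tmul,
    PiTensorProduct.map_tprod, LinearMap.id_apply]

/-- The composite product `P ∘ Q` of graded species. -/
def Comp (P Q : GrSpecies) : GrSpecies where
  obj D I _ := CompObj P Q D I
  map D _ _ _ _ u := compMap P Q D u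
  map_refl D I _ x := by
    have : compMap P Q D (Equiv.refl I) = LinearMap.id := by
      apply CompObj.hom_ext
      intro x p q
      rw [compMap_inc]
      have : (fun k => Q.map (x.d k) (x.mapFib (Equiv.refl I) k) (q k)) = q := by
        funext k
        exact Q.map_refl _ _ _
      rw [this]; rfl
    rw [this]; rfl
  map_trans D I J K _ _ _ u v x := by
    have : compMap P Q D (u.trans v) = compMap P Q D v ∘ₗ compMap P Q D u := by
      apply CompObj.hom_ext
      intro x p q
      rw [LinearMap.comp_apply, compMap_inc, compMap_inc, compMap_inc]
      change CompObj.inc P Q (x.map (u.trans v)) _ = CompObj.inc P Q (x.map (u.trans v)) _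
      congr 3
      funext k
      exact Q.map_trans (x.d k) (x.mapFib u k) ((x.map u).mapFib v k) (q k)
    rw [this]; rfl

/-- The element `(p; (q_k)_k)` of `(P ∘ Q)(I)`, for an arbitrary finite linearly ordered set `K` of
inputs and a map `f : I → K`; the tensor factors `q_k ∈ Q(f⁻¹ k)` are taken in the order of `K`. -/
def Comp.mk {I K : Type} [Finite I] [Fintype K] [LinearOrder K] (f : I → K)
    {e D : ℤ} {d : K → ℤ} (h : e + ∑ k, d k = D) (p : P.obj e K)
    (q : ∀ k, Q.obj (d k) {i // f i = k}) : (Comp P Q).obj D I :=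
  let o : Fin (Fintype.card K) ≃o K := Fintype.orderIsoFinOfCardEq K rfl
  CompObj.inc P Q
    ⟨Fintype.card K, o.symm ∘ f, e, d ∘ o, by rw [← h]; congr 1; exact Equiv.sum_comp o.toEquiv d⟩
    (P.map e o.symm.toEquiv p ⊗ₜ[ℚ] PiTensorProduct.tprod ℚ (fun k =>
      Q.map (d (o k)) (Equiv.subtypeEquivRight (fun i => by simp [OrderIso.symm_apply_eq])) (q (o k))))


/-- Morphisms out of `P ∘ Q`, from maps on the summands compatible with the relations. -/
def Comp.lift {P Q X : GrSpecies}
    (F : ∀ (D : ℤ) (I : Type) [Finite I] (x : CompIdx D I), CompSummand P Q x →ₗ[ℚ] X.obj D I)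
    (hF : ∀ (D : ℤ) (I : Type) [Finite I] (x : CompIdx D I) (a b : Fin x.n)
      (_ : a.val + 1 = b.val) (p : P.obj x.e (Fin x.n))
      (q : ∀ k, Q.obj (x.d k) {i // x.f i = k}),
      F D I (x.perm (Equiv.swap a b))
        (P.map x.e (Equiv.swap a b) p ⊗ₜ[ℚ] PiTensorProduct.tprod ℚ (fun k =>
            Q.map _ (x.permFib (Equiv.swap a b) k) (q ((Equiv.swap a b).symm k))))
        = (x.d a * x.d b).negOnePow • F D I x (p ⊗ₜ[ℚ] PiTensorProduct.tprod ℚ q))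
    (hnat : ∀ (D : ℤ) (I J : Type) [Finite I] [Finite J] (u : I ≃ J) (x : CompIdx D I)
      (p : P.obj x.e (Fin x.n)) (q : ∀ k, Q.obj (x.d k) {i // x.f i = k}),
      F D J (x.map u) (p ⊗ₜ[ℚ] PiTensorProduct.tprod ℚ
          (fun k => Q.map (x.d k) (x.mapFib u k) (q k)))
        = X.map D u (F D I x (p ⊗ₜ[ℚ] PiTensorProduct.tprod ℚ q))) :
    Hom (Comp P Q) X where
  app D I _ := CompObj.lift (F D I) (hF D I)
  naturality D I J _ _ u y := by
    have : CompObj.lift (F D J) (hF D J) ∘ₗ compMap P Q D u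
        = X.map D u ∘ₗ CompObj.lift (F D I) (hF D I) := by
      apply CompObj.hom_ext
      intro x p q
      rw [LinearMap.comp_apply, LinearMap.comp_apply, compMap_inc, CompObj.lift_inc,
        CompObj.lift_inc]
      exact hnat D I J u x p q
    exact LinearMap.congr_fun this y

/-- The element `(1; x)` of `(P ∘ Q)(I)`, where `1 ∈ P({*})`. -/
def insL {P Q : GrSpecies} (o : P.obj 0 Unit) {d : ℤ} {I : Type} [Finite I] (x : Q.obj d I) :
    (Comp P Q).obj d I :=
  Comp.mk (K := Unit) (fun _ => ()) (e := 0) (d := fun _ => d) (by simp) o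
    (fun _ => Q.map d (Equiv.subtypeUnivEquiv (fun _ => rfl)).symm x)

/-- The element `(x; 1, …, 1)` of `(P ∘ Q)(K)`, where `1 ∈ Q({*})` is transported to each one-point set. -/
def insR {P Q : GrSpecies} (o : Q.obj 0 Unit) {d : ℤ} {K : Type} [Fintype K] [LinearOrder K]
    (x : P.obj d K) : (Comp P Q).obj d K :=
  Comp.mk (K := K) (fun k => k) (e := d) (d := fun _ => 0) (by simp) x
    (fun k => Q.map 0 (Equiv.ofUnique Unit {i : K // i = k}) o)

/-- For `f : I → K`, `g : K → L` and `l : L`, the restriction of `f` to `(g ∘ f)⁻¹ l → g⁻¹ l`. -/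
def levelMap {I K L : Type} (f : I → K) (g : K → L) (l : L) (i : {i // (g ∘ f) i = l}) :
    {k // g k = l} := ⟨f i.1, i.2⟩

/-- The fibres of `levelMap f g l` are fibres of `f`. -/
def levelFib {I K L : Type} (f : I → K) (g : K → L) (l : L) (k : {k // g k = l}) :
    {i // f i = k.1} ≃ {i // levelMap f g l i = k} where
  toFun i := ⟨⟨i.1, by simp [i.2, k.2]⟩, Subtype.ext i.2⟩
  invFun i := ⟨i.1.1, congrArg Subtype.val i.2⟩
  left_inv _ := rfl
  right_inv _ := rfl

/-- The equality `B (A ∘ id_R) = E (id_P ∘ C) α` of morphisms `(P ∘ Q) ∘ R ⟶ Y`, where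
`α : (P ∘ Q) ∘ R ≅ P ∘ (Q ∘ R)` is the associativity isomorphism of the composite product. It is
expressed on the elements `((p; q_l); r_k)`, which span `(P ∘ Q) ∘ R`; `α` sends such an element to
`± (p; (q_l; (r_k)_{g k = l}))`, with the Koszul sign of moving each `r_k` to the left of all `q_l`
with `g k < l` (the inputs `K` can always be ordered so that `g` is monotone). -/
def Interchange {P Q R X Y Z : GrSpecies} (A : Hom (Comp P Q) X) (B : Hom (Comp X R) Y)
    (C : Hom (Comp Q R) Z) (E : Hom (Comp P Z) Y) : Prop :=
  ∀ {I K L : Type} [Finite I] [Fintype K] [LinearOrder K] [Fintype L] [LinearOrder L]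
    (f : I → K) (g : K → L) (_ : Monotone g)
    {c s D : ℤ} {a t : L → ℤ} {b : K → ℤ}
    (h₁ : c + ∑ l, a l = s) (h₂ : s + ∑ k, b k = D)
    (h₃ : ∀ l, a l + ∑ k : {k // g k = l}, b k = t l) (h₄ : c + ∑ l, t l = D)
    (p : P.obj c L) (q : ∀ l, Q.obj (a l) {k // g k = l})
    (r : ∀ k, R.obj (b k) {i // f i = k}),
    B.app D I (Comp.mk f h₂ (A.app s K (Comp.mk g h₁ p q)) r) =
      (∏ l, ∏ k with g k < l, (a l * b k).negOnePow) •
        E.app D I (Comp.mk (g ∘ f) h₄ p (fun l =>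
          C.app (t l) _ (Comp.mk (levelMap f g l) (h₃ l) (q l) (fun k => R.map (b k) (levelFib f g l k) (r k)))))

/-- The data of an operad: a graded species `P`, a unit in `P({*})` of degree `0`, and `γ : P ∘ P ⟶ P`. -/
structure OperadData extends GrSpecies where
  one : obj 0 Unit
  γ : Hom (Comp toGrSpecies toGrSpecies) toGrSpecies

/-- The operad axioms: `P` is a monoid for the composite product of graded species. -/
structure OperadData.IsOperad (P : OperadData) : Prop where
  one_comp : ∀ {d : ℤ} {I : Type} [Finite I] (x : P.obj d I), P.γ.app d _ (insL P.one x) = x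
  comp_one : ∀ {d : ℤ} {K : Type} [Fintype K] [LinearOrder K] (x : P.obj d K),
    P.γ.app d _ (insR P.one x) = x
  assoc : Interchange P.γ P.γ P.γ P.γ

/-- A distributive law (in the sense of Beck) between operads `P` and `Q`, from `Q ∘ P` to `P ∘ Q`.
The datum is `law : Q ∘ P ⟶ P ∘ Q`. The other four morphisms are composites of structure maps with
associativity isomorphisms, and are determined by `law` through the equations stated for them:
* `R = (id_P ∘ γ_Q) α : (P ∘ Q) ∘ Q ⟶ P ∘ Q`;
* `L = (γ_P ∘ id_Q) α⁻¹ : P ∘ (P ∘ Q) ⟶ P ∘ Q`;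
* `Φ = R (law ∘ id_Q) α⁻¹ : Q ∘ (P ∘ Q) ⟶ P ∘ Q`;
* `Ψ = L (id_P ∘ law) α : (P ∘ Q) ∘ P ⟶ P ∘ Q`.

The axioms are the four diagrams of Beck: two for the units, and
`law (γ_Q ∘ id_P) = Φ (id_Q ∘ law) α` on `(Q ∘ Q) ∘ P`,
`law (id_Q ∘ γ_P) α = Ψ (law ∘ id_P)` on `(Q ∘ P) ∘ P`. -/
@[ext]
structure DistributiveLaw (P Q : OperadData) where
  law : Hom (Comp Q.toGrSpecies P.toGrSpecies) (Comp P.toGrSpecies Q.toGrSpecies)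
  R : Hom (Comp (Comp P.toGrSpecies Q.toGrSpecies) Q.toGrSpecies)
    (Comp P.toGrSpecies Q.toGrSpecies)
  L : Hom (Comp P.toGrSpecies (Comp P.toGrSpecies Q.toGrSpecies))
    (Comp P.toGrSpecies Q.toGrSpecies)
  Φ : Hom (Comp Q.toGrSpecies (Comp P.toGrSpecies Q.toGrSpecies))
    (Comp P.toGrSpecies Q.toGrSpecies)
  Ψ : Hom (Comp (Comp P.toGrSpecies Q.toGrSpecies) P.toGrSpecies)
    (Comp P.toGrSpecies Q.toGrSpecies)
  R_spec : Interchange (Hom.id _) R Q.γ (Hom.id _)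
  L_spec : Interchange P.γ (Hom.id _) (Hom.id _) L
  Φ_spec : Interchange law R (Hom.id _) Φ
  Ψ_spec : Interchange (Hom.id _) Ψ law L
  law_one_left : ∀ {d : ℤ} {K : Type} [Fintype K] [LinearOrder K] (x : P.obj d K),
    law.app d K (insL Q.one x) = insR Q.one x
  law_one_right : ∀ {d : ℤ} {K : Type} [Fintype K] [LinearOrder K] (y : Q.obj d K),
    law.app d K (insR P.one y) = insL P.one y
  law_comp_left : Interchange Q.γ law law Φ
  law_comp_right : Interchange law Ψ P.γ law

/-! ### Det -/

/-- `Det(I)`: the top exterior power of `ℚ I`, in degree `|I| - 1`; it is zero for `I = ∅` (there is no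
operation without inputs). -/
def detSub (d : ℤ) (I : Type) [Finite I] : Submodule ℚ (ExteriorAlgebra ℚ (I →₀ ℚ)) :=
  if 0 < Nat.card I ∧ d + 1 = Nat.card I then ⋀[ℚ]^(Nat.card I) (I →₀ ℚ) else ⊥

/-- The map induced on exterior algebras by a map of label sets. -/
def extMap {I J : Type} (u : I → J) :
    ExteriorAlgebra ℚ (I →₀ ℚ) →ₐ[ℚ] ExteriorAlgebra ℚ (J →₀ ℚ) :=
  ExteriorAlgebra.map (Finsupp.lmapDomain ℚ ℚ u)

lemma extMap_mem_pow {I J : Type} (u : I → J) (n : ℕ) {x : ExteriorAlgebra ℚ (I →₀ ℚ)}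
    (hx : x ∈ ⋀[ℚ]^n (I →₀ ℚ)) : extMap u x ∈ ⋀[ℚ]^n (J →₀ ℚ) := by
  have h := Submodule.mem_map_of_mem (f := (extMap u).toLinearMap) hx
  rw [Submodule.map_pow] at h
  refine (show _ ≤ (⋀[ℚ]^n (J →₀ ℚ)) from pow_le_pow_left' ?_ n) h
  rw [extMap]
  exact (ExteriorAlgebra.ι_range_map_map _).le.trans
    (Submodule.map_mono le_top |>.trans (by rw [Submodule.map_top]))

lemma extMap_comp {I J K : Type} (u : I → J) (v : J → K) (x : ExteriorAlgebra ℚ (I →₀ ℚ)) :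
    extMap v (extMap u x) = extMap (v ∘ u) x := by
  rw [extMap, extMap, extMap, Finsupp.lmapDomain_comp, ← ExteriorAlgebra.map_comp_map]
  rfl

lemma extMap_id {I : Type} (x : ExteriorAlgebra ℚ (I →₀ ℚ)) : extMap (fun i : I => i) x = x := by
  have : Finsupp.lmapDomain ℚ ℚ (fun i : I => i) = LinearMap.id := Finsupp.lmapDomain_id ℚ ℚ
  rw [extMap, this, ExteriorAlgebra.map_id]; rfl

lemma extMap_mem {d : ℤ} {I J : Type} [Finite I] [Finite J] (u : I ≃ J)
    {x : ExteriorAlgebra ℚ (I →₀ ℚ)} (hx : x ∈ detSub d I) : extMap u x ∈ detSub d J := by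
  unfold detSub at *
  rw [Nat.card_congr u] at hx
  split_ifs at hx ⊢ with h
  · exact extMap_mem_pow u _ hx
  · rw [Submodule.mem_bot] at hx ⊢
    rw [hx, map_zero]

/-- The graded species `I ↦ Det(I)`. -/
def detSpecies : GrSpecies where
  obj d I _ := detSub d I
  map _ _ _ _ _ u := (extMap u).toLinearMap.restrict (fun _ hx => extMap_mem u hx)
  map_refl _ _ _ x := Subtype.ext (extMap_id x.1)
  map_trans _ _ _ _ _ _ _ u v x := Subtype.ext (extMap_comp u v x.1).symm

/-- The coefficient of `0 ∧ 1 ∧ ⋯ ∧ (n-1)` in an element of the exterior algebra of `ℚ {0,…,n-1}`. -/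
def volCoeff (n : ℕ) : ExteriorAlgebra ℚ (Fin n →₀ ℚ) →ₗ[ℚ] ℚ :=
  ExteriorAlgebra.liftAlternating
    (Pi.single (M := fun i => (Fin n →₀ ℚ) [⋀^Fin i]→ₗ[ℚ] ℚ) n Finsupp.basisSingleOne.det)

/-! ### Gri -/

/-- Exchanging the two subtrees at the root of a planar binary tree. -/
inductive TreeStep (I : Type) : FreeMagma I → FreeMagma I → Prop
  | comm (x y : FreeMagma I) : TreeStep I (x * y) (y * x)

/-- Non-planar rooted binary trees with leaves labelled by elements of `I`: planar ones modulo
exchanging the two subtrees at any inner vertex. -/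
def BinTree (I : Type) : Type := (conGen (TreeStep I)).Quotient

namespace BinTree

variable {I J K : Type}

instance : CommMagma (BinTree I) where
  mul := ((inferInstance : Mul (conGen (TreeStep I)).Quotient)).mul
  mul_comm a b := by
    induction a using Quotient.inductionOn
    induction b using Quotient.inductionOn
    exact Quotient.sound (ConGen.Rel.of _ _ (TreeStep.comm _ _))

/-- The tree without inner vertex. -/
def leaf (i : I) : BinTree I := Quotient.mk _ (FreeMagma.of i)

def lift {M : Type} [CommMagma M] (φ : I → M) : BinTree I →ₙ* M where
  toFun := Quotient.lift (FreeMagma.lift φ) (fun a b h => by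
    have : conGen (TreeStep I) ≤ Con.ker (FreeMagma.lift φ) := by
      apply Con.conGen_le.2
      rintro _ _ ⟨x, y⟩
      simp [Con.ker_rel, mul_comm]
    exact this h)
  map_mul' a b := by
    induction a using Quotient.inductionOn
    induction b using Quotient.inductionOn
    exact map_mul (FreeMagma.lift φ) _ _

@[simp] lemma lift_leaf {M : Type} [CommMagma M] (φ : I → M) (i : I) : lift φ (leaf i) = φ i := rfl

lemma induct {C : BinTree I → Prop} (leaf : ∀ i, C (leaf i))
    (mul : ∀ s t, C s → C t → C (s * t)) (t : BinTree I) : C t := by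
  induction t using Quotient.inductionOn with | _ a
  induction a using FreeMagma.recOnMul with
  | ih1 i => exact leaf i
  | ih2 x y hx hy => exact mul _ _ hx hy

/-- The multiset of the labels of the leaves. -/
def leaves (t : BinTree I) : Multiset I := (lift (fun i => Multiplicative.ofAdd {i}) t).toAdd

@[simp] lemma leaves_leaf (i : I) : leaves (leaf i) = {i} := rfl
@[simp] lemma leaves_mul (s t : BinTree I) : leaves (s * t) = leaves s + leaves t := by
  simp [leaves]

/-- Grafting of trees `S k` on the leaves of `T`. -/
def graft (T : BinTree K) (S : K → BinTree I) : BinTree I := lift S T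

@[simp] lemma graft_leaf (k : K) (S : K → BinTree I) : graft (leaf k) S = S k := rfl
@[simp] lemma graft_mul (s t : BinTree K) (S : K → BinTree I) :
    graft (s * t) S = graft s S * graft t S := map_mul _ _ _

lemma leaves_graft (T : BinTree K) (S : K → BinTree I) :
    leaves (graft T S) = (leaves T).bind (fun k => leaves (S k)) := by
  induction T using induct with
  | leaf i => simp
  | mul s t hs ht => simp [hs, ht]

lemma graft_graft (T : BinTree K) (S : K → BinTree J) (R : J → BinTree I) :
    graft (graft T S) R = graft T (fun k => graft (S k) R) := by
  induction T using induct with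
  | leaf i => simp
  | mul s t hs ht => simp [hs, ht]

lemma graft_leaf_right (T : BinTree I) : graft T leaf = T := by
  induction T using induct with
  | leaf i => simp
  | mul s t hs ht => simp [hs, ht]

/-- Change of the labels of the leaves. -/
def relabel (u : I → J) (t : BinTree I) : BinTree J := graft t (fun i => leaf (u i))

lemma leaves_relabel (u : I → J) (t : BinTree I) : leaves (relabel u t) = (leaves t).map u := by
  simp [relabel, leaves_graft, Multiset.bind_singleton]

end BinTree

/-- Rooted binary trees whose leaves are labelled bijectively by `I`, placed in degree `0`
(there is none in the other degrees). -/
def LTree (d : ℤ) (I : Type) : Type :=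
  {t : BinTree I // t.leaves.Nodup ∧ (∀ i, i ∈ t.leaves) ∧ d = 0}

def LTree.map {d : ℤ} {I J : Type} (u : I ≃ J) (t : LTree d I) : LTree d J :=
  ⟨t.1.relabel u, by
    rw [BinTree.leaves_relabel]
    exact ⟨t.2.1.map u.injective, fun j => Multiset.mem_map.2 ⟨u.symm j, t.2.2.1 _, by simp⟩,
      t.2.2.2⟩⟩

/-- Grafting of bijectively labelled trees on the leaves of such a tree. -/
def LTree.graft {D : ℤ} {I : Type} (x : CompIdx D I) (T : LTree x.e (Fin x.n))
    (S : ∀ k, LTree (x.d k) {i // x.f i = k}) : LTree D I :=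
  ⟨T.1.graft (fun k => (S k).1.relabel Subtype.val), by
    have hS : ∀ k i, i ∈ ((S k).1.relabel Subtype.val).leaves ↔ x.f i = k := by
      intro k i
      rw [BinTree.leaves_relabel, Multiset.mem_map]
      exact ⟨by rintro ⟨a, _, rfl⟩; exact a.2, fun h => ⟨⟨i, h⟩, (S k).2.2.1 _, rfl⟩⟩
    rw [BinTree.leaves_graft]
    refine ⟨Multiset.nodup_bind.2 ⟨fun k _ => ?_, ?_⟩, fun i => Multiset.mem_bind.2
      ⟨x.f i, T.2.2.1 _, (hS _ _).2 rfl⟩, ?_⟩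
    · rw [BinTree.leaves_relabel]
      exact (S k).2.1.map Subtype.val_injective
    · refine T.2.1.pairwise ?_
      intro a _ b _ hab
      rw [Function.onFun, Multiset.disjoint_left]
      intro i hi hi'
      exact hab (((hS _ _).1 hi).symm.trans ((hS _ _).1 hi'))
    · have := x.deg
      simpa [T.2.2.2, (S _).2.2.2] using this.symm⟩

/-- The graded species with basis the rooted binary trees with leaves labelled by `I`, in degree `0`. -/
def griSpecies : GrSpecies where
  obj d I _ := LTree d I →₀ ℚ
  map d _ _ _ _ u := Finsupp.lmapDomain ℚ ℚ (LTree.map u)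
  map_refl d I _ x := by
    have : LTree.map (d := d) (Equiv.refl I) = id := by
      funext t; exact Subtype.ext (BinTree.graft_leaf_right t.1)
    rw [this, Finsupp.lmapDomain_id]; rfl
  map_trans d I J K _ _ _ u v x := by
    have : LTree.map (d := d) (u.trans v) = LTree.map v ∘ LTree.map u := by
      funext t
      apply Subtype.ext
      simp [LTree.map, BinTree.relabel, BinTree.graft_graft]
    rw [this, Finsupp.lmapDomain_comp]; rfl


/-- The underlying space of formal linear combinations of trees. -/
def griEquiv (d : ℤ) (I : Type) [Finite I] : griSpecies.obj d I ≃ₗ[ℚ] (LTree d I →₀ ℚ) :=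
  LinearEquiv.refl ℚ _

/-- The basis vector of a tree. -/
def griTree {d : ℤ} {I : Type} [Finite I] (T : LTree d I) : griSpecies.obj d I :=
  (griEquiv d I).symm (Finsupp.single T 1)

lemma griEquiv_griTree {d : ℤ} {I : Type} [Finite I] (T : LTree d I) :
    griEquiv d I (griTree T) = Finsupp.single T 1 := rfl

lemma griSpecies_map_griTree {d : ℤ} {I J : Type} [Finite I] [Finite J] (u : I ≃ J)
    (T : LTree d I) : griSpecies.map d u (griTree T) = griTree (T.map u) :=
  Finsupp.mapDomain_single

open Classical in
/-- The linear extension of grafting. -/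
def griComp {D : ℤ} {I : Type} [Finite I] (x : CompIdx D I) :
    CompSummand griSpecies griSpecies x →ₗ[ℚ] griSpecies.obj D I :=
  (griEquiv D I).symm.toLinearMap ∘ₗ
    Finsupp.lmapDomain ℚ ℚ
      (fun w : LTree x.e (Fin x.n) × (∀ k, LTree (x.d k) {i // x.f i = k}) =>
        LTree.graft x w.1 w.2) ∘ₗ
    (finsuppTensorFinsupp' ℚ _ _).toLinearMap ∘ₗ
    TensorProduct.map (griEquiv x.e (Fin x.n)).toLinearMap
      ((PiTensorProduct.ofFinsuppEquiv' (R := ℚ)).toLinearMap ∘ₗ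
        PiTensorProduct.map (fun k => (griEquiv (x.d k) {i // x.f i = k}).toLinearMap))

lemma griComp_griTree {D : ℤ} {I : Type} [Finite I] (x : CompIdx D I) (T : LTree x.e (Fin x.n))
    (S : ∀ k, LTree (x.d k) {i // x.f i = k}) :
    griComp x (griTree T ⊗ₜ[ℚ] PiTensorProduct.tprod ℚ (fun k => griTree (S k)))
      = griTree (LTree.graft x T S) := by
  classical
  simp only [griComp, LinearMap.comp_apply, TensorProduct.map_tmul, LinearEquiv.coe_coe,
    PiTensorProduct.map_tprod, griEquiv_griTree]
  rw [PiTensorProduct.ofFinsuppEquiv'_tprod_single, finsuppTensorFinsupp'_single_tmul_single]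
  simp [griTree]

lemma gri_ext {D : ℤ} {I : Type} [Finite I] (x : CompIdx D I) {M : Type} [AddCommGroup M]
    [Module ℚ M] {F G : CompSummand griSpecies griSpecies x →ₗ[ℚ] M}
    (h : ∀ (T : LTree x.e (Fin x.n)) (S : ∀ k, LTree (x.d k) {i // x.f i = k}),
      F (griTree T ⊗ₜ[ℚ] PiTensorProduct.tprod ℚ (fun k => griTree (S k)))
      = G (griTree T ⊗ₜ[ℚ] PiTensorProduct.tprod ℚ (fun k => griTree (S k)))) : F = G := by
  apply TensorProduct.ext
  apply Finsupp.lhom_ext'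
  intro T
  apply LinearMap.ext_ring
  apply PiTensorProduct.ext
  apply Module.Basis.ext_multilinear (fun k => Finsupp.basisSingleOne (R := ℚ)
    (ι := LTree (x.d k) {i // x.f i = k}))
  intro S
  simp only [Finsupp.coe_basisSingleOne]
  exact h T S

/-- The composition of `Gri`, given by grafting. -/
def griOperadComp : Hom (Comp griSpecies griSpecies) griSpecies :=
  Comp.lift (fun _ _ _ x => griComp x)
    (by
      intro D I _ x a b hab p q
      have key : griComp (x.perm (Equiv.swap a b)) ∘ₗ
          TensorProduct.map (griSpecies.map x.e (Equiv.swap a b))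
            (PiTensorProduct.map (fun k => griSpecies.map _ (x.permFib (Equiv.swap a b) k)) ∘ₗ
              (PiTensorProduct.reindex ℚ (fun k => griSpecies.obj (x.d k) {i // x.f i = k})
                (Equiv.swap a b)).toLinearMap)
          = (x.d a * x.d b).negOnePow • griComp x := by
        apply gri_ext
        intro T S
        have h0 : x.d a = 0 := (S a).2.2.2
        rw [h0, zero_mul, Int.negOnePow_zero, one_smul, griComp_griTree]
        simp only [LinearMap.comp_apply, TensorProduct.map_tmul, LinearEquiv.coe_coe,
          PiTensorProduct.reindex_tprod, PiTensorProduct.map_tprod, griSpecies_map_griTree]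
        refine (griComp_griTree (x.perm (Equiv.swap a b)) _ _).trans ?_
        congr 1
        apply Subtype.ext
        have hS : ∀ k k', k' = k → (S k').1.graft (fun i => BinTree.leaf i.1)
            = (S k).1.graft (fun i => BinTree.leaf i.1) := by rintro k _ rfl; rfl
        simp only [LTree.graft, LTree.map, BinTree.relabel, BinTree.graft_graft,
          BinTree.graft_leaf]
        congr 1
        funext k
        exact hS k _ ((Equiv.swap a b).symm_apply_apply k)
      have := LinearMap.congr_fun key (p ⊗ₜ[ℚ] PiTensorProduct.tprod ℚ q)
      simp only [LinearMap.comp_apply, TensorProduct.map_tmul, LinearEquiv.coe_coe,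
          PiTensorProduct.reindex_tprod, PiTensorProduct.map_tprod] at this
      exact this)
    (by
      intro D I J _ _ u x p q
      have key : griComp (x.map u) ∘ₗ TensorProduct.map LinearMap.id
            (PiTensorProduct.map (fun k => griSpecies.map (x.d k) (x.mapFib u k)))
          = griSpecies.map D u ∘ₗ griComp x := by
        apply gri_ext x
        intro T S
        rw [LinearMap.comp_apply, LinearMap.comp_apply, griComp_griTree]
        simp only [TensorProduct.map_tmul, PiTensorProduct.map_tprod, LinearMap.id_apply,
          griSpecies_map_griTree]
        refine (griComp_griTree (x.map u) _ _).trans ?_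
        congr 1
        apply Subtype.ext
        simp [LTree.graft, LTree.map, BinTree.relabel, BinTree.graft_graft, CompIdx.mapFib]
      have := LinearMap.congr_fun key (p ⊗ₜ[ℚ] PiTensorProduct.tprod ℚ q)
      simp only [LinearMap.comp_apply, TensorProduct.map_tmul, PiTensorProduct.map_tprod,
        LinearMap.id_apply] at this
      exact this)

/-- The operad `Gri` of commutative non-associative algebras. -/
def Gri : OperadData where
  toGrSpecies := griSpecies
  one := griTree ⟨BinTree.leaf (), by simp⟩
  γ := griOperadComp


/-- The underlying element of the exterior algebra. -/
def detVal (d : ℤ) (I : Type) [Finite I] :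
    detSpecies.obj d I →ₗ[ℚ] ExteriorAlgebra ℚ (I →₀ ℚ) := (detSub d I).subtype

lemma detVal_injective {d : ℤ} {I : Type} [Finite I] : Function.Injective (detVal d I) :=
  Subtype.val_injective

lemma detVal_map {d : ℤ} {I J : Type} [Finite I] [Finite J] (u : I ≃ J)
    (x : detSpecies.obj d I) : detVal d J (detSpecies.map d u x) = extMap u (detVal d I x) := rfl

lemma detVal_cases {d : ℤ} {I : Type} [Finite I] (x : detSpecies.obj d I) :
    (0 < Nat.card I ∧ d + 1 = Nat.card I ∧ detVal d I x ∈ ⋀[ℚ]^(Nat.card I) (I →₀ ℚ)) ∨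
      detVal d I x = 0 := by
  have hx : detVal d I x ∈ detSub d I := x.2
  unfold detSub at hx
  split_ifs at hx with h
  · exact Or.inl ⟨h.1, h.2, hx⟩
  · exact Or.inr ((Submodule.mem_bot ℚ).1 hx)

/-- The ordered product of the images. -/
def detProd {D : ℤ} {I : Type} [Finite I] (x : CompIdx D I) :
    (⨂[ℚ] k, detSpecies.obj (x.d k) {i // x.f i = k}) →ₗ[ℚ] ExteriorAlgebra ℚ (I →₀ ℚ) :=
  PiTensorProduct.lift ((MultilinearMap.mkPiAlgebraFin ℚ x.n (ExteriorAlgebra ℚ (I →₀ ℚ))).compLinearMap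
    (fun k => (extMap Subtype.val).toLinearMap ∘ₗ detVal (x.d k) {i // x.f i = k}))

lemma detProd_tprod {D : ℤ} {I : Type} [Finite I] (x : CompIdx D I)
    (y : ∀ k, detSpecies.obj (x.d k) {i // x.f i = k}) :
    detProd x (PiTensorProduct.tprod ℚ y) =
      (List.ofFn (fun k => extMap Subtype.val (detVal (x.d k) {i // x.f i = k} (y k)))).prod := by
  simp [detProd]

/-- The sign `(-1)^{∑_k (n-1-k) d_k}`. -/
def detSign {D : ℤ} {I : Type} (x : CompIdx D I) : ℤˣ :=
  (∑ k : Fin x.n, ((x.n : ℤ) - 1 - k) * x.d k).negOnePow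

/-- The composition of `Det`: for `p = c • 0 ∧ 1 ∧ ⋯ ∧ (n-1)` and `y_k` of degree `d_k`,
`γ(p; y_0, …, y_{n-1}) = c (-1)^{∑_k (n-1-k) d_k} y_0 ∧ ⋯ ∧ y_{n-1}`.
Taking all `y_k` but one to be units and moving the remaining input to the end of the exterior
product, this says `(x ∧ ⋆) ∘_⋆ y = x ∧ y`; conversely it is the iteration of that rule. -/
def detCompVal {D : ℤ} {I : Type} [Finite I] (x : CompIdx D I) :
    CompSummand detSpecies detSpecies x →ₗ[ℚ] ExteriorAlgebra ℚ (I →₀ ℚ) :=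
  detSign x • TensorProduct.lift ((LinearMap.lsmul ℚ (ExteriorAlgebra ℚ (I →₀ ℚ)) ∘ₗ
    volCoeff x.n ∘ₗ detVal x.e (Fin x.n)).compl₂ (detProd x))

lemma detCompVal_tmul {D : ℤ} {I : Type} [Finite I] (x : CompIdx D I)
    (p : detSpecies.obj x.e (Fin x.n)) (y : ∀ k, detSpecies.obj (x.d k) {i // x.f i = k}) :
    detCompVal x (p ⊗ₜ[ℚ] PiTensorProduct.tprod ℚ y) =
      detSign x • volCoeff x.n (detVal x.e (Fin x.n) p) •
      (List.ofFn (fun k => extMap Subtype.val (detVal (x.d k) {i // x.f i = k} (y k)))).prod := by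
  rw [← detProd_tprod]
  rfl

lemma list_ofFn_prod_mem_pow {A : Type} [Ring A] [Algebra ℚ A] (M : Submodule ℚ A) {n : ℕ}
    (v : Fin n → A) (m : Fin n → ℕ) (h : ∀ k, v k ∈ M ^ m k) :
    (List.ofFn v).prod ∈ M ^ (∑ k, m k) := by
  induction n with
  | zero => simp [Submodule.one_le.1 (le_refl (1 : Submodule ℚ A))]
  | succ n ih =>
    rw [List.ofFn_succ, List.prod_cons, Fin.sum_univ_succ, pow_add]
    exact Submodule.mul_mem_mul (h 0) (ih _ _ (fun k => h k.succ))

lemma detCompVal_mem {D : ℤ} {I : Type} [Finite I] (x : CompIdx D I)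
    (t : CompSummand detSpecies detSpecies x) : detCompVal x t ∈ detSub D I := by
  induction t using TensorProduct.induction_on with
  | zero => rw [map_zero]; exact zero_mem _
  | add s t hs ht => rw [map_add]; exact add_mem hs ht
  | tmul p t =>
  induction t using PiTensorProduct.induction_on with
  | add s t hs ht => rw [TensorProduct.tmul_add, map_add]; exact add_mem hs ht
  | smul_tprod r y =>
  rw [TensorProduct.tmul_smul, map_smul]
  refine Submodule.smul_mem _ _ ?_
  rw [detCompVal_tmul, Units.smul_def]
  refine zsmul_mem ?_ _
  rcases detVal_cases p with ⟨hn, he, -⟩ | hp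
  · by_cases hy : ∃ k, detVal (x.d k) {i // x.f i = k} (y k) = 0
    · obtain ⟨k, hk⟩ := hy
      rw [List.prod_eq_zero, smul_zero]
      · exact zero_mem _
      · rw [List.mem_ofFn]
        exact ⟨k, by rw [hk, map_zero]⟩
    · push Not at hy
      have hy' := fun k => (detVal_cases (y k)).resolve_right (hy k)
      have hcard : Nat.card I = ∑ k, Nat.card {i // x.f i = k} := by
        rw [← Nat.card_sigma]
        exact Nat.card_congr (Equiv.sigmaFiberEquiv x.f).symm
      have hD : 0 < Nat.card I ∧ D + 1 = Nat.card I := by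
        rw [Nat.card_fin] at hn he
        have h1 : D + 1 = Nat.card I := by
          have h2 : ((∑ k, Nat.card {i // x.f i = k} : ℕ) : ℤ) = ∑ k, (x.d k + 1) := by
            push_cast
            exact Finset.sum_congr rfl (fun k _ => (hy' k).2.1.symm)
          have h3 := x.deg
          rw [hcard, h2, Finset.sum_add_distrib]
          simp
          omega
        refine ⟨?_, h1⟩
        rw [hcard]
        exact Finset.sum_pos (fun k _ => (hy' k).1) ⟨⟨0, hn⟩, Finset.mem_univ _⟩
      unfold detSub
      rw [if_pos hD]
      refine Submodule.smul_mem _ _ ?_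
      rw [hcard]
      exact list_ofFn_prod_mem_pow _ _ _ (fun k => extMap_mem_pow _ _ (hy' k).2.2)
  · rw [hp, map_zero, zero_smul]
    exact zero_mem _

/-- The composition of `Det` on a summand. -/
def detComp {D : ℤ} {I : Type} [Finite I] (x : CompIdx D I) :
    CompSummand detSpecies detSpecies x →ₗ[ℚ] detSpecies.obj D I :=
  (detCompVal x).codRestrict (detSub D I) (detCompVal_mem x)

lemma detVal_detComp {D : ℤ} {I : Type} [Finite I] (x : CompIdx D I)
    (t : CompSummand detSpecies detSpecies x) : detVal D I (detComp x t) = detCompVal x t := rfl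

lemma list_ofFn_swap_prod {A : Type} [Ring A] (ε : ℤˣ) {n : ℕ} (v : Fin n → A) (a b : Fin n)
    (hab : a.val + 1 = b.val) (h : v b * v a = ε • (v a * v b)) :
    (List.ofFn (fun k => v (Equiv.swap a b k))).prod = ε • (List.ofFn v).prod := by
  induction n with
  | zero => exact a.elim0
  | succ n ih =>
    obtain ⟨b, rfl⟩ : ∃ b' : Fin n, b = b'.succ := by
      refine ⟨⟨b.val - 1, by omega⟩, ?_⟩
      ext; simp; omega
    rw [List.ofFn_succ, List.prod_cons, List.ofFn_succ (f := v), List.prod_cons]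
    induction a using Fin.cases with
    | zero =>
      obtain ⟨n, rfl⟩ : ∃ m, n = m + 1 := ⟨n - 1, by have := b.2; omega⟩
      obtain rfl : b = 0 := by ext; simp at hab ⊢; omega
      rw [List.ofFn_succ, List.prod_cons, List.ofFn_succ (f := fun i => v i.succ), List.prod_cons,
        Equiv.swap_apply_left, Equiv.swap_apply_right, ← mul_assoc, h, ← mul_assoc,
        smul_mul_assoc]
      congr 4
    | succ a =>
      have h0 : Equiv.swap a.succ b.succ 0 = 0 :=
        Equiv.swap_apply_of_ne_of_ne (Fin.succ_ne_zero _).symm (Fin.succ_ne_zero _).symm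
      have h1 : ∀ k : Fin n, Equiv.swap a.succ b.succ k.succ = (Equiv.swap a b k).succ := by
        intro k
        exact (Fin.succ_injective n).swap_apply a b k
      simp only [h0, h1]
      rw [ih (fun k => v k.succ) a b (by simpa using hab) h, mul_smul_comm]

lemma ext_comm {M : Type} [AddCommGroup M] [Module ℚ M] {m n : ℕ} {x y : ExteriorAlgebra ℚ M}
    (hx : x ∈ ⋀[ℚ]^m M) (hy : y ∈ ⋀[ℚ]^n M) :
    y * x = ((m * n : ℕ) : ℤ).negOnePow • (x * y) := by
  have h1 : ∀ w : M, ∀ (n : ℕ) (y : ExteriorAlgebra ℚ M), y ∈ ⋀[ℚ]^n M →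
      y * ExteriorAlgebra.ι ℚ w = (n : ℤ).negOnePow • (ExteriorAlgebra.ι ℚ w * y) := by
    intro w n y hy
    induction hy using Submodule.pow_induction_on_left' with
    | algebraMap r => simp [Algebra.commutes]
    | add x y i hx hy h1 h2 => rw [add_mul, h1, h2, mul_add, smul_add]
    | mem_mul m hm i x hx h =>
      obtain ⟨m, rfl⟩ := hm
      have := eq_neg_of_add_eq_zero_left (ExteriorAlgebra.ι_add_mul_swap (R := ℚ) m w)
      rw [mul_assoc, h, mul_smul_comm, ← mul_assoc, this]
      push_cast
      rw [Int.negOnePow_succ]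
      simp [Units.smul_def, mul_assoc]
  induction hx using Submodule.pow_induction_on_left' with
  | algebraMap r => simp [Algebra.commutes]
  | add x y i hx hy h1 h2 => rw [add_mul, mul_add, h1, h2, smul_add]
  | mem_mul w hw i x hx h =>
    obtain ⟨w, rfl⟩ := hw
    rw [← mul_assoc, h1 w n y hy, smul_mul_assoc, mul_assoc, h, mul_smul_comm, mul_assoc, smul_smul,
      ← Int.negOnePow_add]
    congr 2
    push_cast
    ring

lemma volCoeff_swap (n : ℕ) (a b : Fin n) (hab : a ≠ b) (x : ExteriorAlgebra ℚ (Fin n →₀ ℚ)) :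
    volCoeff n (extMap (Equiv.swap a b) x) = - volCoeff n x := by
  have : volCoeff n ∘ₗ (extMap (Equiv.swap a b)).toLinearMap = - volCoeff n := by
    apply ExteriorAlgebra.lhom_ext
    intro i
    ext v
    simp only [LinearMap.compAlternatingMap_apply, LinearMap.comp_apply, AlgHom.toLinearMap_apply,
      LinearMap.neg_apply, extMap, ExteriorAlgebra.map_apply_ιMulti, volCoeff,
      ExteriorAlgebra.liftAlternating_apply_ιMulti]
    by_cases hi : i = n
    · subst hi
      rw [Pi.single_eq_same]
      have key := AlternatingMap.eq_smul_basis_det (Finsupp.basisSingleOne (R := ℚ) (ι := Fin i))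
        ((Finsupp.basisSingleOne (R := ℚ) (ι := Fin i)).det.compLinearMap
          (Finsupp.lmapDomain ℚ ℚ (Equiv.swap a b)))
      have h1 : ((Finsupp.basisSingleOne (R := ℚ) (ι := Fin i)).det.compLinearMap
          (Finsupp.lmapDomain ℚ ℚ (Equiv.swap a b))) (Finsupp.basisSingleOne (R := ℚ)) = -1 := by
        have h2 : (fun k => Finsupp.lmapDomain ℚ ℚ (Equiv.swap a b)
            (Finsupp.basisSingleOne (R := ℚ) (ι := Fin i) k))
            = (Finsupp.basisSingleOne (R := ℚ) (ι := Fin i)) ∘ Equiv.swap a b := by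
          funext k; simp [Finsupp.mapDomain_single]
        rw [AlternatingMap.compLinearMap_apply]
        change (Finsupp.basisSingleOne (R := ℚ) (ι := Fin i)).det
          (fun k => Finsupp.lmapDomain ℚ ℚ (Equiv.swap a b)
            (Finsupp.basisSingleOne (R := ℚ) (ι := Fin i) k)) = -1
        rw [h2, AlternatingMap.map_swap _ _ hab, Module.Basis.det_self]
      rw [h1] at key
      have h3 := congrArg (fun g => g v) key
      rw [neg_one_smul] at h3
      exact h3
    · rw [Pi.single_eq_of_ne hi]; simp
  exact LinearMap.congr_fun this x

/-- The composition of `Det`. -/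
def detOperadComp : Hom (Comp detSpecies detSpecies) detSpecies :=
  Comp.lift (fun _ _ _ x => detComp x)
    (by
      intro D I _ x a b hab p q
      apply detVal_injective
      rw [Units.smul_def, map_zsmul, ← Units.smul_def, detVal_detComp, detVal_detComp,
        detCompVal_tmul, detCompVal_tmul]
      set v : Fin x.n → ExteriorAlgebra ℚ (I →₀ ℚ) :=
        fun k => extMap Subtype.val (detVal (x.d k) {i // x.f i = k} (q k)) with hv
      have hne : a ≠ b := by rintro rfl; omega
      have e1 : ∀ k, extMap Subtype.val (detVal _ _ (detSpecies.map _
          (x.permFib (Equiv.swap a b) k) (q ((Equiv.swap a b).symm k)))) = v (Equiv.swap a b k) := by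
        intro k
        rw [detVal_map, extMap_comp]
        rfl
      have e2 : v b * v a = ((x.d a + 1) * (x.d b + 1)).negOnePow • (v a * v b) := by
        rcases detVal_cases (q a) with ⟨-, ha, ha'⟩ | ha
        · rcases detVal_cases (q b) with ⟨-, hb, hb'⟩ | hb
          · rw [ha, hb, ← Nat.cast_mul]
            exact ext_comm (extMap_mem_pow _ _ ha') (extMap_mem_pow _ _ hb')
          · simp [hv, hb]
        · simp [hv, ha]
      have e3 := list_ofFn_swap_prod _ v a b hab e2
      have e4 : detSign (x.perm (Equiv.swap a b)) = (x.d a + x.d b).negOnePow * detSign x := by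
        unfold detSign
        rw [← Int.negOnePow_add, Int.negOnePow_eq_iff]
        have h1 : ∑ k : Fin x.n, ((x.n : ℤ) - 1 - k) * x.d ((Equiv.swap a b).symm k)
            = ∑ k : Fin x.n, ((x.n : ℤ) - 1 - (Equiv.swap a b k : Fin x.n)) * x.d k := by
          rw [← Equiv.sum_comp (Equiv.swap a b)]
          simp only [Equiv.symm_apply_apply]
        have h2 : ∑ k : Fin x.n, (((k : Fin x.n) : ℤ) - (Equiv.swap a b k : Fin x.n)) * x.d k
            = x.d b - x.d a := by
          rw [Finset.sum_eq_add_of_mem a b (Finset.mem_univ _) (Finset.mem_univ _) hne]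
          · rw [Equiv.swap_apply_left, Equiv.swap_apply_right, ← hab]
            push_cast
            ring
          · intro c _ hc
            rw [Equiv.swap_apply_of_ne_of_ne hc.1 hc.2, sub_self, zero_mul]
        have h3 : ∑ k : Fin x.n, ((x.n : ℤ) - 1 - (Equiv.swap a b k : Fin x.n)) * x.d k
            = ∑ k : Fin x.n, ((x.n : ℤ) - 1 - k) * x.d k + (x.d b - x.d a) := by
          rw [← h2, ← Finset.sum_add_distrib]
          exact Finset.sum_congr rfl (fun k _ => by ring)
        have h4 : ∑ k, ((x.n : ℤ) - 1 - k) * (x.d ∘ (Equiv.swap a b).symm) k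
            = ∑ k : Fin x.n, ((x.n : ℤ) - 1 - k) * x.d k + (x.d b - x.d a) := h1.trans h3
        rw [h4]
        exact ⟨- x.d a, by ring⟩
      rw [detVal_map, volCoeff_swap _ _ _ hne]
      refine (congrArg (fun z : ExteriorAlgebra ℚ (I →₀ ℚ) => detSign (x.perm (Equiv.swap a b)) •
        (-(volCoeff x.n (detVal x.e (Fin x.n) p))) • z)
        ((congrArg List.prod (congrArg List.ofFn (funext e1))).trans e3)).trans ?_
      have e5 : (x.d a + x.d b).negOnePow * ((x.d a + 1) * (x.d b + 1)).negOnePow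
          = - (x.d a * x.d b).negOnePow := by
        rw [← Int.negOnePow_add, ← Int.negOnePow_succ, Int.negOnePow_eq_iff]
        exact ⟨x.d a + x.d b, by ring⟩
      rw [e4, smul_comm (-(_ : ℚ)) (_ : ℤˣ), smul_smul, mul_right_comm, e5, neg_mul, Units.neg_smul,
        neg_smul, smul_neg, neg_neg, mul_smul])
    (by
      intro D I J _ _ u x p q
      apply detVal_injective
      rw [detVal_map, detVal_detComp, detVal_detComp, detCompVal_tmul, detCompVal_tmul,
        Units.smul_def, Units.smul_def, map_zsmul, map_smul, map_list_prod, List.map_ofFn]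
      refine congrArg (fun z : ExteriorAlgebra ℚ (J →₀ ℚ) => ((detSign x : ℤˣ) : ℤ) •
        (volCoeff x.n (detVal x.e (Fin x.n) p)) • z)
        (congrArg List.prod (congrArg List.ofFn (funext fun k => ?_)))
      rw [detVal_map, extMap_comp, Function.comp_apply, extMap_comp]
      rfl)

/-- The suspended commutative associative operad `Det`. -/
def Det : OperadData where
  toGrSpecies := detSpecies
  one := ⟨ExteriorAlgebra.ι ℚ (Finsupp.single () 1), by
    rw [detSub, if_pos (by simp)]; simp⟩
  γ := detOperadComp


/-! ### Generators and the rewriting rule -/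

/-- `I = {i, j}` with `i ≠ j`. -/
def IsPair {I : Type} (i j : I) : Prop := i ≠ j ∧ ∀ a : I, a = i ∨ a = j

/-- `I = {i, j, k}` with `i`, `j`, `k` pairwise different. -/
structure IsTriple {I : Type} (i j k : I) : Prop where
  ij : i ≠ j
  ik : i ≠ k
  jk : j ≠ k
  all : ∀ a : I, a = i ∨ a = j ∨ a = k

lemma IsPair.card {I : Type} {i j : I} (h : IsPair i j) : Nat.card I = 2 := by
  rw [Nat.card_eq_two_iff]
  refine ⟨i, j, h.1, ?_⟩
  ext a
  simpa using h.2 a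

lemma isPair_bool : IsPair false true := ⟨by simp, by simp⟩

lemma IsTriple.pair₁ {I : Type} {i j k : I} (h : IsTriple i j k) :
    IsPair (⟨j, h.ij.symm⟩ : {a // a ≠ i}) ⟨k, h.ik.symm⟩ :=
  ⟨fun e => h.jk (congrArg Subtype.val e), fun a => by
    rcases h.all a.1 with e | e | e
    · exact absurd e a.2
    · exact Or.inl (Subtype.ext e)
    · exact Or.inr (Subtype.ext e)⟩

lemma IsTriple.pair₂ {I : Type} {i j k : I} (h : IsTriple i j k) :
    IsPair (⟨i, h.ij⟩ : {a // a ≠ j}) ⟨k, h.jk.symm⟩ :=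
  ⟨fun e => h.ik (congrArg Subtype.val e), fun a => by
    rcases h.all a.1 with e | e | e
    · exact Or.inl (Subtype.ext e)
    · exact absurd e a.2
    · exact Or.inr (Subtype.ext e)⟩

lemma IsTriple.pair₃ {I : Type} {i j k : I} (h : IsTriple i j k) :
    IsPair (⟨i, h.ik⟩ : {a // a ≠ k}) ⟨j, h.jk⟩ :=
  ⟨fun e => h.ij (congrArg Subtype.val e), fun a => by
    rcases h.all a.1 with e | e | e
    · exact Or.inl (Subtype.ext e)
    · exact Or.inr (Subtype.ext e)
    · exact absurd e a.2⟩

/-- The generator `e_{i,j} = i ∧ j` of `Det`, of degree `1`. -/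
def eGen {I : Type} [Finite I] (i j : I) (h : IsPair i j) : Det.obj 1 I :=
  ⟨ExteriorAlgebra.ι ℚ (Finsupp.single i 1) * ExteriorAlgebra.ι ℚ (Finsupp.single j 1), by
    rw [detSub, h.card, if_pos (by norm_num)]
    change _ ∈ LinearMap.range (ExteriorAlgebra.ι ℚ) ^ 2
    rw [pow_two]
    exact Submodule.mul_mem_mul (LinearMap.mem_range_self _ _) (LinearMap.mem_range_self _ _)⟩

/-- The generator `ω_{i,j}` of `Gri`, of degree `0`: the tree with the two leaves `i` and `j`. -/
def omegaGen {I : Type} [Finite I] (i j : I) (h : IsPair i j) : Gri.obj 0 I :=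
  griTree ⟨BinTree.leaf i * BinTree.leaf j, by
    simpa using ⟨h.1, h.2⟩⟩

open Classical in
/-- The element `x_{i,⋆} ∘_⋆ y` of `(P ∘ Q)(I)`, for `x` with two inputs and `y` with inputs
`I \ {i}`. The two inputs of `x` are written `false` (for `i`) and `true` (for `⋆`), and `o` is the
unit of `Q`, which is put into the input `i`. -/
def twoStep {P Q : GrSpecies} (o : Q.obj 0 Unit) {c e D : ℤ} (h : c + e = D) {I : Type} [Finite I]
    (i : I) (x : P.obj c Bool) (y : Q.obj e {a : I // a ≠ i}) : (Comp P Q).obj D I :=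
  Comp.mk (K := Bool) (fun a : I => decide (a ≠ i)) (d := fun b => match b with
      | false => 0
      | true => e) (by simpa using h) x
    (fun b => match b with
      | false => Q.map 0 ((Equiv.ofUnique Unit {a : I // a = i}).trans
          (Equiv.subtypeEquivRight (fun a => by simp))) o
      | true => Q.map e (Equiv.subtypeEquivRight (fun a => by simp)) y)

/-- The morphism `φ : Gri ∘ Det ⟶ Det ∘ Gri` satisfies
`φ (ω_{i,⋆} ∘_⋆ e_{j,k}) = e_{j,⋆} ∘_⋆ ω_{i,k} - e_{k,⋆} ∘_⋆ ω_{i,j}`. -/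
def ExtendsRule
    (φ : Hom (Comp Gri.toGrSpecies Det.toGrSpecies) (Comp Det.toGrSpecies Gri.toGrSpecies)) : Prop :=
  ∀ {I : Type} [Finite I] (i j k : I) (h : IsTriple i j k),
    φ.app 1 I (twoStep Det.one (zero_add 1) i
        (omegaGen false true isPair_bool) (eGen ⟨j, h.ij.symm⟩ ⟨k, h.ik.symm⟩ h.pair₁)) =
      twoStep Gri.one (add_zero 1) j
        (eGen false true isPair_bool) (omegaGen ⟨i, h.ij⟩ ⟨k, h.jk.symm⟩ h.pair₂) -
      twoStep Gri.one (add_zero 1) k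
        (eGen false true isPair_bool) (omegaGen ⟨i, h.ik⟩ ⟨j, h.jk⟩ h.pair₃)

/-- `γ : (P ∘ Q) ∘ (P ∘ Q) ⟶ P ∘ Q` is the composition
`(P ∘ Q) ∘ (P ∘ Q) ≅ P ∘ (Q ∘ P) ∘ Q ⟶ P ∘ (P ∘ Q) ∘ Q ≅ (P ∘ P) ∘ (Q ∘ Q) ⟶ P ∘ Q` given by the
distributive law and the compositions of `P` and `Q`, that is, `γ = L (id_P ∘ Φ) α`. -/
def DistributiveLaw.IsInducedComposition {P Q : OperadData} (Δ : DistributiveLaw P Q)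
    (γ : Hom (Comp (Comp P.toGrSpecies Q.toGrSpecies) (Comp P.toGrSpecies Q.toGrSpecies))
      (Comp P.toGrSpecies Q.toGrSpecies)) : Prop :=
  Interchange (Hom.id (Comp P.toGrSpecies Q.toGrSpecies)) γ Δ.Φ Δ.L

/-- The data of an operad on `P ∘ Q` with composition `γ` and with unit `(1; 1)`. -/
def compositeOperadData (P Q : OperadData)
    (γ : Hom (Comp (Comp P.toGrSpecies Q.toGrSpecies) (Comp P.toGrSpecies Q.toGrSpecies))
      (Comp P.toGrSpecies Q.toGrSpecies)) : OperadData where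
  toGrSpecies := Comp P.toGrSpecies Q.toGrSpecies
  one := insL P.one Q.one
  γ := γ

end

end BOperad

open BOperad

/-! Existence comes from an operad `N` that contains `Det` and `Gri` and for which composing an
element of `Det` with elements of `Gri` gives a bijection from `Det ∘ Gri` onto `N`. The law is
then: compose in `N`, and read the result back through this bijection. Beck's diagrams, the
composition induced on `Det ∘ Gri` and its operad axioms all become instances of the associativity
of `N` (`Interchange.of_injective`).

The model of `N` is an exterior algebra whose generators are the rooted binary trees: `N(I)` in
degree `d` is spanned by the products of `d + 1` trees whose leaves together exhaust `I` without
repetition. Joining two trees at a new root extends to a bracket of odd elements which is an even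
derivation in each argument (`br`). The bracket is commutative (`brDer_symm`), so non-planar trees
can be evaluated on odd elements, and products of trees through an algebra homomorphism (`subst`).
No Jacobi-type identity enters, because the trees are free generators for the bracket. Such
substitutions respect the bracket, hence they compose (`substO_mul`, `subst_subst`), and this is the
source of associativity.

The difficulty is the signs, since an input of degree `d` is a product of `d + 1` trees and is odd
only when `d` is even. Each input is therefore multiplied by a parameter of parity `d` that the
bracket annihilates; the products are odd and can be substituted, and the ordered product of the
parameters is afterwards divided out on the left (`subst_arg_mk`). The Koszul signs are then
produced by the reordering of parameters. An additional sign `epsSign` matches the convention of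
`Det` (`detN_sign`), and it satisfies the cocycle identity needed for associativity (`epsSign_mul`,
`nγ_assoc`).

`Det` sits in `N` as the products of leaves (`detN`), `Gri` as the single trees (`griN`), and the
two together give all products of trees exactly once up to order (`compN_bijective`). The rewriting
rule is the Leibniz rule: `{i, j ∧ k} = {i, j} ∧ k + j ∧ {i, k} = j ∧ {i, k} - k ∧ {i, j}`.

Uniqueness is an induction on the number of leaves of the whole element, and inside it on the size
of the tree from `Gri` (`agree_of_extendsRule`). A tree is cut at its root, and compatibility with
the composition of `Gri` reduces the question to the tree with two leaves. For that tree, an input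
from `Det` on at least two points factors through a generator `e`, because `Det(I)` is a line when
`I` is nonempty. The rule, together with compatibility with the composition of `Det`, then expresses
the value by values of the law on strictly smaller sets. -/

open scoped TensorProduct DirectSum

namespace BOperad

noncomputable section

/-! ### Even derivations and the odd bracket of an exterior algebra -/

section Bracket

variable {V W : Type} [AddCommGroup V] [Module ℚ V] [AddCommGroup W] [Module ℚ W]

/-- The elements of odd degree of the exterior algebra. -/
abbrev oddPart (V : Type) [AddCommGroup V] [Module ℚ V] : Submodule ℚ (ExteriorAlgebra ℚ V) :=
  CliffordAlgebra.evenOdd (0 : QuadraticForm ℚ V) 1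

/-- The elements of even degree of the exterior algebra. -/
abbrev evenPart (V : Type) [AddCommGroup V] [Module ℚ V] : Submodule ℚ (ExteriorAlgebra ℚ V) :=
  CliffordAlgebra.evenOdd (0 : QuadraticForm ℚ V) 0

lemma ι_mem_oddPart (v : V) : ExteriorAlgebra.ι ℚ v ∈ oddPart V :=
  CliffordAlgebra.ι_mem_evenOdd_one _ v

lemma one_mem_evenPart : (1 : ExteriorAlgebra ℚ V) ∈ evenPart V :=
  CliffordAlgebra.one_le_evenOdd_zero _ (Submodule.one_le.1 le_rfl)

lemma algebraMap_mem_evenPart (r : ℚ) : algebraMap ℚ (ExteriorAlgebra ℚ V) r ∈ evenPart V :=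
  CliffordAlgebra.one_le_evenOdd_zero _ (Submodule.algebraMap_mem r)

lemma even_mul_even {x y : ExteriorAlgebra ℚ V} (hx : x ∈ evenPart V) (hy : y ∈ evenPart V) :
    x * y ∈ evenPart V :=
  CliffordAlgebra.evenOdd_mul_le (0 : QuadraticForm ℚ V) 0 0 (Submodule.mul_mem_mul hx hy)

lemma even_mul_odd {x y : ExteriorAlgebra ℚ V} (hx : x ∈ evenPart V) (hy : y ∈ oddPart V) :
    x * y ∈ oddPart V :=
  CliffordAlgebra.evenOdd_mul_le (0 : QuadraticForm ℚ V) 0 1 (Submodule.mul_mem_mul hx hy)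

lemma odd_mul_even {x y : ExteriorAlgebra ℚ V} (hx : x ∈ oddPart V) (hy : y ∈ evenPart V) :
    x * y ∈ oddPart V :=
  CliffordAlgebra.evenOdd_mul_le (0 : QuadraticForm ℚ V) 1 0 (Submodule.mul_mem_mul hx hy)

lemma odd_mul_odd {x y : ExteriorAlgebra ℚ V} (hx : x ∈ oddPart V) (hy : y ∈ oddPart V) :
    x * y ∈ evenPart V :=
  CliffordAlgebra.evenOdd_mul_le (0 : QuadraticForm ℚ V) 1 1 (Submodule.mul_mem_mul hx hy)

lemma ι_anticomm (u v : V) : ExteriorAlgebra.ι ℚ u * ExteriorAlgebra.ι ℚ v =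
    -(ExteriorAlgebra.ι ℚ v * ExteriorAlgebra.ι ℚ u) :=
  eq_neg_of_add_eq_zero_left (ExteriorAlgebra.ι_add_mul_swap u v)

@[elab_as_elim]
lemma odd_ind {P : ∀ x : ExteriorAlgebra ℚ V, x ∈ oddPart V → Prop}
    (ι : ∀ v, P (ExteriorAlgebra.ι ℚ v) (ι_mem_oddPart v))
    (add : ∀ x y hx hy, P x hx → P y hy → P (x + y) (Submodule.add_mem _ hx hy))
    (mul : ∀ u v x hx, P x hx → P (ExteriorAlgebra.ι ℚ u * ExteriorAlgebra.ι ℚ v * x)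
      (even_mul_odd (odd_mul_odd (ι_mem_oddPart u) (ι_mem_oddPart v)) hx))
    (x : ExteriorAlgebra ℚ V) (hx : x ∈ oddPart V) : P x hx :=
  CliffordAlgebra.odd_induction (0 : QuadraticForm ℚ V) ι add mul x hx

@[elab_as_elim]
lemma even_ind {P : ∀ x : ExteriorAlgebra ℚ V, x ∈ evenPart V → Prop}
    (algebraMap : ∀ r : ℚ, P (algebraMap ℚ _ r) (algebraMap_mem_evenPart r))
    (add : ∀ x y hx hy, P x hx → P y hy → P (x + y) (Submodule.add_mem _ hx hy))
    (mul : ∀ u v x hx, P x hx → P (ExteriorAlgebra.ι ℚ u * ExteriorAlgebra.ι ℚ v * x)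
      (even_mul_even (odd_mul_odd (ι_mem_oddPart u) (ι_mem_oddPart v)) hx))
    (x : ExteriorAlgebra ℚ V) (hx : x ∈ evenPart V) : P x hx :=
  CliffordAlgebra.even_induction (0 : QuadraticForm ℚ V) algebraMap add mul x hx

lemma ι_ι_comm (u v : V) (y : ExteriorAlgebra ℚ V) :
    ExteriorAlgebra.ι ℚ u * ExteriorAlgebra.ι ℚ v * y =
      y * (ExteriorAlgebra.ι ℚ u * ExteriorAlgebra.ι ℚ v) := by
  induction y using ExteriorAlgebra.induction with
  | algebraMap r => exact (Algebra.commutes r _).symm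
  | ι w =>
    rw [mul_assoc, ι_anticomm v w, mul_neg, ← mul_assoc, ι_anticomm u w, neg_mul, neg_neg, mul_assoc]
  | mul a b ha hb => rw [← mul_assoc, ha, mul_assoc, hb, mul_assoc]
  | add a b ha hb => rw [mul_add, add_mul, ha, hb]

lemma even_comm {x : ExteriorAlgebra ℚ V} (hx : x ∈ evenPart V) (y : ExteriorAlgebra ℚ V) :
    x * y = y * x := by
  induction x, hx using even_ind with
  | algebraMap r => exact Algebra.commutes r _
  | add a b _ _ ha hb => rw [mul_add, add_mul, ha, hb]
  | mul u v x _ h => rw [mul_assoc, h, ← mul_assoc, ι_ι_comm, mul_assoc]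

lemma odd_anticomm {x y : ExteriorAlgebra ℚ V} (hx : x ∈ oddPart V) (hy : y ∈ oddPart V) :
    x * y = -(y * x) := by
  have h1 : ∀ v : V, ExteriorAlgebra.ι ℚ v * y = -(y * ExteriorAlgebra.ι ℚ v) := by
    intro v
    induction y, hy using odd_ind with
    | ι u => exact ι_anticomm v u
    | add a b _ _ ha hb => rw [mul_add, add_mul, ha, hb, neg_add]
    | mul u w a _ ha => rw [← mul_assoc, ← ι_ι_comm, mul_assoc, ha, mul_neg, mul_assoc, mul_assoc,
        mul_assoc]
  induction x, hx using odd_ind with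
  | ι v => exact h1 v
  | add a b _ _ ha hb => rw [mul_add, add_mul, ha, hb, neg_add]
  | mul u w a _ ha => rw [mul_assoc, ha, mul_neg, ← mul_assoc, ι_ι_comm, mul_assoc]

lemma odd_sq {x : ExteriorAlgebra ℚ V} (hx : x ∈ oddPart V) : x * x = 0 := by
  have h := odd_anticomm hx hx
  have h2 : (2 : ℚ) • (x * x) = 0 := by rw [two_smul]; nth_rewrite 1 [h]; simp
  simpa using h2

/-- Algebra homomorphisms with odd values on generators preserve the parity. -/
lemma map_mem_oddPart (F : ExteriorAlgebra ℚ V →ₐ[ℚ] ExteriorAlgebra ℚ W)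
    (hF : ∀ v, F (ExteriorAlgebra.ι ℚ v) ∈ oddPart W) {x : ExteriorAlgebra ℚ V}
    (hx : x ∈ oddPart V) : F x ∈ oddPart W := by
  induction x, hx using odd_ind with
  | ι v => exact hF v
  | add a b _ _ ha hb => rw [map_add]; exact add_mem ha hb
  | mul u v a _ ha =>
    rw [map_mul, map_mul]
    exact even_mul_odd (odd_mul_odd (hF u) (hF v)) ha

lemma map_mem_evenPart (F : ExteriorAlgebra ℚ V →ₐ[ℚ] ExteriorAlgebra ℚ W)
    (hF : ∀ v, F (ExteriorAlgebra.ι ℚ v) ∈ oddPart W) {x : ExteriorAlgebra ℚ V}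
    (hx : x ∈ evenPart V) : F x ∈ evenPart W := by
  induction x, hx using even_ind with
  | algebraMap r => rw [AlgHom.commutes]; exact algebraMap_mem_evenPart r
  | add a b _ _ ha hb => rw [map_add]; exact add_mem ha hb
  | mul u v a _ ha =>
    rw [map_mul, map_mul]
    exact even_mul_even (odd_mul_odd (hF u) (hF v)) ha

/-- Derivations along an algebra homomorphism are determined by their values on generators. -/
lemma derivation_ext {A : Type} [Ring A] [Algebra ℚ A] (F : ExteriorAlgebra ℚ V →ₐ[ℚ] A)
    {D E : ExteriorAlgebra ℚ V →ₗ[ℚ] A} (hD : ∀ x y, D (x * y) = D x * F y + F x * D y)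
    (hE : ∀ x y, E (x * y) = E x * F y + F x * E y)
    (h : ∀ v, D (ExteriorAlgebra.ι ℚ v) = E (ExteriorAlgebra.ι ℚ v)) : D = E := by
  have hone : ∀ D : ExteriorAlgebra ℚ V →ₗ[ℚ] A,
      (∀ x y, D (x * y) = D x * F y + F x * D y) → D 1 = 0 := by
    intro D hD
    have := hD 1 1
    simpa using this
  refine LinearMap.ext fun x => ?_
  induction x using ExteriorAlgebra.induction with
  | algebraMap r => rw [Algebra.algebraMap_eq_smul_one, map_smul, map_smul, hone D hD, hone E hE]
  | ι v => exact h v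
  | mul a b ha hb => rw [hD, hE, ha, hb]
  | add a b ha hb => rw [map_add, map_add, ha, hb]

/-- The homomorphism `v ↦ v + ε φ(v)` to the dual numbers. -/
def derHom (φ : V →ₗ[ℚ] oddPart V) :
    ExteriorAlgebra ℚ V →ₐ[ℚ] TrivSqZeroExt (ExteriorAlgebra ℚ V) (ExteriorAlgebra ℚ V) :=
  ExteriorAlgebra.lift ℚ ⟨
    { toFun := fun v => (TrivSqZeroExt.inl (ExteriorAlgebra.ι ℚ v) : TrivSqZeroExt _ _) +
        TrivSqZeroExt.inr (φ v : ExteriorAlgebra ℚ V)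
      map_add' := fun u v => by
        ext <;> simp
      map_smul' := fun r v => by
        ext <;> simp }, fun v => by
      ext
      · simp
      -- The nilpotent part of the square is `v φ(v) + φ(v) v`, which vanishes because both factors
      -- are odd.
      · simp [odd_anticomm (ι_mem_oddPart v) (φ v).2]⟩

/-- The even derivation with given odd values on the generators. -/
def der (φ : V →ₗ[ℚ] oddPart V) : ExteriorAlgebra ℚ V →ₗ[ℚ] ExteriorAlgebra ℚ V :=
  (TrivSqZeroExt.sndHom _ _).restrictScalars ℚ ∘ₗ (derHom φ).toLinearMap

lemma derHom_fst (φ : V →ₗ[ℚ] oddPart V) (x : ExteriorAlgebra ℚ V) :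
    (derHom φ x).fst = x := by
  have : (TrivSqZeroExt.fstHom ℚ (ExteriorAlgebra ℚ V) (ExteriorAlgebra ℚ V)).comp (derHom φ)
      = AlgHom.id ℚ _ := by
    apply ExteriorAlgebra.hom_ext
    ext v
    simp [derHom]
  exact DFunLike.congr_fun this x

@[simp] lemma der_ι (φ : V →ₗ[ℚ] oddPart V) (v : V) :
    der φ (ExteriorAlgebra.ι ℚ v) = φ v := by
  simp [der, derHom]

lemma der_mul (φ : V →ₗ[ℚ] oddPart V) (x y : ExteriorAlgebra ℚ V) :
    der φ (x * y) = der φ x * y + x * der φ y := by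
  simp only [der, LinearMap.comp_apply, AlgHom.toLinearMap_apply, map_mul]
  change (derHom φ x * derHom φ y).snd = _
  rw [TrivSqZeroExt.snd_mul, derHom_fst, derHom_fst, add_comm]
  rfl

lemma der_add (φ ψ : V →ₗ[ℚ] oddPart V) : der (φ + ψ) = der φ + der ψ := by
  apply derivation_ext (AlgHom.id ℚ _)
  · intro x y; simp [der_mul]
  · intro x y; simp only [LinearMap.add_apply, der_mul, AlgHom.id_apply]; noncomm_ring
  · intro v; simp

lemma der_smul (r : ℚ) (φ : V →ₗ[ℚ] oddPart V) : der (r • φ) = r • der φ := by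
  apply derivation_ext (AlgHom.id ℚ _)
  · intro x y; simp [der_mul]
  · intro x y; simp [der_mul]
  · intro v; simp

/-- Even elements are central, so even derivations form a module over them. Three terms are what the
expansion of a bracket with a product `u v a` requires. -/
lemma der_even_mul_add {φ φ₁ φ₂ φ₃ : V →ₗ[ℚ] oddPart V} {c₁ c₂ c₃ : ExteriorAlgebra ℚ V}
    (h₁ : c₁ ∈ evenPart V) (h₂ : c₂ ∈ evenPart V) (h₃ : c₃ ∈ evenPart V)
    (h : ∀ v, (φ v : ExteriorAlgebra ℚ V) = c₁ * φ₁ v + c₂ * φ₂ v + c₃ * φ₃ v)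
    (x : ExteriorAlgebra ℚ V) :
    der φ x = c₁ * der φ₁ x + c₂ * der φ₂ x + c₃ * der φ₃ x := by
  have : der φ = LinearMap.mulLeft ℚ c₁ ∘ₗ der φ₁ + LinearMap.mulLeft ℚ c₂ ∘ₗ der φ₂ +
      LinearMap.mulLeft ℚ c₃ ∘ₗ der φ₃ := by
    apply derivation_ext (AlgHom.id ℚ _)
    · intro x y; simp [der_mul]
    · intro x y
      simp only [LinearMap.comp_apply, LinearMap.mulLeft_apply, der_mul, AlgHom.id_apply, mul_add,
        add_mul, LinearMap.add_apply, ← mul_assoc, ← even_comm h₁ x, ← even_comm h₂ x,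
        ← even_comm h₃ x]
      abel
    · intro v; simp [h]
  rw [this]; rfl

lemma der_mem_oddPart (φ : V →ₗ[ℚ] oddPart V) {x : ExteriorAlgebra ℚ V} (hx : x ∈ oddPart V) :
    der φ x ∈ oddPart V := by
  induction x, hx using odd_ind with
  | ι v => rw [der_ι]; exact (φ v).2
  | add a b _ _ ha hb => rw [map_add]; exact add_mem ha hb
  | mul u v a ha h =>
    rw [der_mul, der_mul, der_ι, der_ι]
    refine add_mem (even_mul_odd (add_mem ?_ ?_) ha)
      (even_mul_odd (odd_mul_odd (ι_mem_oddPart _) (ι_mem_oddPart _)) h)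
    · exact odd_mul_odd (φ u).2 (ι_mem_oddPart _)
    · exact odd_mul_odd (ι_mem_oddPart _) (φ v).2

/-! ### The bracket of odd elements attached to a bilinear operation on the generators. -/

variable (β : V →ₗ[ℚ] V →ₗ[ℚ] V)

/-- The derivation `{v, -}` for a generator `v`. -/
def genDer (v : V) : ExteriorAlgebra ℚ V →ₗ[ℚ] ExteriorAlgebra ℚ V :=
  der (((ExteriorAlgebra.ι ℚ).codRestrict (oddPart V) ι_mem_oddPart) ∘ₗ β v)

@[simp] lemma genDer_ι (u v : V) :
    genDer β u (ExteriorAlgebra.ι ℚ v) = ExteriorAlgebra.ι ℚ (β u v) := by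
  simp [genDer]

/-- The map `v ↦ {v, y}` on generators. -/
def genBr (y : oddPart V) : V →ₗ[ℚ] oddPart V where
  toFun v := ⟨genDer β v y, der_mem_oddPart _ y.2⟩
  map_add' u v := by
    apply Subtype.ext
    simp only [genDer, map_add, LinearMap.comp_add, der_add]
    rfl
  map_smul' r v := by
    apply Subtype.ext
    simp only [genDer, map_smul, LinearMap.comp_smul, der_smul]
    rfl

/-- The derivation `{-, y}` for an odd element `y`. -/
def brDer (y : oddPart V) : ExteriorAlgebra ℚ V →ₗ[ℚ] ExteriorAlgebra ℚ V := der (genBr β y)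

lemma brDer_ι (y : oddPart V) (v : V) : brDer β y (ExteriorAlgebra.ι ℚ v) = genDer β v y := by
  simp [brDer, genBr]

lemma brDer_mul (z : oddPart V) (x y : ExteriorAlgebra ℚ V) :
    brDer β z (x * y) = brDer β z x * y + x * brDer β z y := der_mul _ _ _

lemma brDer_add (y z : oddPart V) : brDer β (y + z) = brDer β y + brDer β z := by
  have : genBr β (y + z) = genBr β y + genBr β z := by
    ext v; simp [genBr]
  rw [brDer, this, der_add]; rfl

variable {β}

lemma brDer_gen (hβ : ∀ u v, β u v = β v u) (u : V) (x : ExteriorAlgebra ℚ V) :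
    brDer β ⟨ExteriorAlgebra.ι ℚ u, ι_mem_oddPart u⟩ x = genDer β u x := by
  have : brDer β ⟨ExteriorAlgebra.ι ℚ u, ι_mem_oddPart u⟩ = genDer β u := by
    unfold brDer genDer
    congr 1
    ext v
    simp [genBr, hβ u v]
  rw [this]

/-- The construction treats the two arguments differently: it is a derivation on the left by
definition, with values on generators that are derivations on the right. Both sides are nevertheless
determined by the same recursion in `y`: they agree on generators by the symmetry of `β`, and both
expand a product `u v a` by the Leibniz rule. -/
lemma brDer_symm (hβ : ∀ u v, β u v = β v u) (x y : oddPart V) : brDer β y x.1 = brDer β x y.1 := by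
  obtain ⟨y, hy⟩ := y
  induction y, hy using odd_ind with
  | ι u => rw [brDer_gen hβ, brDer_ι]
  | add a b ha hb h1 h2 =>
    have := brDer_add β ⟨a, ha⟩ ⟨b, hb⟩
    rw [map_add, ← h1, ← h2, ← LinearMap.add_apply, ← this]
    rfl
  | mul u v a ha h =>
    have hu := ι_mem_oddPart u
    have hv := ι_mem_oddPart v
    have huv := odd_mul_odd hu hv
    -- As derivations in the left argument, `{-, u v a} = v a {-, u} - u a {-, v} + u v {-, a}`.
    have key := der_even_mul_add (φ := genBr β ⟨_, even_mul_odd huv ha⟩)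
      (φ₁ := genBr β ⟨_, hu⟩) (φ₂ := genBr β ⟨_, hv⟩) (φ₃ := genBr β ⟨_, ha⟩)
      (odd_mul_odd hv ha) (neg_mem (odd_mul_odd hu ha)) huv (by
        intro w
        have h1 : genDer β w (ExteriorAlgebra.ι ℚ u) ∈ oddPart V := der_mem_oddPart _ hu
        have h2 : genDer β w (ExteriorAlgebra.ι ℚ v) ∈ oddPart V := der_mem_oddPart _ hv
        have hm : ∀ a b, genDer β w (a * b) = genDer β w a * b + a * genDer β w b := der_mul _
        change genDer β w _ = _ * genDer β w _ + _ * genDer β w _ + _ * genDer β w _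
        rw [hm, hm, add_mul, even_comm (odd_mul_odd hv ha), odd_anticomm hu h2, neg_mul, neg_mul,
          mul_assoc, mul_assoc, even_comm (odd_mul_odd hu ha)]) x.1
    have hm : ∀ a b, brDer β x (a * b) = brDer β x a * b + a * brDer β x b := brDer_mul β x
    have h1 : genDer β u x ∈ oddPart V := der_mem_oddPart _ x.2
    have h2 : genDer β v x ∈ oddPart V := der_mem_oddPart _ x.2
    have eu := brDer_gen hβ u x.1
    have ev := brDer_gen hβ v x.1
    unfold brDer at eu ev h
    change brDer β _ _ = _ at key
    rw [key, hm, hm, eu, ev, h, brDer_ι, brDer_ι, add_mul, even_comm (odd_mul_odd hv ha),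
      odd_anticomm hu h2, neg_mul, neg_mul, even_comm (odd_mul_odd hu ha)]
    simp only [mul_assoc]
    rfl

variable (β) in
/-- The bracket of two odd elements. -/
def br (x y : oddPart V) : oddPart V := ⟨brDer β y x, der_mem_oddPart _ x.2⟩

lemma br_val (x y : oddPart V) : (br β x y : ExteriorAlgebra ℚ V) = brDer β y x := rfl

lemma br_comm (hβ : ∀ u v, β u v = β v u) (x y : oddPart V) : br β x y = br β y x := Subtype.ext (brDer_symm hβ x y)

/-- Elements on which all the derivations `{-, y}` vanish. -/
def IsConst (β : V →ₗ[ℚ] V →ₗ[ℚ] V) (c : ExteriorAlgebra ℚ V) : Prop :=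
  ∀ y : oddPart V, brDer β y c = 0

lemma IsConst.mul {c d : ExteriorAlgebra ℚ V} (hc : IsConst β c) (hd : IsConst β d) :
    IsConst β (c * d) := fun y => by rw [brDer_mul, hc, hd, zero_mul, mul_zero, add_zero]

lemma isConst_one : IsConst β (1 : ExteriorAlgebra ℚ V) := fun y => by
  have := brDer_mul β y 1 1
  simpa using this

lemma IsConst.smul {c : ExteriorAlgebra ℚ V} (r : ℚ) (hc : IsConst β c) : IsConst β (r • c) :=
  fun y => by rw [map_smul, hc, smul_zero]

lemma IsConst.list_prod {l : List (ExteriorAlgebra ℚ V)} (h : ∀ c ∈ l, IsConst β c) :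
    IsConst β l.prod := by
  induction l with
  | nil => exact isConst_one
  | cons a l ih =>
    rw [List.prod_cons]
    exact (h a List.mem_cons_self).mul (ih fun c hc => h c (List.mem_cons_of_mem _ hc))

lemma isConst_ι {v : V} (hv : ∀ u, β v u = 0) : IsConst β (ExteriorAlgebra.ι ℚ v) := fun y => by
  have : genDer β v = 0 := by
    apply derivation_ext (AlgHom.id ℚ _)
    · intro x y; exact der_mul _ x y
    · intro x y; simp
    · intro u; simp [hv]
  rw [brDer_ι, this, LinearMap.zero_apply]

/-- The derivation `{-, y}` kills `c`, so only the second Leibniz term survives. This is what lets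
parameters pass through the evaluation of a tree. -/
lemma br_const_mul {c : ExteriorAlgebra ℚ V} (hc : IsConst β c) {x y z : oddPart V}
    (h : (z : ExteriorAlgebra ℚ V) = c * x) :
    (br β z y : ExteriorAlgebra ℚ V) = c * br β x y := by
  rw [br_val, h, brDer_mul, hc, zero_mul, zero_add]; rfl

lemma br_add_left (x y z : oddPart V) : br β (x + y) z = br β x z + br β y z :=
  Subtype.ext (map_add (brDer β z) _ _)

/-- A homomorphism that respects the bracket of generators respects the bracket. -/
lemma map_br {γ : W →ₗ[ℚ] W →ₗ[ℚ] W} (hγ : ∀ u v, γ u v = γ v u)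
    (F : ExteriorAlgebra ℚ V →ₐ[ℚ] ExteriorAlgebra ℚ W)
    (hF : ∀ v, F (ExteriorAlgebra.ι ℚ v) ∈ oddPart W)
    (h : ∀ u v, F (ExteriorAlgebra.ι ℚ (β u v)) = br γ ⟨_, hF u⟩ ⟨_, hF v⟩) (x y : oddPart V) :
    F (br β x y) = br γ ⟨F x, map_mem_oddPart F hF x.2⟩ ⟨F y, map_mem_oddPart F hF y.2⟩ := by
  -- `F D` and `E F` are both derivations along `F`, so agreement on generators suffices. This is
  -- applied first in the right argument, with a generator on the left, and then in the left
  -- argument.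
  have ext : ∀ (D : ExteriorAlgebra ℚ V →ₗ[ℚ] ExteriorAlgebra ℚ V)
      (E : ExteriorAlgebra ℚ W →ₗ[ℚ] ExteriorAlgebra ℚ W)
      (_ : ∀ a b, D (a * b) = D a * b + a * D b) (_ : ∀ a b, E (a * b) = E a * b + a * E b)
      (_ : ∀ v, F (D (ExteriorAlgebra.ι ℚ v)) = E (F (ExteriorAlgebra.ι ℚ v)))
      (z : ExteriorAlgebra ℚ V), F (D z) = E (F z) := by
    intro D E hD hE h z
    have : F.toLinearMap ∘ₗ D = E ∘ₗ F.toLinearMap := by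
      apply derivation_ext F
      · intro a b; simp [hD]
      · intro a b; simp [hE]
      · exact h
    exact LinearMap.congr_fun this z
  have h1 : ∀ (u : V) (z : oddPart V), F (genDer β u z) =
      brDer γ ⟨_, hF u⟩ (F z) := by
    intro u z
    refine ext (genDer β u) (brDer γ ⟨_, hF u⟩) (der_mul _) (der_mul _) ?_ z
    intro v
    rw [genDer_ι, h, br_comm hγ]
    rfl
  refine ext (brDer β y) (brDer γ ⟨F y, _⟩) (der_mul _) (der_mul _) ?_ x
  intro v
  rw [brDer_ι, h1]
  exact brDer_symm hγ ⟨F y, map_mem_oddPart F hF y.2⟩ ⟨_, hF v⟩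

end Bracket

end

end BOperad

namespace BOperad

noncomputable section

/-! ### The exterior algebra on trees and odd parameters -/

/-- The vector space spanned by trees with leaves in `I` and by parameters. -/
abbrev GenSp (I Θ : Type) : Type := (BinTree I ⊕ Θ) →₀ ℚ

/-- The exterior algebra on trees with leaves in `I` and on odd parameters. -/
abbrev Lam (I Θ : Type) : Type := ExteriorAlgebra ℚ (GenSp I Θ)

variable {I J K Θ Θ' : Type}

/-- The generators of `Lam I Θ`. -/
def lamGen (g : BinTree I ⊕ Θ) : Lam I Θ := ExteriorAlgebra.ι ℚ (Finsupp.single g 1)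

/-- The generator given by a tree. -/
def tree (t : BinTree I) : Lam I Θ := lamGen (Sum.inl t)

/-- The generator given by a parameter. -/
def par (π : Θ) : Lam I Θ := lamGen (Sum.inr π)

lemma lamGen_mem (g : BinTree I ⊕ Θ) : lamGen g ∈ oddPart (GenSp I Θ) := ι_mem_oddPart _

lemma lam_hom_ext {A : Type} [Semiring A] [Algebra ℚ A] {F G : Lam I Θ →ₐ[ℚ] A}
    (h : ∀ t, F (tree t) = G (tree t)) (h' : ∀ π, F (par π) = G (par π)) : F = G := by
  apply ExteriorAlgebra.hom_ext
  apply Finsupp.lhom_ext'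
  intro g
  apply LinearMap.ext_ring
  rcases g with t | π
  · exact h t
  · exact h' π

/-- The bracket of generators: trees are joined at a new root, parameters are annihilated. -/
def joinGen : BinTree I ⊕ Θ → BinTree I ⊕ Θ → GenSp I Θ
  | Sum.inl s, Sum.inl t => Finsupp.single (Sum.inl (s * t)) 1
  | _, _ => 0

/-- The bilinear extension of `joinGen`. -/
def join (I Θ : Type) : GenSp I Θ →ₗ[ℚ] GenSp I Θ →ₗ[ℚ] GenSp I Θ :=
  Finsupp.lift _ ℚ _ (fun a => Finsupp.lift _ ℚ _ (joinGen a))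

@[simp] lemma join_single (a b : BinTree I ⊕ Θ) :
    join I Θ (Finsupp.single a 1) (Finsupp.single b 1) = joinGen a b := by
  simp [join]

lemma join_comm (u v : GenSp I Θ) : join I Θ u v = join I Θ v u := by
  have : join I Θ = (join I Θ).flip := by
    apply Finsupp.lhom_ext'
    intro a
    apply LinearMap.ext_ring
    apply Finsupp.lhom_ext'
    intro b
    apply LinearMap.ext_ring
    simp only [LinearMap.comp_apply, Finsupp.lsingle_apply, LinearMap.flip_apply, join_single]
    rcases a with a | a <;> rcases b with b | b <;> simp [joinGen, mul_comm]
  exact LinearMap.congr_fun₂ this u v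

/-- The odd elements of `Lam I Θ`. -/
abbrev OddLam (I Θ : Type) : Type := oddPart (GenSp I Θ)

/-- Commutativity alone is what `BinTree.lift` asks for: trees can now be evaluated on odd elements.
-/
instance : CommMagma (OddLam I Θ) where
  mul := br (join I Θ)
  mul_comm := br_comm join_comm

lemma oddLam_mul (x y : OddLam I Θ) : x * y = br (join I Θ) x y := rfl

/-- Elements annihilated by the bracket. -/
abbrev IsPar (c : Lam I Θ) : Prop := IsConst (join I Θ) c

lemma isPar_par (π : Θ) : IsPar (par π : Lam I Θ) := by
  apply isConst_ι
  intro u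
  induction u using Finsupp.induction_linear with
  | zero => simp
  | add u v hu hv => rw [map_add, hu, hv, add_zero]
  | single b r =>
    rw [← mul_one r, ← smul_eq_mul, ← Finsupp.smul_single, map_smul, join_single]
    rcases b with b | b <;> simp [joinGen]

/-- A tree as an odd element. -/
def treeO (t : BinTree I) : OddLam I Θ := ⟨tree t, lamGen_mem _⟩

/-- A parameter as an odd element. -/
def parO (π : Θ) : OddLam I Θ := ⟨par π, lamGen_mem _⟩

/-- A leaf as an odd element. -/
def leafO (i : I) : OddLam I Θ := treeO (BinTree.leaf i)

lemma treeO_mul (s t : BinTree I) : (treeO (s * t) : OddLam I Θ) = treeO s * treeO t := by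
  apply Subtype.ext
  rw [oddLam_mul, br_val]
  change _ = brDer _ _ (ExteriorAlgebra.ι ℚ _)
  rw [brDer_ι]
  change _ = genDer _ _ (ExteriorAlgebra.ι ℚ _)
  rw [genDer_ι, join_single]
  rfl

/-- Evaluation of a tree in the magma of odd elements. -/
def ev (X : K → OddLam I Θ) (t : BinTree K) : OddLam I Θ := BinTree.lift X t

@[simp] lemma ev_leaf (X : K → OddLam I Θ) (k : K) : ev X (BinTree.leaf k) = X k := rfl

@[simp] lemma ev_mul (X : K → OddLam I Θ) (s t : BinTree K) : ev X (s * t) = ev X s * ev X t :=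
  map_mul _ _ _

lemma ev_treeO (S : K → BinTree I) (t : BinTree K) :
    ev (fun k => (treeO (S k) : OddLam I Θ)) t = treeO (t.graft S) := by
  induction t using BinTree.induct with
  | leaf k => rfl
  | mul s t hs ht => rw [ev_mul, hs, ht, BinTree.graft_mul, treeO_mul]

/-- Substitution of odd elements for the leaves and for the parameters. -/
def subst (X : K → OddLam I Θ) (θ : Θ' → OddLam I Θ) : Lam K Θ' →ₐ[ℚ] Lam I Θ :=
  ExteriorAlgebra.lift ℚ ⟨(oddPart _).subtype ∘ₗ
    Finsupp.lift _ ℚ _ (Sum.elim (ev X) θ), fun _ => odd_sq (Subtype.prop _)⟩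

@[simp] lemma subst_tree (X : K → OddLam I Θ) (θ : Θ' → OddLam I Θ) (t : BinTree K) :
    subst X θ (tree t) = ev X t := by
  simp [subst, tree, lamGen]

@[simp] lemma subst_par (X : K → OddLam I Θ) (θ : Θ' → OddLam I Θ) (π : Θ') :
    subst X θ (par π) = θ π := by
  simp [subst, par, lamGen]

lemma subst_ι_mem (X : K → OddLam I Θ) (θ : Θ' → OddLam I Θ) (v : GenSp K Θ') :
    subst X θ (ExteriorAlgebra.ι ℚ v) ∈ oddPart (GenSp I Θ) := by
  rw [subst, ExteriorAlgebra.lift_ι_apply]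
  exact Subtype.prop _

/-- Substitution on odd elements. -/
def substO (X : K → OddLam I Θ) (θ : Θ' → OddLam I Θ) (y : OddLam K Θ') : OddLam I Θ :=
  ⟨subst X θ y, map_mem_oddPart _ (subst_ι_mem X θ) y.2⟩

/-- By `map_br` only generators matter. A pair of trees is handled by the definition of evaluation;
as soon as one of the two is a parameter, both sides vanish, on the right because the parameters go
to elements annihilated by the bracket. -/
lemma substO_mul {X : K → OddLam I Θ} {θ : Θ' → OddLam I Θ} (hθ : ∀ π, IsPar (θ π).1)
    (x y : OddLam K Θ') : substO X θ (x * y) = substO X θ x * substO X θ y := by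
  apply Subtype.ext
  refine map_br join_comm (subst X θ) (subst_ι_mem X θ) ?_ x y
  let T : GenSp K Θ' →ₗ[ℚ] OddLam I Θ := Finsupp.lift _ ℚ _ (Sum.elim (ev X) θ)
  have hT : ∀ v, subst X θ (ExteriorAlgebra.ι ℚ v) = T v := by
    intro v
    rw [subst, ExteriorAlgebra.lift_ι_apply]; rfl
  have hT' : ∀ v h, (⟨subst X θ (ExteriorAlgebra.ι ℚ v), h⟩ : OddLam I Θ) = T v :=
    fun v h => Subtype.ext (hT v)
  have hsing : ∀ g, T (Finsupp.single g 1) = Sum.elim (ev X) θ g := by simp [T]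
  have hz : ∀ z, br (join I Θ) 0 z = 0 := fun z => Subtype.ext (map_zero (brDer _ z))
  have hsm : ∀ (r : ℚ) (x z), br (join I Θ) (r • x) z = r • br (join I Θ) x z :=
    fun r x z => Subtype.ext (map_smul (brDer _ z) r _)
  intro u v
  rw [hT', hT', hT]
  congr 1
  induction u using Finsupp.induction_linear with
  | zero => simp [hz]
  | add a b ha hb => rw [map_add, LinearMap.add_apply, map_add, ha, hb, map_add, br_add_left]
  | single g r =>
  rw [← mul_one r, ← smul_eq_mul, ← Finsupp.smul_single, map_smul, map_smul, LinearMap.smul_apply,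
    map_smul, hsm]
  congr 1
  rw [br_comm join_comm]
  induction v using Finsupp.induction_linear with
  | zero => simp [hz]
  | add a b ha hb => rw [map_add, map_add, ha, hb, map_add, br_add_left]
  | single g' r' =>
  rw [← mul_one r', ← smul_eq_mul, ← Finsupp.smul_single, map_smul, map_smul, map_smul, hsm,
    join_single, hsing, hsing]
  congr 1
  have hp : ∀ π z, br (join I Θ) (θ π) z = 0 := fun π z => Subtype.ext (hθ π z)
  rcases g with s | π
  · rcases g' with t | π'
    · simp only [joinGen, hsing, Sum.elim_inl]
      rw [br_comm join_comm]
      exact ev_mul X s t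
    · simp [joinGen, hp]
  · rcases g' with t | π'
    · rw [br_comm join_comm]
      simp [joinGen, hp]
    · simp [joinGen, hp]

lemma substO_ev {X : K → OddLam I Θ} {θ : Θ' → OddLam I Θ} (hθ : ∀ π, IsPar (θ π).1)
    (Y : J → OddLam K Θ') (t : BinTree J) :
    substO X θ (ev Y t) = ev (fun j => substO X θ (Y j)) t := by
  induction t using BinTree.induct with
  | leaf k => rfl
  | mul s t hs ht => rw [ev_mul, substO_mul hθ, hs, ht, ev_mul]

/-- Two algebra homomorphisms are compared on trees and on parameters, and on trees this is the
compatibility of substitution with the bracket. Associativity of the composition of products of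
trees rests on this. -/
lemma subst_subst {Ξ : Type} {X : K → OddLam I Θ} {θ : Θ' → OddLam I Θ} (hθ : ∀ π, IsPar (θ π).1)
    (Y : J → OddLam K Θ') (ζ : Ξ → OddLam K Θ') (z : Lam J Ξ) :
    subst X θ (subst Y ζ z) = subst (fun j => substO X θ (Y j)) (fun ξ => substO X θ (ζ ξ)) z := by
  have : (subst X θ).comp (subst Y ζ) =
      subst (fun j => substO X θ (Y j)) (fun ξ => substO X θ (ζ ξ)) := by
    apply lam_hom_ext
    · intro t
      simp only [AlgHom.comp_apply, subst_tree]
      exact congrArg Subtype.val (substO_ev hθ Y t)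
    · intro ξ
      simp only [AlgHom.comp_apply, subst_par]
      rfl
  exact DFunLike.congr_fun this z

/-- Change of the labels of the leaves. -/
def mapLeaf (u : I → J) : Lam I Θ →ₐ[ℚ] Lam J Θ := subst (fun i => leafO (u i)) parO

/-- Adjunction of parameters, together with a change of the labels of the leaves. -/
def inj (u : I → J) : Lam I Empty →ₐ[ℚ] Lam J Θ := subst (fun i => leafO (u i)) Empty.elim

lemma isPar_parO (π : Θ) : IsPar (parO π : OddLam I Θ).1 := isPar_par π

lemma subst_inj {X : K → OddLam I Θ} {θ : Θ' → OddLam I Θ} (hθ : ∀ π, IsPar (θ π).1) (u : J → K)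
    (z : Lam J Empty) : subst X θ (inj u z) = subst (fun j => X (u j)) Empty.elim z := by
  rw [inj, subst_subst hθ]
  congr 1
  congr 1
  · funext j
    apply Subtype.ext
    simp only [substO, leafO, treeO, subst_tree, ev_leaf]
  · funext e; exact e.elim

lemma subst_mapLeaf {X : K → OddLam I Θ} {θ : Θ' → OddLam I Θ} (hθ : ∀ π, IsPar (θ π).1) (u : J → K)
    (z : Lam J Θ') : subst X θ (mapLeaf u z) = subst (fun j => X (u j)) θ z := by
  rw [mapLeaf, subst_subst hθ]
  congr 1
  congr 1
  · funext j
    apply Subtype.ext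
    simp only [substO, leafO, treeO, subst_tree, ev_leaf]
  · funext e
    apply Subtype.ext
    simp only [substO, parO, subst_par]

lemma mapLeaf_inj (u : I → J) (v : J → K) (z : Lam I Empty) :
    (mapLeaf v (inj u z : Lam J Θ)) = inj (v ∘ u) z := subst_inj isPar_parO u z

lemma mapLeaf_mapLeaf (u : I → J) (v : J → K) (z : Lam I Θ) :
    mapLeaf v (mapLeaf u z) = mapLeaf (v ∘ u) z := subst_mapLeaf isPar_parO u z

lemma inj_inj (u : I → J) (v : J → K) (z : Lam I Empty) :
    (inj v (inj u z : Lam J Empty) : Lam K Θ) = inj (v ∘ u) z := subst_inj (fun π => π.elim) u z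

lemma inj_mapLeaf (u : I → J) (v : J → K) (z : Lam I Empty) :
    (inj v (mapLeaf u z) : Lam K Θ) = inj (v ∘ u) z := subst_mapLeaf (fun π => π.elim) u z

lemma inj_empty (u : I → J) (z : Lam I Empty) : (inj u z : Lam J Empty) = mapLeaf u z := by
  unfold inj mapLeaf
  congr 2
  funext e; exact e.elim

lemma ev_leafO (t : BinTree I) : ev (fun i => (leafO i : OddLam I Θ)) t = treeO t := by
  have := ev_treeO (Θ := Θ) (fun i : I => BinTree.leaf i) t
  rwa [BinTree.graft_leaf_right] at this

lemma mapLeaf_id (z : Lam I Θ) : mapLeaf (fun i => i) z = z := by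
  have : mapLeaf (fun i => i) = AlgHom.id ℚ (Lam I Θ) := by
    apply lam_hom_ext
    · intro t
      simp only [mapLeaf, subst_tree, ev_leafO]
      rfl
    · intro π
      simp only [mapLeaf, subst_par]
      rfl
  exact DFunLike.congr_fun this z

@[simp] lemma mapLeaf_tree (u : I → J) (t : BinTree I) :
    (mapLeaf u (tree t) : Lam J Θ) = tree (t.relabel u) := by
  simp only [mapLeaf, subst_tree, leafO, ev_treeO]
  rfl

@[simp] lemma mapLeaf_par (u : I → J) (π : Θ) :
    (mapLeaf u (par π) : Lam J Θ) = par π := by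
  simp only [mapLeaf, subst_par]
  rfl

@[simp] lemma inj_tree (u : I → J) (t : BinTree I) :
    (inj u (tree t) : Lam J Θ) = tree (t.relabel u) := by
  simp only [inj, subst_tree, leafO, ev_treeO]
  rfl

/-! ### Weights -/

/-- The leaves and parameters occurring in a generator. -/
def wt : BinTree I ⊕ Θ → Multiset (I ⊕ Θ)
  | Sum.inl t => t.leaves.map Sum.inl
  | Sum.inr π => {Sum.inr π}

/-- The span of the products of `j` generators with total weight `m`. -/
def wspan (j : ℤ) (m : Multiset (I ⊕ Θ)) : Submodule ℚ (Lam I Θ) :=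
  Submodule.span ℚ {z | ∃ l : List (BinTree I ⊕ Θ), (l.length : ℤ) = j ∧ (l.map wt).sum = m ∧
    z = (l.map lamGen).prod}

lemma list_mem_wspan (l : List (BinTree I ⊕ Θ)) :
    (l.map lamGen).prod ∈ wspan (l.length : ℤ) (l.map wt).sum :=
  Submodule.subset_span ⟨l, rfl, rfl, rfl⟩

lemma lamGen_mem_wspan (g : BinTree I ⊕ Θ) : lamGen g ∈ wspan 1 (wt g) := by
  simpa using list_mem_wspan [g]

lemma one_mem_wspan : (1 : Lam I Θ) ∈ wspan 0 0 := by simpa using list_mem_wspan ([] : List (BinTree I ⊕ Θ))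

lemma mul_mem_wspan {j j' : ℤ} {m m' : Multiset (I ⊕ Θ)} {x y : Lam I Θ} (hx : x ∈ wspan j m)
    (hy : y ∈ wspan j' m') : x * y ∈ wspan (j + j') (m + m') := by
  have := Submodule.mul_mem_mul hx hy
  rw [wspan, wspan, Submodule.span_mul_span] at this
  refine Submodule.span_mono ?_ this
  rintro _ ⟨_, ⟨l, rfl, rfl, rfl⟩, _, ⟨l', rfl, rfl, rfl⟩, rfl⟩
  exact ⟨l ++ l', by simp, by simp, by simp⟩

lemma wspan_linear {j : ℤ} {m : Multiset (I ⊕ Θ)} {A : Type} [AddCommGroup A] [Module ℚ A]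
    (S : Submodule ℚ A) (T : Lam I Θ →ₗ[ℚ] A)
    (h : ∀ l : List (BinTree I ⊕ Θ), (l.length : ℤ) = j → (l.map wt).sum = m →
      T (l.map lamGen).prod ∈ S) {x : Lam I Θ} (hx : x ∈ wspan j m) : T x ∈ S := by
  have : wspan j m ≤ S.comap T := by
    rw [wspan, Submodule.span_le]
    rintro _ ⟨l, h1, h2, rfl⟩
    exact h l h1 h2
  exact this hx

/-- The Leibniz rule changes one factor at a time, so the effect on a single generator is the effect
on every product. -/
lemma derivation_mem_wspan {s : ℤ} {m₀ : Multiset (I ⊕ Θ)} (D : Lam I Θ →ₗ[ℚ] Lam I Θ)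
    (hD : ∀ x y, D (x * y) = D x * y + x * D y)
    (h : ∀ g, D (lamGen g) ∈ wspan (1 + s) (wt g + m₀)) {j : ℤ} {m : Multiset (I ⊕ Θ)}
    {x : Lam I Θ} (hx : x ∈ wspan j m) : D x ∈ wspan (j + s) (m + m₀) := by
  refine wspan_linear _ D ?_ hx
  rintro l rfl rfl
  clear hx
  induction l with
  | nil =>
    have := hD 1 1
    simp only [mul_one, one_mul] at this
    simp [left_eq_add.1 this]
  | cons g l ih =>
    simp only [List.map_cons, List.prod_cons, List.length_cons, List.sum_cons, hD]
    refine add_mem ?_ ?_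
    · convert mul_mem_wspan (h g) (list_mem_wspan l) using 1
      push_cast
      rw [show (l.length : ℤ) + 1 + s = 1 + s + l.length by ring, add_right_comm (wt g)]
    · convert mul_mem_wspan (lamGen_mem_wspan g) ih using 1
      push_cast
      rw [show (l.length : ℤ) + 1 + s = 1 + (l.length + s) by ring, add_assoc]

/-- Bracketing joins one factor of `x` with one factor of `y`: the number of factors minus one,
which will be the operadic degree, is additive. The derivation estimate is used twice, with shift
`j'` for `{-, y}` and with shift `0` for the bracket with a generator. -/
lemma br_mem_wspan {j j' : ℤ} {m m' : Multiset (I ⊕ Θ)} {x y : OddLam I Θ}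
    (hx : x.1 ∈ wspan (j + 1) m) (hy : y.1 ∈ wspan (j' + 1) m') :
    (x * y).1 ∈ wspan (j + j' + 1) (m + m') := by
  rw [oddLam_mul, br_val, show j + j' + 1 = j + 1 + j' by ring]
  refine derivation_mem_wspan _ (brDer_mul _ y) (fun g => ?_) hx
  rw [lamGen, brDer_ι, add_comm 1 j', add_comm (wt g) m']
  rw [show j' + 1 = (j' + 1) + 0 by ring]
  refine derivation_mem_wspan _ (der_mul _) (fun g' => ?_) hy
  change genDer _ _ (ExteriorAlgebra.ι ℚ _) ∈ _
  rw [genDer_ι, join_single]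
  rcases g with s | π <;> rcases g' with t | π' <;> simp only [joinGen, map_zero, zero_mem]
  have := lamGen_mem_wspan (Sum.inl (s * t) : BinTree I ⊕ Θ)
  simp only [wt, BinTree.leaves_mul, Multiset.map_add] at this ⊢
  rwa [add_comm (Multiset.map Sum.inl t.leaves)]

lemma ev_mem_wspan {X : K → OddLam I Θ} {r : K → ℤ} {μ : K → Multiset (I ⊕ Θ)}
    (hX : ∀ k, (X k).1 ∈ wspan (r k + 1) (μ k)) (t : BinTree K) :
    (ev X t).1 ∈ wspan ((t.leaves.map r).sum + 1) (t.leaves.map μ).sum := by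
  induction t using BinTree.induct with
  | leaf k => simpa using hX k
  | mul s t hs ht =>
    rw [ev_mul, BinTree.leaves_mul, Multiset.map_add, Multiset.map_add, Multiset.sum_add,
      Multiset.sum_add]
    exact br_mem_wspan hs ht

/-- Evaluating one tree gives one factor plus the sum of `r` over its leaves, so a product of `j`
trees gives `j` plus the total of `r`. -/
lemma subst_mem_wspan {X : K → OddLam I Θ} {r : K → ℤ} {μ : K → Multiset (I ⊕ Θ)}
    (hX : ∀ k, (X k).1 ∈ wspan (r k + 1) (μ k)) {j : ℤ} {m : Multiset K} {z : Lam K Empty}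
    (hz : z ∈ wspan j (m.map Sum.inl)) :
    subst X Empty.elim z ∈ wspan ((m.map r).sum + j) (m.map μ).sum := by
  refine wspan_linear _ (subst X Empty.elim).toLinearMap ?_ hz
  rintro l rfl hm
  -- The multiset of leaves must vary in the induction, since the tail of the list uses only part of
  -- `m`.
  have key : ∀ l : List (BinTree K ⊕ Empty), ∃ m' : Multiset K, (l.map wt).sum = m'.map Sum.inl ∧
      subst X Empty.elim (l.map lamGen).prod ∈ wspan ((m'.map r).sum + l.length) (m'.map μ).sum := by
    intro l
    induction l with
    | nil => exact ⟨0, by simp, by simpa using one_mem_wspan⟩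
    | cons g l ih =>
      obtain ⟨m', h1, h2⟩ := ih
      rcases g with t | e
      · refine ⟨t.leaves + m', by simp [wt, h1], ?_⟩
        rw [List.map_cons, List.prod_cons, map_mul]
        rw [show lamGen (Sum.inl t) = (tree t : Lam K Empty) from rfl, subst_tree]
        convert mul_mem_wspan (ev_mem_wspan hX t) h2 using 2
        · simp only [Multiset.map_add, Multiset.sum_add, List.length_cons]; push_cast; ring
        · simp
      · exact e.elim
  obtain ⟨m', h1, h2⟩ := key l
  rw [h1] at hm
  rw [← Multiset.map_injective Sum.inl_injective hm]
  exact h2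

lemma wspan_parity {j : ℤ} {m : Multiset (I ⊕ Θ)} {z : Lam I Θ} (hz : z ∈ wspan j m) :
    (Even j → z ∈ evenPart (GenSp I Θ)) ∧ (Odd j → z ∈ oddPart (GenSp I Θ)) := by
  have key : ∀ l : List (BinTree I ⊕ Θ),
      (Even (l.length : ℤ) → (l.map lamGen).prod ∈ evenPart (GenSp I Θ)) ∧
      (Odd (l.length : ℤ) → (l.map lamGen).prod ∈ oddPart (GenSp I Θ)) := by
    intro l
    induction l with
    | nil => simp [one_mem_evenPart]
    | cons g l ih =>
      simp only [List.length_cons, List.map_cons, List.prod_cons, Nat.cast_add, Nat.cast_one]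
      refine ⟨fun h => odd_mul_odd (lamGen_mem g) (ih.2 ?_),
        fun h => odd_mul_even (lamGen_mem g) (ih.1 ?_)⟩
      · rw [Int.even_add_one, Int.not_even_iff_odd] at h; exact h
      · rcases h with ⟨c, hc⟩; exact ⟨c, by omega⟩
  constructor
  · intro hj
    refine wspan_linear (evenPart _) LinearMap.id ?_ hz
    rintro l rfl -
    exact (key l).1 hj
  · intro hj
    refine wspan_linear (oddPart _) LinearMap.id ?_ hz
    rintro l rfl -
    exact (key l).2 hj

end

end BOperad

namespace BOperad

noncomputable section

variable {I J K L Θ Θ' : Type}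

/-! ### Contraction with parameters -/

lemma span_lamGen_lists : Submodule.span ℚ
    (Set.range fun l : List (BinTree I ⊕ Θ) => (l.map lamGen).prod) = ⊤ := by
  rw [eq_top_iff]
  rintro z -
  have hmul : ∀ x y : Lam I Θ, x ∈ Submodule.span ℚ
      (Set.range fun l : List (BinTree I ⊕ Θ) => (l.map lamGen).prod) →
      y ∈ Submodule.span ℚ (Set.range fun l : List (BinTree I ⊕ Θ) => (l.map lamGen).prod) →
      x * y ∈ Submodule.span ℚ
        (Set.range fun l : List (BinTree I ⊕ Θ) => (l.map lamGen).prod) := by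
    intro x y hx hy
    have := Submodule.mul_mem_mul hx hy
    rw [Submodule.span_mul_span] at this
    refine Submodule.span_mono ?_ this
    rintro _ ⟨_, ⟨l, rfl⟩, _, ⟨l', rfl⟩, rfl⟩
    exact ⟨l ++ l', by simp⟩
  induction z using ExteriorAlgebra.induction with
  | algebraMap r =>
    rw [Algebra.algebraMap_eq_smul_one]
    exact Submodule.smul_mem _ _ (Submodule.subset_span ⟨[], rfl⟩)
  | ι v =>
    induction v using Finsupp.induction_linear with
    | zero => simp
    | add u v hu hv => rw [map_add]; exact add_mem hu hv
    | single g r =>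
      rw [← mul_one r, ← smul_eq_mul, ← Finsupp.smul_single, map_smul]
      exact Submodule.smul_mem _ _ (Submodule.subset_span ⟨[g], by simp [lamGen]⟩)
  | mul x y hx hy => exact hmul x y hx hy
  | add x y hx hy => exact add_mem hx hy

lemma lam_linear_ext {A : Type} [AddCommGroup A] [Module ℚ A] {S T : Lam I Θ →ₗ[ℚ] A}
    (h : ∀ l : List (BinTree I ⊕ Θ), S (l.map lamGen).prod = T (l.map lamGen).prod) : S = T :=
  LinearMap.ext_on_range span_lamGen_lists h

/-- Contraction with the coordinate of a parameter. -/
def contr (π : Θ) : Lam I Θ →ₗ[ℚ] Lam I Θ :=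
  CliffordAlgebra.contractLeft (Finsupp.lapply (Sum.inr π))

@[simp] lemma contr_one (π : Θ) : contr π (1 : Lam I Θ) = 0 :=
  CliffordAlgebra.contractLeft_one _ _

open Classical in
lemma contr_gen_mul (π : Θ) (g : BinTree I ⊕ Θ) (z : Lam I Θ) :
    contr π (lamGen g * z) = (if g = Sum.inr π then z else 0) - lamGen g * contr π z := by
  refine (CliffordAlgebra.contractLeft_ι_mul _ _ _).trans ?_
  congr 1
  rw [Finsupp.lapply_apply, Finsupp.single_apply]
  split_ifs <;> simp

lemma contr_par_mul (π : Θ) (z : Lam I Θ) :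
    contr π (par π * z) = z - par π * contr π z := by
  rw [par, contr_gen_mul, if_pos rfl]

lemma contr_gen_mul_of_ne {π : Θ} {g : BinTree I ⊕ Θ} (h : g ≠ Sum.inr π) (z : Lam I Θ) :
    contr π (lamGen g * z) = - (lamGen g * contr π z) := by
  rw [contr_gen_mul, if_neg h, zero_sub]

open Classical in
/-- Putting one parameter to zero. -/
def killOne (π : Θ) : Lam I Θ →ₐ[ℚ] Lam I Θ :=
  subst leafO (fun π' => if π' = π then 0 else parO π')

@[simp] lemma killOne_self (π : Θ) : killOne π (par π : Lam I Θ) = 0 := by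
  simp [killOne]

lemma killOne_of_ne {π : Θ} {g : BinTree I ⊕ Θ} (h : g ≠ Sum.inr π) :
    killOne π (lamGen g : Lam I Θ) = lamGen g := by
  rcases g with t | π'
  · have := subst_tree (Θ := Θ) (leafO (I := I))
      (fun π' => open Classical in if π' = π then 0 else parO π') t
    rw [ev_leafO] at this
    exact this
  · have h' : π' ≠ π := fun e => h (by rw [e])
    have := subst_par (Θ := Θ) (leafO (I := I))
      (fun π' => open Classical in if π' = π then 0 else parO π') π'
    simp only [if_neg h'] at this
    exact this

lemma par_sq (π : Θ) : (par π : Lam I Θ) * par π = 0 := odd_sq (lamGen_mem _)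

/-- Taylor expansion in one odd variable: it stops after the linear term because the square of the
parameter is zero. -/
lemma eq_killOne_add (π : Θ) (z : Lam I Θ) : z = killOne π z + par π * contr π z := by
  have : (LinearMap.id : Lam I Θ →ₗ[ℚ] Lam I Θ) =
      (killOne π).toLinearMap + LinearMap.mulLeft ℚ (par π : Lam I Θ) ∘ₗ contr π := by
    apply lam_linear_ext
    intro l
    induction l with
    | nil => simp
    | cons g l ih =>
      simp only [LinearMap.id_apply, LinearMap.add_apply, AlgHom.toLinearMap_apply,
        LinearMap.comp_apply, LinearMap.mulLeft_apply, List.map_cons, List.prod_cons,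
        map_mul] at ih ⊢
      by_cases h : g = Sum.inr π
      · subst h
        change par π * _ = killOne π (par π) * _ + par π * contr π (par π * _)
        rw [killOne_self, contr_par_mul, zero_mul, zero_add, mul_sub, ← mul_assoc, par_sq, zero_mul,
          sub_zero]
      · have hg : (par π : Lam I Θ) * lamGen g = -(lamGen g * par π) :=
          odd_anticomm (lamGen_mem (Sum.inr π)) (lamGen_mem g)
        rw [killOne_of_ne h, contr_gen_mul_of_ne h, mul_neg, ← mul_assoc, hg, neg_mul, neg_neg,
          mul_assoc, ← mul_add, ← ih]
  exact LinearMap.congr_fun this z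

lemma contr_killOne {π π' : Θ} (h : π ≠ π') (z : Lam I Θ) :
    contr π (killOne π' z) = killOne π' (contr π z) := by
  have : contr π ∘ₗ (killOne (I := I) π').toLinearMap = (killOne π').toLinearMap ∘ₗ contr π := by
    apply lam_linear_ext
    intro l
    induction l with
    | nil => simp
    | cons g l ih =>
      simp only [AlgHom.toLinearMap_apply, LinearMap.comp_apply, List.map_cons, List.prod_cons,
        map_mul] at ih ⊢
      by_cases h1 : g = Sum.inr π
      · subst h1
        have hne : (Sum.inr π : BinTree I ⊕ Θ) ≠ Sum.inr π' := fun e => h (Sum.inr_injective e)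
        rw [killOne_of_ne hne]
        change contr π (par π * _) = killOne π' (contr π (par π * _))
        rw [contr_par_mul, contr_par_mul, map_sub, ih, map_mul]
        rw [show killOne π' (par π : Lam I Θ) = par π from killOne_of_ne hne]
      · rw [contr_gen_mul_of_ne h1, map_neg, map_mul (killOne π')]
        by_cases h2 : g = Sum.inr π'
        · subst h2
          rw [show killOne π' (lamGen (Sum.inr π') : Lam I Θ) = 0 from killOne_self π', zero_mul,
            map_zero, zero_mul, neg_zero]
        · rw [killOne_of_ne h2, contr_gen_mul_of_ne h1, ih]
  exact LinearMap.congr_fun this z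

/-- Contraction with a list of parameters. -/
def contrList : List Θ → (Lam I Θ →ₗ[ℚ] Lam I Θ)
  | [] => LinearMap.id
  | π :: l => contrList l ∘ₗ contr π

/-- The parameters are divided out on the left one after the other, in the order in which they stand
in the product. Setting a different parameter to zero commutes with contraction, so the hypothesis
is inherited by each quotient. -/
lemma eq_par_mul_contrList {l : List Θ} (hl : l.Nodup) {z : Lam I Θ}
    (h : ∀ π ∈ l, killOne π z = 0) : z = (l.map par).prod * contrList l z := by
  induction l generalizing z with
  | nil => simp [contrList]
  | cons π l ih =>
    rw [List.nodup_cons] at hl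
    have h1 := eq_killOne_add π z
    rw [h π List.mem_cons_self, zero_add] at h1
    have h2 := ih hl.2 (z := contr π z) (fun π' h' => by
      rw [← contr_killOne (fun e => hl.1 (by rw [e]; exact h')), h π' (List.mem_cons_of_mem _ h'), map_zero])
    rw [List.map_cons, List.prod_cons, mul_assoc]
    change z = par π * (_ * contrList l (contr π z))
    rw [← h2]
    exact h1

lemma contr_inj (π : Θ) (u : I → J) (z : Lam I Empty) : contr π (inj u z) = 0 := by
  have : contr π ∘ₗ (inj u : Lam I Empty →ₐ[ℚ] Lam J Θ).toLinearMap = 0 := by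
    apply lam_linear_ext
    intro l
    induction l with
    | nil => simp
    | cons g l ih =>
      rcases g with t | e
      · simp only [AlgHom.toLinearMap_apply, LinearMap.comp_apply, List.map_cons, List.prod_cons,
          map_mul, LinearMap.zero_apply] at ih ⊢
        have ht : inj u (lamGen (Sum.inl t) : Lam I Empty)
          = (lamGen (Sum.inl (t.relabel u)) : Lam J Θ) := inj_tree u t
        rw [ht, contr_gen_mul_of_ne (by simp), ih, mul_zero, neg_zero]
      · exact e.elim
  exact LinearMap.congr_fun this z

lemma contr_par_prod_mul {π : Θ} {l : List Θ} (h : π ∉ l) {w : Lam I Θ} (hw : contr π w = 0) :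
    contr π ((l.map par).prod * w) = 0 := by
  induction l with
  | nil => simpa using hw
  | cons π' l ih =>
    rw [List.map_cons, List.prod_cons, mul_assoc, par, contr_gen_mul_of_ne, ih, mul_zero, neg_zero]
    · exact fun e => h (List.mem_cons_of_mem _ e)
    · intro e
      exact h (by rw [Sum.inr_injective e]; exact List.mem_cons_self)

lemma contrList_par_prod_mul {l : List Θ} (hl : l.Nodup) {w : Lam I Θ}
    (hw : ∀ π ∈ l, contr π w = 0) : contrList l ((l.map par).prod * w) = w := by
  induction l with
  | nil => simp [contrList]
  | cons π l ih =>
    rw [List.nodup_cons] at hl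
    rw [List.map_cons, List.prod_cons, mul_assoc]
    change contrList l (contr π _) = _
    rw [contr_par_mul, contr_par_prod_mul hl.1 (hw π List.mem_cons_self), mul_zero, sub_zero,
      ih hl.2 (fun π' h => hw π' (List.mem_cons_of_mem _ h))]

/-- Putting all parameters to zero. -/
def kill : Lam I Θ →ₐ[ℚ] Lam I Empty := subst leafO (fun _ => 0)

lemma kill_inj (z : Lam I Empty) : kill (inj (fun i => i) z : Lam I Θ) = z := by
  rw [kill, subst_inj]
  · change inj (fun i => i) z = z
    rw [inj_empty, mapLeaf_id]
  · intro π y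
    exact map_zero _

lemma inj_id_injective : Function.Injective (inj (fun i => i) : Lam I Empty → Lam I Θ) :=
  Function.LeftInverse.injective kill_inj

/-- Contraction with the same list undoes the multiplication, because contractions annihilate
elements without parameters. The composition will be well determined by its parametrized form for
this reason. -/
lemma par_prod_mul_cancel {l : List Θ} (hl : l.Nodup) {y z : Lam I Empty}
    (h : (l.map par).prod * (inj (fun i => i) y : Lam I Θ) = (l.map par).prod * inj (fun i => i) z) :
    y = z := by
  have := congrArg (contrList l) h
  rw [contrList_par_prod_mul hl fun π _ => contr_inj π _ y,
    contrList_par_prod_mul hl fun π _ => contr_inj π _ z] at this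
  exact inj_id_injective this

/-- On a monomial, contraction produces a signed sum of monomials in which one occurrence of the
parameter has been deleted. -/
lemma contr_mem_wspan {π : Θ} {j : ℤ} {m : Multiset (I ⊕ Θ)} {z : Lam I Θ}
    (hz : z ∈ wspan (j + 1) (Sum.inr π ::ₘ m)) : contr π z ∈ wspan j m := by
  refine wspan_linear _ (contr π) ?_ hz
  intro l hl hm
  have key : ∀ l : List (BinTree I ⊕ Θ), contr π (l.map lamGen).prod ∈ Submodule.span ℚ
      {w | ∃ l' : List (BinTree I ⊕ Θ), l'.length + 1 = l.length ∧
        Sum.inr π ::ₘ (l'.map wt).sum = (l.map wt).sum ∧ w = (l'.map lamGen).prod} := by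
    intro l
    induction l with
    | nil => simp
    | cons g l ih =>
      rw [show ((g :: l).map lamGen).prod = lamGen g * (l.map lamGen).prod from List.prod_cons,
        contr_gen_mul]
      refine sub_mem ?_ ?_
      · split_ifs with h
        · refine Submodule.subset_span ⟨l, rfl, ?_, rfl⟩
          subst h
          simp [wt]
        · exact zero_mem _
      · have := Submodule.mem_map_of_mem (f := LinearMap.mulLeft ℚ (lamGen g)) ih
        rw [Submodule.map_span] at this
        refine Submodule.span_mono ?_ this
        rintro _ ⟨_, ⟨l', h1, h2, rfl⟩, rfl⟩
        refine ⟨g :: l', by simp [h1], ?_, by simp⟩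
        rw [List.map_cons, List.sum_cons, List.map_cons, List.sum_cons, ← h2, Multiset.add_cons]
  refine Submodule.span_mono ?_ (key l)
  rintro _ ⟨l', h1, h2, rfl⟩
  refine ⟨l', by omega, ?_, rfl⟩
  rw [hm] at h2
  exact (Multiset.cons_inj_right _).1 h2

lemma contrList_mem_wspan {l : List Θ} {j : ℤ} {m : Multiset (I ⊕ Θ)} {z : Lam I Θ}
    (hz : z ∈ wspan (j + l.length) (((l.map Sum.inr : List (I ⊕ Θ)) : Multiset (I ⊕ Θ)) + m)) :
    contrList l z ∈ wspan j m := by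
  induction l generalizing z with
  | nil => simpa [contrList] using hz
  | cons π l ih =>
    apply ih
    apply contr_mem_wspan
    convert hz using 2
    · push_cast [List.length_cons]
      ring
    · rw [List.map_cons, ← Multiset.cons_coe, Multiset.cons_add]

/-- Trees contribute no parameters to the weight, so every monomial of `z` has the parameter itself
as a factor. -/
lemma killOne_eq_zero {π : Θ} {j : ℤ} {m : Multiset (I ⊕ Θ)} {z : Lam I Θ}
    (hz : z ∈ wspan j m) (hπ : Sum.inr π ∈ m) : killOne π z = 0 := by
  have := wspan_linear ⊥ (killOne π).toLinearMap ?_ hz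
  · simpa using this
  · rintro l - rfl
    rw [Submodule.mem_bot, AlgHom.toLinearMap_apply, map_list_prod]
    apply List.prod_eq_zero
    have : ∃ g ∈ l, Sum.inr π ∈ wt g := by
      clear hz
      induction l with
      | nil => simp at hπ
      | cons g l ih =>
        rw [List.map_cons, List.sum_cons, Multiset.mem_add] at hπ
        rcases hπ with h | h
        · exact ⟨g, List.mem_cons_self, h⟩
        · obtain ⟨g', h1, h2⟩ := ih h
          exact ⟨g', List.mem_cons_of_mem _ h1, h2⟩
    obtain ⟨g, hg, h⟩ := this
    rw [List.map_map, List.mem_map]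
    refine ⟨g, hg, ?_⟩
    rcases g with t | π'
    · simp [wt] at h
    · simp only [wt, Multiset.mem_singleton] at h
      rw [← Sum.inr_injective h]
      exact killOne_self π

lemma sum_wt_map_inl (l : List (BinTree I)) :
    ((l.map (Sum.inl : BinTree I → BinTree I ⊕ Θ)).map wt).sum =
      (l.map BinTree.leaves).sum.map Sum.inl := by
  induction l with
  | nil => simp
  | cons t l ih => simp only [List.map_cons, List.sum_cons, ih, wt, Multiset.map_add]

lemma eq_map_inl_of_wt {l : List (BinTree I ⊕ Θ)} {m : Multiset I}
    (h : (l.map wt).sum = m.map Sum.inl) :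
    ∃ l' : List (BinTree I), l = l'.map Sum.inl ∧ (l'.map BinTree.leaves).sum = m := by
  have : ∃ l' : List (BinTree I), l = l'.map Sum.inl := by
    have hmem : ∀ g ∈ l, ∀ π, Sum.inr π ∉ wt g := by
      intro g hg π hπ
      have : Sum.inr π ∈ (l.map wt).sum := by
        rw [← Multiset.sum_coe]
        exact Multiset.mem_of_le (Multiset.single_le_sum (fun _ _ => Multiset.zero_le _) _
          (Multiset.mem_coe.2 (List.mem_map_of_mem hg))) hπ
      rw [h, Multiset.mem_map] at this
      obtain ⟨_, _, h⟩ := this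
      cases h
    clear h
    induction l with
    | nil => exact ⟨[], rfl⟩
    | cons g l ih =>
      obtain ⟨l', rfl⟩ := ih (fun g' hg' => hmem g' (List.mem_cons_of_mem _ hg'))
      rcases g with t | π
      · exact ⟨t :: l', rfl⟩
      · exact absurd (by simp [wt]) (hmem (Sum.inr π) List.mem_cons_self π)
  obtain ⟨l', rfl⟩ := this
  refine ⟨l', rfl, ?_⟩
  apply Multiset.map_injective (Sum.inl_injective (β := Θ))
  rw [← h, sum_wt_map_inl]

lemma list_tree_mem_wspan (l : List (BinTree I)) :
    ((l.map tree).prod : Lam I Θ) ∈ wspan l.length ((l.map BinTree.leaves).sum.map Sum.inl) := by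
  have := list_mem_wspan (l.map Sum.inl : List (BinTree I ⊕ Θ))
  rw [sum_wt_map_inl, List.map_map, List.length_map] at this
  exact this

/-- Linear maps into a submodule on the span of products of trees. -/
lemma wspan_tree_linear {j : ℤ} {m : Multiset I} {A : Type} [AddCommGroup A] [Module ℚ A]
    (S : Submodule ℚ A) (T : Lam I Θ →ₗ[ℚ] A)
    (h : ∀ l : List (BinTree I), (l.length : ℤ) = j → (l.map BinTree.leaves).sum = m →
      T (l.map tree).prod ∈ S) {x : Lam I Θ} (hx : x ∈ wspan j (m.map Sum.inl)) : T x ∈ S := by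
  refine wspan_linear S T ?_ hx
  intro l h1 h2
  obtain ⟨l', rfl, h3⟩ := eq_map_inl_of_wt h2
  have := h l' (by simpa using h1) h3
  rwa [List.map_map]

/-- A weight free of parameters means that only trees occur, and these are untouched when parameters
are set to zero. -/
lemma inj_kill {j : ℤ} {m : Multiset I} {z : Lam I Θ} (hz : z ∈ wspan j (m.map Sum.inl)) :
    inj (fun i => i) (kill z) = z := by
  have := wspan_tree_linear ⊥ ((inj (fun i => i)).toLinearMap ∘ₗ kill.toLinearMap - LinearMap.id)
    ?_ hz
  · rw [Submodule.mem_bot] at this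
    exact sub_eq_zero.1 this
  · intro l _ _
    rw [Submodule.mem_bot, LinearMap.sub_apply, sub_eq_zero, LinearMap.comp_apply,
      AlgHom.toLinearMap_apply, AlgHom.toLinearMap_apply, LinearMap.id_apply,
      map_list_prod, map_list_prod, List.map_map, List.map_map]
    congr 2
    funext t
    simp only [Function.comp_apply, kill, subst_tree, ev_leafO]
    exact (inj_tree _ t).trans (congrArg _ (BinTree.graft_leaf_right t))

lemma kill_mem_wspan {j : ℤ} {m : Multiset I} {z : Lam I Θ} (hz : z ∈ wspan j (m.map Sum.inl)) :
    kill z ∈ wspan j (m.map Sum.inl) := by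
  refine wspan_tree_linear _ kill.toLinearMap ?_ hz
  rintro l rfl rfl
  rw [AlgHom.toLinearMap_apply, map_list_prod, List.map_map]
  have : kill ∘ (tree : BinTree I → Lam I Θ) = tree := by
    funext t
    simp only [Function.comp_apply, kill, subst_tree, ev_leafO]
    rfl
  rw [this]
  exact list_tree_mem_wspan l

/-! ### Linearity of substitution in one input -/

lemma ev_congr {X Y : K → OddLam I Θ} {t : BinTree K} (h : ∀ k ∈ t.leaves, X k = Y k) :
    ev X t = ev Y t := by
  induction t using BinTree.induct with
  | leaf k => exact h k (by simp)
  | mul s t hs ht =>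
    simp only [BinTree.leaves_mul, Multiset.mem_add] at h
    rw [ev_mul, ev_mul, hs fun k hk => h k (Or.inl hk), ht fun k hk => h k (Or.inr hk)]

lemma not_mem_of_cons_add {m₁ m₂ : Multiset K} {k : K} (h : (m₁ + m₂).Nodup) (hk : k ∈ m₁) :
    k ∉ m₂ := fun hk' => (Multiset.disjoint_left.1 (Multiset.nodup_add.1 h).2.2) hk hk'

/-- The label `k` sits on exactly one leaf, so at each vertex above it only one of the two subtrees
changes, and the bracket is additive in that one. -/
lemma ev_add {X Y Z : K → OddLam I Θ} {k : K} (hX : ∀ k' ≠ k, X k' = Z k')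
    (hY : ∀ k' ≠ k, Y k' = Z k') (hk : Z k = X k + Y k) {t : BinTree K} (ht : t.leaves.Nodup)
    (hm : k ∈ t.leaves) : ev Z t = ev X t + ev Y t := by
  induction t using BinTree.induct with
  | leaf k' =>
    obtain rfl : k = k' := by simpa using hm
    exact hk
  | mul s t hs h't =>
    have hne : ∀ {t' : BinTree K}, k ∉ t'.leaves → ∀ k' ∈ t'.leaves, k' ≠ k := by
      rintro t' h' k' hk' rfl; exact h' hk'
    rw [BinTree.leaves_mul] at ht hm
    rw [ev_mul, ev_mul, ev_mul]
    rcases Multiset.mem_add.1 hm with h | h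
    · have h2 := hne (not_mem_of_cons_add ht h)
      rw [hs (Multiset.nodup_add.1 ht).1 h, ev_congr fun k' hk' => hX k' (h2 k' hk'),
        ev_congr fun k' hk' => hY k' (h2 k' hk')]
      exact br_add_left _ _ _
    · have h2 := hne (not_mem_of_cons_add (add_comm s.leaves t.leaves ▸ ht) h)
      rw [h't (Multiset.nodup_add.1 ht).2.1 h, ev_congr fun k' hk' => hX k' (h2 k' hk'),
        ev_congr fun k' hk' => hY k' (h2 k' hk')]
      rw [mul_comm, mul_comm (ev Z s), mul_comm (ev Z s)]
      exact br_add_left _ _ _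

lemma ev_const_mul {X Z : K → OddLam I Θ} {k : K} {c : Lam I Θ} (hc : IsPar c)
    (hX : ∀ k' ≠ k, X k' = Z k') (hk : (Z k).1 = c * (X k).1) {t : BinTree K}
    (ht : t.leaves.Nodup) (hm : k ∈ t.leaves) : (ev Z t).1 = c * (ev X t).1 := by
  induction t using BinTree.induct with
  | leaf k' =>
    obtain rfl : k = k' := by simpa using hm
    exact hk
  | mul s t hs h't =>
    have hne : ∀ {t' : BinTree K}, k ∉ t'.leaves → ∀ k' ∈ t'.leaves, k' ≠ k := by
      rintro t' h' k' hk' rfl; exact h' hk'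
    rw [BinTree.leaves_mul] at ht hm
    rw [ev_mul, ev_mul]
    rcases Multiset.mem_add.1 hm with h | h
    · have h2 := hne (not_mem_of_cons_add ht h)
      rw [ev_congr (X := X) (t := t) fun k' hk' => hX k' (h2 k' hk')]
      exact br_const_mul hc (hs (Multiset.nodup_add.1 ht).1 h)
    · have h2 := hne (not_mem_of_cons_add (add_comm s.leaves t.leaves ▸ ht) h)
      rw [ev_congr (X := X) (t := s) fun k' hk' => hX k' (h2 k' hk'), mul_comm,
        mul_comm (ev Z s)]
      exact br_const_mul hc (h't (Multiset.nodup_add.1 ht).2.1 h)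

lemma list_subst_congr {X Z : K → OddLam I Θ} {k : K} (hX : ∀ k' ≠ k, X k' = Z k')
    {l : List (BinTree K)} (hl : k ∉ (l.map BinTree.leaves).sum) :
    l.map (fun t => (ev X t).1) = l.map (fun t => (ev Z t).1) := by
  induction l with
  | nil => rfl
  | cons t l ih =>
    rw [List.map_cons, List.sum_cons, Multiset.mem_add, not_or] at hl
    rw [List.map_cons, List.map_cons, ih hl.2, ev_congr fun k' hk' => hX k' ?_]
    rintro rfl
    exact hl.1 hk'

lemma list_ev_add {X Y Z : K → OddLam I Θ} {k : K} (hX : ∀ k' ≠ k, X k' = Z k')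
    (hY : ∀ k' ≠ k, Y k' = Z k') (hk : Z k = X k + Y k) {l : List (BinTree K)}
    (hl : (l.map BinTree.leaves).sum.Nodup) (hm : k ∈ (l.map BinTree.leaves).sum) :
    (l.map (fun t => (ev Z t).1)).prod =
      (l.map (fun t => (ev X t).1)).prod + (l.map (fun t => (ev Y t).1)).prod := by
  induction l with
  | nil => simp at hm
  | cons t l ih =>
    rw [List.map_cons, List.sum_cons] at hl hm
    simp only [List.map_cons, List.prod_cons]
    rcases Multiset.mem_add.1 hm with h | h
    · have h2 := not_mem_of_cons_add hl h
      rw [list_subst_congr hX h2, list_subst_congr hY h2,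
        ev_add hX hY hk (Multiset.nodup_add.1 hl).1 h, ← add_mul]
      rfl
    · have h2 := not_mem_of_cons_add (add_comm t.leaves _ ▸ hl) h
      have hne : ∀ k' ∈ t.leaves, k' ≠ k := by rintro k' hk' rfl; exact h2 hk'
      rw [ih (Multiset.nodup_add.1 hl).2.1 h, ev_congr fun k' hk' => hX k' (hne k' hk'),
        ev_congr fun k' hk' => hY k' (hne k' hk'), mul_add]

/-- Evenness of `c` is needed to bring it to the front, past the factors that precede the one
containing `k`. -/
lemma list_ev_const_mul {X Z : K → OddLam I Θ} {k : K} {c : Lam I Θ} (hc : IsPar c)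
    (hc' : c ∈ evenPart (GenSp I Θ)) (hX : ∀ k' ≠ k, X k' = Z k') (hk : (Z k).1 = c * (X k).1)
    {l : List (BinTree K)} (hl : (l.map BinTree.leaves).sum.Nodup)
    (hm : k ∈ (l.map BinTree.leaves).sum) :
    (l.map (fun t => (ev Z t).1)).prod = c * (l.map (fun t => (ev X t).1)).prod := by
  induction l with
  | nil => simp at hm
  | cons t l ih =>
    rw [List.map_cons, List.sum_cons] at hl hm
    simp only [List.map_cons, List.prod_cons]
    rcases Multiset.mem_add.1 hm with h | h
    · have h2 := not_mem_of_cons_add hl h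
      rw [list_subst_congr hX h2, ev_const_mul hc hX hk (Multiset.nodup_add.1 hl).1 h, mul_assoc]
    · have h2 := not_mem_of_cons_add (add_comm t.leaves _ ▸ hl) h
      have hne : ∀ k' ∈ t.leaves, k' ≠ k := by rintro k' hk' rfl; exact h2 hk'
      rw [ih (Multiset.nodup_add.1 hl).2.1 h, ev_congr fun k' hk' => hX k' (hne k' hk'),
        ← mul_assoc, ← even_comm hc', mul_assoc]

lemma subst_list_tree (X : K → OddLam I Θ) (θ : Θ' → OddLam I Θ) (l : List (BinTree K)) :
    subst X θ (l.map tree).prod = (l.map (fun t => (ev X t).1)).prod := by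
  rw [map_list_prod, List.map_map]
  congr 2
  funext t
  exact subst_tree X θ t

lemma subst_add {X Y Z : K → OddLam I Θ} {k : K} (hX : ∀ k' ≠ k, X k' = Z k')
    (hY : ∀ k' ≠ k, Y k' = Z k') (hk : Z k = X k + Y k) {j : ℤ} {m : Multiset K} (hm : m.Nodup)
    (hkm : k ∈ m) {z : Lam K Empty} (hz : z ∈ wspan j (m.map Sum.inl)) :
    subst Z Empty.elim z = subst X Empty.elim z + subst Y Empty.elim z := by
  have := wspan_tree_linear ⊥ ((subst Z Empty.elim).toLinearMap - ((subst X Empty.elim).toLinearMap +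
    (subst Y Empty.elim).toLinearMap)) ?_ hz
  · rw [Submodule.mem_bot] at this
    exact sub_eq_zero.1 this
  · rintro l - rfl
    rw [Submodule.mem_bot, LinearMap.sub_apply, sub_eq_zero, LinearMap.add_apply,
      AlgHom.toLinearMap_apply, AlgHom.toLinearMap_apply, AlgHom.toLinearMap_apply,
      subst_list_tree, subst_list_tree, subst_list_tree, list_ev_add hX hY hk hm hkm]

lemma subst_const_mul {X Z : K → OddLam I Θ} {k : K} {c : Lam I Θ} (hc : IsPar c)
    (hc' : c ∈ evenPart (GenSp I Θ)) (hX : ∀ k' ≠ k, X k' = Z k') (hk : (Z k).1 = c * (X k).1)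
    {j : ℤ} {m : Multiset K} (hm : m.Nodup)
    (hkm : k ∈ m) {z : Lam K Empty} (hz : z ∈ wspan j (m.map Sum.inl)) :
    subst Z Empty.elim z = c * subst X Empty.elim z := by
  have := wspan_tree_linear ⊥ ((subst Z Empty.elim).toLinearMap -
    LinearMap.mulLeft ℚ c ∘ₗ (subst X Empty.elim).toLinearMap) ?_ hz
  · rw [Submodule.mem_bot] at this
    exact sub_eq_zero.1 this
  · rintro l - rfl
    rw [Submodule.mem_bot, LinearMap.sub_apply, sub_eq_zero, LinearMap.comp_apply,
      AlgHom.toLinearMap_apply, AlgHom.toLinearMap_apply, LinearMap.mulLeft_apply,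
      subst_list_tree, subst_list_tree, list_ev_const_mul hc hc' hX hk hm hkm]

end

end BOperad

namespace BOperad

noncomputable section

/-! ### Parity -/

section Parity

variable {V W : Type} [AddCommGroup V] [Module ℚ V] [AddCommGroup W] [Module ℚ W]

/-- The element `x` is homogeneous of the parity of `d`. -/
def HasPar (d : ℤ) (x : ExteriorAlgebra ℚ V) : Prop :=
  (Even d → x ∈ evenPart V) ∧ (Odd d → x ∈ oddPart V)

lemma HasPar.mul {d d' : ℤ} {x y : ExteriorAlgebra ℚ V} (hx : HasPar d x) (hy : HasPar d' y) :
    HasPar (d + d') (x * y) := by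
  rcases Int.even_or_odd d with h | h <;> rcases Int.even_or_odd d' with h' | h'
  · exact ⟨fun _ => even_mul_even (hx.1 h) (hy.1 h'), fun h'' => by
      rw [← Int.not_even_iff_odd] at h''; exact absurd (h.add h') h''⟩
  · exact ⟨fun h'' => by rw [← Int.not_odd_iff_even] at h''; exact absurd (h.add_odd h') h'',
      fun _ => even_mul_odd (hx.1 h) (hy.2 h')⟩
  · exact ⟨fun h'' => by rw [← Int.not_odd_iff_even] at h''; exact absurd (h.add_even h') h'',
      fun _ => odd_mul_even (hx.2 h) (hy.1 h')⟩
  · exact ⟨fun _ => odd_mul_odd (hx.2 h) (hy.2 h'), fun h'' => by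
      rw [← Int.not_even_iff_odd] at h''; exact absurd (h.add_odd h') h''⟩

lemma hasPar_one : HasPar 0 (1 : ExteriorAlgebra ℚ V) :=
  ⟨fun _ => one_mem_evenPart, fun h => absurd h (by decide)⟩

lemma HasPar.units_smul {d : ℤ} {x : ExteriorAlgebra ℚ V} (hx : HasPar d x) (ε : ℤˣ) :
    HasPar d (ε • x) := by
  rw [Units.smul_def]
  exact ⟨fun h => zsmul_mem (hx.1 h) _, fun h => zsmul_mem (hx.2 h) _⟩

lemma HasPar.comm {d d' : ℤ} {x y : ExteriorAlgebra ℚ V} (hx : HasPar d x) (hy : HasPar d' y) :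
    y * x = (d * d').negOnePow • (x * y) := by
  rcases Int.even_or_odd d with h | h
  · rw [even_comm (hx.1 h), Int.negOnePow_even _ (h.mul_right _), one_smul]
  · rcases Int.even_or_odd d' with h' | h'
    · rw [← even_comm (hy.1 h'), Int.negOnePow_even _ (h'.mul_left _), one_smul]
    · rw [odd_anticomm (hy.2 h') (hx.2 h), Int.negOnePow_odd _ (h.mul h'), Units.neg_smul, one_smul]

lemma HasPar.map {d : ℤ} {x : ExteriorAlgebra ℚ V} (hx : HasPar d x)
    (F : ExteriorAlgebra ℚ V →ₐ[ℚ] ExteriorAlgebra ℚ W)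
    (hF : ∀ v, F (ExteriorAlgebra.ι ℚ v) ∈ oddPart W) : HasPar d (F x) :=
  ⟨fun h => map_mem_evenPart F hF (hx.1 h), fun h => map_mem_oddPart F hF (hx.2 h)⟩

end Parity

/-! ### Ordered products -/

section OrderedProduct

variable {K L : Type} [Fintype K] [LinearOrder K] [Fintype L] [LinearOrder L]

/-- The product over a finite linearly ordered set, in increasing order. -/
def oprod {A : Type} [Monoid A] (v : K → A) : A :=
  ((Finset.univ.sort (· ≤ · : K → K → Prop)).map v).prod

variable {A : Type} [Monoid A]

lemma oprod_fin {n : ℕ} (v : Fin n → A) : oprod v = (List.ofFn v).prod := by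
  rw [oprod, Fin.sort_univ, List.ofFn_eq_map]

lemma sort_eq_of_pairwise {l : List K} (h1 : l.Pairwise (· ≤ ·)) (h2 : l.Nodup)
    (h3 : ∀ k, k ∈ l) : Finset.univ.sort (· ≤ · : K → K → Prop) = l := by
  refine List.Perm.eq_of_pairwise' (Finset.pairwise_sort _ _) h1 ?_
  rw [List.perm_ext_iff_of_nodup (Finset.sort_nodup _ _) h2]
  simp [h3]

lemma oprod_orderIso (σ : K ≃o L) (v : L → A) : oprod (fun k => v (σ k)) = oprod v := by
  unfold oprod
  rw [sort_eq_of_pairwise (K := L) (l := (Finset.univ.sort (· ≤ · : K → K → Prop)).map σ),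
    List.map_map]
  · rfl
  · rw [List.pairwise_map]
    simp only [OrderIso.le_iff_le]
    exact Finset.pairwise_sort _ _
  · exact (Finset.sort_nodup _ _).map σ.injective
  · intro l
    rw [List.mem_map]
    exact ⟨σ.symm l, by simp, by simp⟩

/-- For monotone `g` the fibres are consecutive in `K`: concatenating their sorted lists in the
order of `L` already gives the sorted list of `K`. No factors are commuted, so no sign appears. -/
lemma oprod_fibers {g : K → L} (hg : Monotone g) (v : K → A) :
    oprod (fun l => oprod (fun k : {k // g k = l} => v k)) = oprod v := by
  unfold oprod
  rw [sort_eq_of_pairwise (K := K) (l := (Finset.univ.sort (· ≤ · : L → L → Prop)).flatMap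
    (fun l => (Finset.univ.sort (· ≤ · : {k // g k = l} → _ → Prop)).map Subtype.val)),
    List.map_flatMap]
  · have h : ∀ (l : List L) (f : L → List A),
        (l.flatMap f).prod = (l.map fun a => (f a).prod).prod := by
      intro l f
      induction l with
      | nil => simp
      | cons a l ih => simp [ih]
    rw [h]
    simp only [List.map_map]
    rfl
  · rw [List.pairwise_flatMap]
    constructor
    · intro l _
      rw [List.pairwise_map]
      exact Finset.pairwise_sort _ _
    · refine (Finset.sortedLT_sort (Finset.univ : Finset L)).pairwise.imp ?_
      intro a b hab x hx y hy
      obtain ⟨x, -, rfl⟩ := List.mem_map.1 hx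
      obtain ⟨y, -, rfl⟩ := List.mem_map.1 hy
      by_contra h
      have := hg (not_le.1 h).le
      rw [x.2, y.2] at this
      exact absurd hab (not_lt.2 this)
  · rw [List.nodup_flatMap]
    constructor
    · intro l _
      exact (Finset.sort_nodup _ _).map Subtype.val_injective
    · refine (Finset.sort_nodup (Finset.univ : Finset L) _).imp ?_
      intro a b hab
      rw [Function.onFun, List.disjoint_left]
      intro x hx hy
      obtain ⟨x, -, rfl⟩ := List.mem_map.1 hx
      obtain ⟨y, -, h⟩ := List.mem_map.1 hy
      exact hab (x.2.symm.trans ((congrArg g h.symm).trans y.2))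
  · intro k
    rw [List.mem_flatMap]
    exact ⟨g k, by simp, List.mem_map.2 ⟨⟨k, rfl⟩, by simp, rfl⟩⟩

lemma map_oprod {B : Type} [Monoid B] (F : A →* B) (v : K → A) :
    F (oprod v) = oprod (fun k => F (v k)) := by
  rw [oprod, map_list_prod, List.map_map]; rfl

lemma oprod_ite (p : K → Prop) [DecidablePred p] (v : K → A) :
    oprod (fun k => if p k then v k else 1) =
      (((Finset.univ.sort (· ≤ · : K → K → Prop)).filter p).map v).prod := by
  unfold oprod
  induction Finset.univ.sort (· ≤ · : K → K → Prop) with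
  | nil => simp
  | cons k l ih =>
    by_cases h : p k <;> simp [h, ih]

lemma oprod_units_smul {B : Type} [Ring B] (ε : K → ℤˣ) (v : K → B) :
    oprod (fun k => ε k • v k) = (∏ k, ε k) • oprod v := by
  have : ∏ k, ε k = ((Finset.univ.sort (· ≤ · : K → K → Prop)).map ε).prod := by
    rw [← List.prod_toFinset _ (Finset.sort_nodup _ _), Finset.sort_toFinset]
  rw [this]
  unfold oprod
  induction Finset.univ.sort (· ≤ · : K → K → Prop) with
  | nil => simp
  | cons k l ih =>
    simp only [List.map_cons, List.prod_cons, ih, smul_mul_assoc, mul_smul_comm, smul_smul]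
    rw [mul_comm]

lemma oprod_update_mul {B : Type} [Monoid B] (v w : K → B) (k₀ : K) (c : B)
    (hc : ∀ b, c * b = b * c) (h : ∀ k ≠ k₀, w k = v k) (h₀ : w k₀ = c * v k₀) :
    oprod w = c * oprod v := by
  unfold oprod
  have key : ∀ l : List K, l.Nodup → (k₀ ∉ l → (l.map w).prod = (l.map v).prod) ∧
      (k₀ ∈ l → (l.map w).prod = c * (l.map v).prod) := by
    intro l hl
    induction l with
    | nil => simp
    | cons k l ih =>
      rw [List.nodup_cons] at hl
      simp only [List.map_cons, List.prod_cons, List.mem_cons, not_or]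
      constructor
      · rintro ⟨h1, h2⟩
        rw [h k (Ne.symm h1), (ih hl.2).1 h2]
      · intro h1
        by_cases h2 : k₀ = k
        · subst h2
          rw [(ih hl.2).1 hl.1, h₀, mul_assoc]
        · rw [h k (Ne.symm h2), (ih hl.2).2 (h1.resolve_left h2), ← mul_assoc, ← hc, mul_assoc]
  exact (key _ (Finset.sort_nodup _ _)).2 (by simp)

/-- To separate the two families, each `w j` has to pass every `v i` with `j < i`. In the induction
`w 0` moves past all later `v i`. -/
lemma ofFn_prod_mul {B : Type} [Ring B] {n : ℕ} (v w : Fin n → B) (a b : Fin n → ℤ)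
    (h : ∀ i j, w j * v i = (a i * b j).negOnePow • (v i * w j)) :
    (List.ofFn (fun i => v i * w i)).prod =
      (∏ i, ∏ j, if j < i then (a i * b j).negOnePow else 1) •
        ((List.ofFn v).prod * (List.ofFn w).prod) := by
  induction n with
  | zero => simp
  | succ n ih =>
    simp only [List.ofFn_succ, List.prod_cons]
    rw [ih (fun i => v i.succ) (fun i => w i.succ) (fun i => a i.succ) (fun i => b i.succ)
      (fun i j => h _ _)]
    have h1 : ∀ (n : ℕ) (v : Fin n → B) (a : Fin n → ℤ) (x : B) (b : ℤ)
        (_ : ∀ i, x * v i = (a i * b).negOnePow • (v i * x)),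
        x * (List.ofFn v).prod = (∏ i, (a i * b).negOnePow) • ((List.ofFn v).prod * x) := by
      intro n v a x b h
      induction n with
      | zero => simp
      | succ n ih =>
        simp only [List.ofFn_succ, List.prod_cons, Fin.prod_univ_succ]
        rw [← mul_assoc, h, smul_mul_assoc, mul_assoc,
          ih (fun i => v i.succ) (fun i => a i.succ) (fun i => h _), mul_smul_comm, smul_smul,
          mul_assoc]
    have h2 := h1 n (fun i => v i.succ) (fun i => a i.succ) (w 0) (b 0) (fun i => h _ _)
    rw [mul_smul_comm, mul_assoc, ← mul_assoc (w 0), h2, smul_mul_assoc, mul_smul_comm, smul_smul]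
    simp only [mul_assoc]
    congr 1
    rw [Fin.prod_univ_succ]
    simp only [Fin.prod_univ_succ, Fin.not_lt_zero, if_false, Finset.prod_const_one, one_mul,
      Fin.succ_lt_succ_iff, Fin.succ_pos, if_true, Finset.prod_mul_distrib]
    rw [mul_comm]

lemma oprod_mul {B : Type} [Ring B] (v w : K → B) (a b : K → ℤ)
    (h : ∀ i j, w j * v i = (a i * b j).negOnePow • (v i * w j)) :
    oprod (fun i => v i * w i) =
      (∏ i, ∏ j, if j < i then (a i * b j).negOnePow else 1) • (oprod v * oprod w) := by
  let o : Fin (Fintype.card K) ≃o K := Fintype.orderIsoFinOfCardEq K rfl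
  rw [← oprod_orderIso o, ← oprod_orderIso o v, ← oprod_orderIso o w, oprod_fin, oprod_fin,
    oprod_fin, ofFn_prod_mul _ _ (fun i => a (o i)) (fun i => b (o i)) (fun i j => h _ _)]
  congr 1
  rw [← Equiv.prod_comp o.toEquiv]
  refine Finset.prod_congr rfl fun i _ => ?_
  rw [← Equiv.prod_comp o.toEquiv]
  refine Finset.prod_congr rfl fun j _ => ?_
  simp

lemma hasPar_oprod {V : Type} [AddCommGroup V] [Module ℚ V] {v : K → ExteriorAlgebra ℚ V}
    {d : K → ℤ} (h : ∀ k, HasPar (d k) (v k)) : HasPar (∑ k, d k) (oprod v) := by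
  have : ∑ k, d k = ((Finset.univ.sort (· ≤ · : K → K → Prop)).map d).sum := by
    rw [← List.sum_toFinset _ (Finset.sort_nodup _ _), Finset.sort_toFinset]
  rw [this]
  unfold oprod
  induction Finset.univ.sort (· ≤ · : K → K → Prop) with
  | nil => simpa using hasPar_one
  | cons k l ih =>
    rw [List.map_cons, List.sum_cons, List.map_cons, List.prod_cons]
    exact (h k).mul ih

lemma isConst_oprod {V : Type} [AddCommGroup V] [Module ℚ V] {β : V →ₗ[ℚ] V →ₗ[ℚ] V}
    {v : K → ExteriorAlgebra ℚ V} (h : ∀ k, IsConst β (v k)) : IsConst β (oprod v) := by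
  apply IsConst.list_prod
  intro c hc
  obtain ⟨k, -, rfl⟩ := List.mem_map.1 hc
  exact h k

end OrderedProduct

/-! ### The sign of the parametrized composition -/

section Sign

/-- The second elementary symmetric function `∑_{k < l} d_k d_l`. -/
def esymm₂ {K : Type} [Fintype K] (d : K → ℤ) : ℤ := ((∑ k, d k) ^ 2 - ∑ k, d k ^ 2) / 2

/-- The division by two in `esymm₂` is exact, since `x² = x` modulo `2`. -/
lemma two_mul_esymm₂ {K : Type} [Fintype K] (d : K → ℤ) :
    2 * esymm₂ d = (∑ k, d k) ^ 2 - ∑ k, d k ^ 2 := by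
  apply Int.mul_ediv_cancel'
  have h : ∀ x : ℤ, ((x : ZMod 2)) ^ 2 = x := by
    intro x
    have : ∀ y : ZMod 2, y ^ 2 = y := by decide
    exact this _
  have := (ZMod.intCast_zmod_eq_zero_iff_dvd ((∑ k, d k) ^ 2 - ∑ k, d k ^ 2) 2).1 (by
    push_cast
    rw [← Int.cast_sum, h]
    simp only [h]
    push_cast
    ring)
  exact_mod_cast this

lemma esymm₂_comp {K L : Type} [Fintype K] [Fintype L] (σ : K ≃ L) (d : L → ℤ) :
    esymm₂ (fun k => d (σ k)) = esymm₂ d := by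
  have h1 := Equiv.sum_comp σ d
  have h2 := Equiv.sum_comp σ (fun l => d l ^ 2)
  simp only [esymm₂, h1, h2]

lemma prod_negOnePow {K : Type} (s : Finset K) (d : K → ℤ) :
    ∏ k ∈ s, (d k).negOnePow = (∑ k ∈ s, d k).negOnePow := by
  classical
  induction s using Finset.induction_on with
  | empty => simp
  | insert a s ha ih => rw [Finset.prod_insert ha, Finset.sum_insert ha, ih, Int.negOnePow_add]

lemma prod_ite_negOnePow {K : Type} [Fintype K] [LinearOrder K] (d : K → ℤ) :
    (∏ i, ∏ j, if j < i then (d i * d j).negOnePow else 1) = (esymm₂ d).negOnePow := by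
  have h1 : ∀ i j, (if j < i then (d i * d j).negOnePow else 1)
      = (if j < i then d i * d j else 0).negOnePow := by
    intro i j; split_ifs <;> simp
  simp only [h1, prod_negOnePow]
  congr 1
  have h2 : ∑ i, ∑ j, (if j < i then d i * d j else 0) + ∑ i, ∑ j, (if j < i then d i * d j else 0)
      = (∑ k, d k) ^ 2 - ∑ k, d k ^ 2 := by
    conv_lhs => rw [add_comm]; arg 1; rw [Finset.sum_comm]
    rw [← Finset.sum_add_distrib, sq, Finset.sum_mul_sum, ← Finset.sum_sub_distrib]
    refine Finset.sum_congr rfl fun i _ => ?_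
    have h3 : d i ^ 2 = ∑ j, if i = j then d i ^ 2 else 0 := by simp
    rw [← Finset.sum_add_distrib, eq_sub_iff_add_eq, h3, ← Finset.sum_add_distrib]
    refine Finset.sum_congr rfl fun j _ => ?_
    rcases lt_trichotomy i j with h | h | h
    · simp [h, h.not_gt, h.ne, mul_comm]
    · subst h; simp [sq]
    · simp [h, h.not_gt, h.ne']
  have h3 := two_mul_esymm₂ d
  omega

/-- The sign relating parametrized and signed compositions. -/
def epsSign {K : Type} [Fintype K] (c : ℤ) (d : K → ℤ) : ℤˣ := (c * ∑ k, d k + esymm₂ d).negOnePow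

/-- The cocycle identity that associativity demands of the sign. It is an equality of the exponents
themselves: with `t l = a l + ∑ b` over the fibre, expanding the second elementary symmetric
function of `t` leaves exactly the mixed terms `a l * ∑ b` and the contributions of the single
fibres. The computation is done after doubling, where everything is a polynomial in sums and sums of
squares. -/
lemma epsSign_mul {K L : Type} [Fintype K] [Fintype L] [DecidableEq L] (g : K → L) {c s : ℤ}
    {a t : L → ℤ} {b : K → ℤ} (h₁ : c + ∑ l, a l = s)
    (h₃ : ∀ l, a l + ∑ k : {k // g k = l}, b k = t l) :
    epsSign c a * epsSign s b =
      (∏ l, epsSign (a l) (fun k : {k // g k = l} => b k)) * epsSign c t := by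
  simp only [epsSign, prod_negOnePow, ← Int.negOnePow_add]
  congr 1
  have hB : ∀ d : K → ℤ, ∑ l, ∑ k : {k // g k = l}, d k = ∑ k, d k :=
    fun d => Fintype.sum_fiberwise g d
  have e1 := two_mul_esymm₂ a
  have e2 := two_mul_esymm₂ b
  have e3 := two_mul_esymm₂ t
  have e4 : 2 * ∑ l, esymm₂ (fun k : {k // g k = l} => b k) =
      ∑ l, (∑ k : {k // g k = l}, b k) ^ 2 - ∑ k, b k ^ 2 := by
    rw [Finset.mul_sum, ← hB, ← Finset.sum_sub_distrib]
    exact Finset.sum_congr rfl fun l _ => two_mul_esymm₂ _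
  have e5 : ∑ l, t l = ∑ l, a l + ∑ k, b k := by
    rw [← hB, ← Finset.sum_add_distrib]
    exact Finset.sum_congr rfl fun l _ => (h₃ l).symm
  have e6 : ∑ l, t l ^ 2 = ∑ l, a l ^ 2 + 2 * ∑ l, a l * ∑ k : {k // g k = l}, b k +
      ∑ l, (∑ k : {k // g k = l}, b k) ^ 2 := by
    rw [Finset.mul_sum, ← Finset.sum_add_distrib, ← Finset.sum_add_distrib]
    refine Finset.sum_congr rfl fun l _ => ?_
    rw [← h₃ l]
    ring
  rw [Finset.sum_add_distrib]
  subst h₁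
  rw [e5] at e3 ⊢
  rw [e6] at e3
  have : 2 * (c * ∑ l, a l + esymm₂ a + ((c + ∑ l, a l) * ∑ k, b k + esymm₂ b)) =
    2 * (∑ l, a l * ∑ k : {k // g k = l}, b k + ∑ l, esymm₂ (fun k : {k // g k = l} => b k) +
      (c * (∑ l, a l + ∑ k, b k) + esymm₂ t)) := by
    linear_combination e1 + e2 - e3 - e4
  omega

end Sign

end

end BOperad

namespace BOperad

noncomputable section

variable {I J K L Θ Θ' : Type}

/-! ### The species of products of trees -/

/-- The multiset containing each element once. -/
def full (I : Type) [Finite I] : Multiset I := (Set.finite_univ (α := I)).toFinset.val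

lemma nodup_full [Finite I] : (full I).Nodup := Finset.nodup _

lemma mem_full [Finite I] (i : I) : i ∈ full I := by simp [full]

lemma eq_full [Finite I] {m : Multiset I} (h : m.Nodup) (h' : ∀ i, i ∈ m) : m = full I :=
  (Multiset.Nodup.ext h nodup_full).2 fun i => by simp [h', mem_full]

lemma full_eq [Fintype I] : full I = (Finset.univ : Finset I).val :=
  (eq_full (Finset.nodup _) (by simp)).symm

lemma full_map [Finite I] [Finite J] (u : I ≃ J) : (full I).map u = full J :=
  eq_full (nodup_full.map u.injective) fun j => Multiset.mem_map.2 ⟨u.symm j, mem_full _, by simp⟩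

lemma sum_full_fibers [Finite I] [Fintype K] (f : I → K) :
    ∑ k, (full {i // f i = k}).map Subtype.val = full I := by
  classical
  apply eq_full
  · rw [Finset.sum_eq_multiset_sum, ← Multiset.join, ← Multiset.bind]
    refine Multiset.nodup_bind.2 ⟨fun k _ => nodup_full.map Subtype.val_injective, ?_⟩
    refine (Finset.nodup _).pairwise ?_
    intro a _ b _ hab
    rw [Function.onFun, Multiset.disjoint_left]
    intro i hi hi'
    obtain ⟨x, -, rfl⟩ := Multiset.mem_map.1 hi
    obtain ⟨y, -, h⟩ := Multiset.mem_map.1 hi'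
    exact hab (x.2.symm.trans ((congrArg f h.symm).trans y.2))
  · intro i
    rw [Multiset.mem_sum]
    exact ⟨f i, Finset.mem_univ _, Multiset.mem_map.2 ⟨⟨i, rfl⟩, mem_full _, rfl⟩⟩

lemma inj_mem_wspan (u : I → J) {j : ℤ} {m : Multiset I} {z : Lam I Empty}
    (hz : z ∈ wspan j (m.map Sum.inl)) :
    (inj u z : Lam J Θ) ∈ wspan j ((m.map u).map Sum.inl) := by
  have h : (m.map fun i => ({Sum.inl (u i)} : Multiset (J ⊕ Θ))).sum = (m.map u).map Sum.inl := by
    clear hz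
    induction m using Multiset.induction_on with
    | empty => simp
    | cons a m ih => simp [ih]
  have := subst_mem_wspan (X := fun i => (leafO (u i) : OddLam J Θ)) (r := fun _ => 0)
    (μ := fun i => {Sum.inl (u i)}) (fun i => by
      simpa [wt] using! lamGen_mem_wspan (Θ := Θ) (Sum.inl (BinTree.leaf (u i)))) hz
  rw [h] at this
  simpa [inj] using this

/-- The linear combinations of products of `d + 1` trees in which each element of `I` occurs
exactly once as a leaf. -/
def nSub (d : ℤ) (I : Type) [Finite I] : Submodule ℚ (Lam I Empty) :=
  if 0 ≤ d then wspan (d + 1) ((full I).map Sum.inl) else ⊥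

lemma mem_wspan_of_mem_nSub {d : ℤ} [Finite I] {z : Lam I Empty} (hz : z ∈ nSub d I) :
    z ∈ wspan (d + 1) ((full I).map Sum.inl) := by
  unfold nSub at hz
  split_ifs at hz
  · exact hz
  · rw [Submodule.mem_bot] at hz
    rw [hz]; exact zero_mem _

lemma mapLeaf_mem_nSub {d : ℤ} [Finite I] [Finite J] (u : I ≃ J) {z : Lam I Empty}
    (hz : z ∈ nSub d I) : mapLeaf u z ∈ nSub d J := by
  unfold nSub at *
  split_ifs at hz ⊢
  · rw [← inj_empty, ← full_map u]
    exact inj_mem_wspan u hz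
  · rw [Submodule.mem_bot] at *
    rw [hz, map_zero]

/-- The species of products of trees. -/
def nSpecies : GrSpecies where
  obj d I _ := nSub d I
  map _ _ _ _ _ u := (mapLeaf u).toLinearMap.restrict (fun _ hz => mapLeaf_mem_nSub u hz)
  map_refl _ _ _ x := Subtype.ext (mapLeaf_id x.1)
  map_trans _ _ _ _ _ _ _ u v x := Subtype.ext (mapLeaf_mapLeaf u v x.1).symm

/-- The underlying element of the exterior algebra. -/
def nVal {d : ℤ} {I : Type} [Finite I] : nSpecies.obj d I →ₗ[ℚ] Lam I Empty := (nSub d I).subtype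

lemma nVal_injective {d : ℤ} [Finite I] :
    Function.Injective (nVal : nSpecies.obj d I →ₗ[ℚ] Lam I Empty) := Subtype.val_injective

lemma nVal_map {d : ℤ} [Finite I] [Finite J] (u : I ≃ J) (x : nSpecies.obj d I) :
    nVal (nSpecies.map d u x) = mapLeaf u (nVal x) := rfl

lemma nVal_mem {d : ℤ} [Finite I] (x : nSpecies.obj d I) : nVal x ∈ nSub d I := x.2

lemma nVal_mem_wspan {d : ℤ} [Finite I] (x : nSpecies.obj d I) :
    nVal x ∈ wspan (d + 1) ((full I).map Sum.inl) := mem_wspan_of_mem_nSub x.2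

lemma eq_zero_of_neg {d : ℤ} [Finite I] (hd : ¬ 0 ≤ d) (x : nSpecies.obj d I) : x = 0 := by
  have := nVal_mem x
  rw [nSub, if_neg hd, Submodule.mem_bot] at this
  exact nVal_injective this

lemma hasPar_nVal {d : ℤ} [Finite I] (x : nSpecies.obj d I) : HasPar (d + 1) (nVal x) :=
  wspan_parity (nVal_mem_wspan x)

/-! ### Parametrized composition -/

/-- A family of parameters of given parities. -/
def ParFam (d : K → ℤ) (θ : K → Lam I Θ) : Prop := ∀ k, HasPar (d k) (θ k) ∧ IsPar (θ k)

variable [Finite I] [Finite J] {f : I → K} {d : K → ℤ}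

open Classical in
/-- The odd elements `θ_k q_k`. -/
def arg (θ : K → Lam I Θ) (q : ∀ k, nSpecies.obj (d k) {i // f i = k}) (k : K) : OddLam I Θ :=
  if h : θ k * inj Subtype.val (nVal (q k)) ∈ oddPart (GenSp I Θ) then ⟨_, h⟩ else 0

/-- The parameter has parity `d k` and a product of `d k + 1` trees has parity `d k + 1`, so their
product is odd and the default value in `arg` does not occur. -/
lemma arg_val {θ : K → Lam I Θ} (hθ : ParFam d θ) (q : ∀ k, nSpecies.obj (d k) {i // f i = k})
    (k : K) : (arg θ q k).1 = θ k * inj Subtype.val (nVal (q k)) := by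
  have h : θ k * inj Subtype.val (nVal (q k)) ∈ oddPart (GenSp I Θ) := by
    refine ((hθ k).1.mul ((hasPar_nVal (q k)).map _ (subst_ι_mem _ _))).2 ⟨d k, by ring⟩
  rw [arg, dif_pos h]

/-- The parametrized composition as a multilinear map. -/
def substMulti [Finite K] {θ : K → Lam I Θ} (hθ : ParFam d θ) {e : ℤ} (p : nSpecies.obj e K) :
    MultilinearMap ℚ (fun k => nSpecies.obj (d k) {i // f i = k}) (Lam I Θ) where
  toFun q := subst (arg θ q) Empty.elim (nVal p)
  map_update_add' q k x y := by
    have hne : ∀ (z z' : nSpecies.obj (d k) {i // f i = k}), ∀ k' ≠ k,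
        arg θ (Function.update q k z) k' = arg θ (Function.update q k z') k' := by
      intro z z' k' h
      rw [arg, arg, Function.update_of_ne h, Function.update_of_ne h]
    refine subst_add (k := k) (hne _ _) (hne _ _) ?_ nodup_full (mem_full k) (nVal_mem_wspan p)
    apply Subtype.ext
    rw [Submodule.coe_add, arg_val hθ, arg_val hθ, arg_val hθ, ← mul_add, ← map_add, ← map_add]
    simp only [Function.update_self]
  map_update_smul' q k r x := by
    have hne : ∀ (z z' : nSpecies.obj (d k) {i // f i = k}), ∀ k' ≠ k,
        arg θ (Function.update q k z) k' = arg θ (Function.update q k z') k' := by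
      intro z z' k' h
      rw [arg, arg, Function.update_of_ne h, Function.update_of_ne h]
    -- A rational scalar is an even element annihilated by the bracket, so homogeneity is a case of
    -- pulling out an even constant.
    have := subst_const_mul (X := arg θ (Function.update q k x))
      (Z := arg θ (Function.update q k (r • x))) (k := k)
      (c := algebraMap ℚ (Lam I Θ) r) ?_ (algebraMap_mem_evenPart r)
      (hne _ _) ?_ nodup_full (mem_full k) (nVal_mem_wspan p)
    · rw [this, Algebra.smul_def]
    · rw [Algebra.algebraMap_eq_smul_one]
      exact isConst_one.smul r
    · rw [arg_val hθ, arg_val hθ, ← Algebra.smul_def, ← mul_smul_comm, ← map_smul, ← map_smul]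
      simp only [Function.update_self]

/-- The parametrized composition as a bilinear map. -/
def substLin [Finite K] (f : I → K) {θ : K → Lam I Θ} (hθ : ParFam d θ) (e : ℤ) :
    nSpecies.obj e K →ₗ[ℚ] (⨂[ℚ] k, nSpecies.obj (d k) {i // f i = k}) →ₗ[ℚ] Lam I Θ where
  toFun p := PiTensorProduct.lift (substMulti hθ p)
  map_add' p p' := by
    apply PiTensorProduct.ext
    ext q
    simp [substMulti]
  map_smul' r p := by
    apply PiTensorProduct.ext
    ext q
    simp [substMulti]

lemma substLin_tprod [Finite K] {θ : K → Lam I Θ} (hθ : ParFam d θ) {e : ℤ}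
    (p : nSpecies.obj e K) (q : ∀ k, nSpecies.obj (d k) {i // f i = k}) :
    substLin f hθ e p (PiTensorProduct.tprod ℚ q) = subst (arg θ q) Empty.elim (nVal p) := by
  simp [substLin, substMulti]

open Classical in
/-- The universal parameters: an odd parameter for each `k` with `d k` odd. -/
def stdPar (π : K → Θ) (d : K → ℤ) (k : K) : Lam I Θ := if Odd (d k) then par (π k) else 1

lemma parFam_stdPar (π : K → Θ) (d : K → ℤ) : ParFam d (stdPar (I := I) π d) := by
  intro k
  unfold stdPar
  split_ifs with h
  · exact ⟨⟨fun h' => absurd h (Int.not_odd_iff_even.2 h'), fun _ => lamGen_mem _⟩, isPar_par _⟩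
  · exact ⟨⟨fun _ => one_mem_evenPart, fun h' => absurd h' h⟩, isConst_one⟩

open Classical in
/-- The inputs of odd degree. -/
def oddList {n : ℕ} (d : Fin n → ℤ) : List (Fin n) :=
  (Finset.univ.sort (· ≤ · : Fin n → Fin n → Prop)).filter fun k => Odd (d k)

lemma oddList_nodup {n : ℕ} (d : Fin n → ℤ) : (oddList d).Nodup :=
  (Finset.sort_nodup _ _).filter _

lemma oprod_stdPar {n : ℕ} (d : Fin n → ℤ) :
    oprod (stdPar (I := I) (fun k => k) d) = ((oddList d).map par).prod := by
  classical
  exact oprod_ite _ _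

/-! ### Extraction of the composition from its parametrized form. -/

variable {D : ℤ}

/-- The composition of trees with values in the exterior algebra. -/
def nCompVal (x : CompIdx D I) : CompSummand nSpecies nSpecies x →ₗ[ℚ] Lam I Empty :=
  -- After substituting the odd elements `θ_k q_k`, the contraction removes the parameters in
  -- increasing order from the left. What remains involves no parameters, and `kill` only records
  -- this in the type.
  epsSign x.e x.d • (kill.toLinearMap ∘ₗ contrList (oddList x.d) ∘ₗ
    TensorProduct.lift (substLin x.f (parFam_stdPar (fun k => k) x.d) x.e))

lemma nCompVal_tmul (x : CompIdx D I) (p : nSpecies.obj x.e (Fin x.n))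
    (q : ∀ k, nSpecies.obj (x.d k) {i // x.f i = k}) :
    nCompVal x (p ⊗ₜ[ℚ] PiTensorProduct.tprod ℚ q) = epsSign x.e x.d • kill (contrList (oddList x.d)
      (subst (arg (stdPar (fun k => k) x.d) q) Empty.elim (nVal p))) := by
  rw [← substLin_tprod]
  rfl

/-- A count of factors and labels: each odd parameter and each element of `I` occurs exactly once,
and there are `D + 1` trees. The second alternative covers negative degrees, in which the species is
zero. -/
lemma subst_arg_stdPar_mem (x : CompIdx D I) (p : nSpecies.obj x.e (Fin x.n))
    (q : ∀ k, nSpecies.obj (x.d k) {i // x.f i = k}) :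
    (0 ≤ D ∧ subst (arg (stdPar (fun k => k) x.d) q) Empty.elim (nVal p) ∈
      wspan (D + 1 + (oddList x.d).length) ((((oddList x.d).map Sum.inr : List (I ⊕ Fin x.n)) :
        Multiset (I ⊕ Fin x.n)) + (full I).map Sum.inl)) ∨
      subst (arg (stdPar (fun k => k) x.d) q) Empty.elim (nVal p) = 0 := by
  classical
  by_cases he : 0 ≤ x.e
  swap
  · right; rw [eq_zero_of_neg he p, map_zero, map_zero]
  by_cases hd : ∃ k, ¬ 0 ≤ x.d k
  · right
    obtain ⟨k, hk⟩ := hd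
    exact (substMulti (parFam_stdPar (fun k => k) x.d) p).map_coord_zero k (eq_zero_of_neg hk _)
  · left
    push Not at hd
    refine ⟨?_, ?_⟩
    · rw [← x.deg]
      exact add_nonneg he (Finset.sum_nonneg fun k _ => hd k)
    · have h := subst_mem_wspan (X := arg (stdPar (fun k => k) x.d) q)
        (r := fun k => (if Odd (x.d k) then 1 else 0) + x.d k)
        (μ := fun k => (if Odd (x.d k) then {Sum.inr k} else 0) +
          ((full {i // x.f i = k}).map Subtype.val).map Sum.inl) (fun k => by
          rw [arg_val (parFam_stdPar _ _), add_assoc]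
          refine mul_mem_wspan ?_ (inj_mem_wspan _ (nVal_mem_wspan _))
          unfold stdPar
          split_ifs
          · simpa [wt] using! lamGen_mem_wspan (I := I) (Sum.inr k)
          · exact one_mem_wspan) (nVal_mem_wspan p)
      have hl : ∀ {A : Type} [AddCommMonoid A] (v : Fin x.n → A),
          ∑ k, (if Odd (x.d k) then v k else 0) = ((oddList x.d).map v).sum := by
        intro A _ v
        rw [← Finset.sort_toFinset (Finset.univ : Finset (Fin x.n)) (· ≤ ·),
          List.sum_toFinset _ (Finset.sort_nodup _ _)]
        unfold oddList
        induction Finset.univ.sort (· ≤ · : Fin x.n → Fin x.n → Prop) with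
        | nil => simp
        | cons k l ih => by_cases hk : Odd (x.d k) <;> simp [hk, ih]
      convert h using 2
      · rw [full_eq]
        change _ = ∑ k, ((if Odd (x.d k) then 1 else 0) + x.d k) + _
        rw [Finset.sum_add_distrib, hl (fun _ => (1 : ℤ))]
        have hdeg := x.deg
        simp
        linarith
      · rw [full_eq (I := Fin x.n)]
        change _ = ∑ k, ((if Odd (x.d k) then {Sum.inr k} else 0) +
          ((full {i // x.f i = k}).map Subtype.val).map Sum.inl)
        rw [Finset.sum_add_distrib, hl (fun k => ({Sum.inr k} : Multiset (I ⊕ Fin x.n))),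
          ← sum_full_fibers x.f]
        congr 1
        · induction oddList x.d with
          | nil => simp
          | cons k l ih =>
            simp only [List.map_cons, List.sum_cons, ← ih]
            rfl
        · exact map_sum (Multiset.mapAddMonoidHom Sum.inl) _ _

/-- The parametrized composition determines the composition. -/
lemma subst_arg_stdPar (x : CompIdx D I) (p : nSpecies.obj x.e (Fin x.n))
    (q : ∀ k, nSpecies.obj (x.d k) {i // x.f i = k}) :
    subst (arg (stdPar (fun k => k) x.d) q) Empty.elim (nVal p) = epsSign x.e x.d •
      (oprod (stdPar (fun k => k) x.d) *
        inj (fun i => i) (nCompVal x (p ⊗ₜ[ℚ] PiTensorProduct.tprod ℚ q))) := by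
  rw [nCompVal_tmul, oprod_stdPar]
  rcases subst_arg_stdPar_mem x p q with ⟨-, h⟩ | h
  · rw [Units.smul_def, Units.smul_def, map_zsmul, ← Units.smul_def, ← Units.smul_def,
      mul_smul_comm, smul_smul, Int.units_mul_self, one_smul,
      inj_kill (contrList_mem_wspan h)]
    apply eq_par_mul_contrList (oddList_nodup _)
    intro π hπ
    refine killOne_eq_zero h (Multiset.mem_add.2 (Or.inl ?_))
    exact Multiset.mem_coe.2 (List.mem_map_of_mem hπ)
  · rw [h]; simp

/-- The product of distinct parameters can be cancelled, so the parametrized identity for the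
universal parameters characterizes the composition. Equivariance and naturality are checked through
this criterion, without ever contracting. -/
lemma eq_nCompVal (x : CompIdx D I) (p : nSpecies.obj x.e (Fin x.n))
    (q : ∀ k, nSpecies.obj (x.d k) {i // x.f i = k}) {y : Lam I Empty}
    (h : subst (arg (stdPar (fun k => k) x.d) q) Empty.elim (nVal p) = epsSign x.e x.d •
      (oprod (stdPar (fun k => k) x.d) * inj (fun i => i) y)) :
    nCompVal x (p ⊗ₜ[ℚ] PiTensorProduct.tprod ℚ q) = y := by
  rw [subst_arg_stdPar, oprod_stdPar] at h
  exact par_prod_mul_cancel (oddList_nodup _) (smul_left_cancel _ h)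

lemma nCompVal_mem (x : CompIdx D I) (t : CompSummand nSpecies nSpecies x) :
    nCompVal x t ∈ nSub D I := by
  induction t using TensorProduct.induction_on with
  | zero => rw [map_zero]; exact zero_mem _
  | add s t hs ht => rw [map_add]; exact add_mem hs ht
  | tmul p t =>
  induction t using PiTensorProduct.induction_on with
  | add s t hs ht => rw [TensorProduct.tmul_add, map_add]; exact add_mem hs ht
  | smul_tprod r q =>
  rw [TensorProduct.tmul_smul, map_smul]
  refine Submodule.smul_mem _ _ ?_
  rw [nCompVal_tmul, Units.smul_def]
  refine zsmul_mem ?_ _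
  rcases subst_arg_stdPar_mem x p q with ⟨h0, h⟩ | h
  · rw [nSub, if_pos h0]
    exact kill_mem_wspan (contrList_mem_wspan h)
  · rw [h]; simp

/-- The parametrized composition for an arbitrary family of parameters. -/
lemma subst_arg (x : CompIdx D I) (p : nSpecies.obj x.e (Fin x.n))
    (q : ∀ k, nSpecies.obj (x.d k) {i // x.f i = k}) {θ : Fin x.n → Lam I Θ}
    (hθ : ParFam x.d θ) :
    subst (arg θ q) Empty.elim (nVal p) = epsSign x.e x.d • (oprod θ *
        inj (fun i => i) (nCompVal x (p ⊗ₜ[ℚ] PiTensorProduct.tprod ℚ q))) := by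
  classical
  -- The even parameters, replaced by `1` in the universal family, are restored one at a time; `S`
  -- is the set of those already restored.
  let θS : Finset (Fin x.n) → Fin x.n → Lam I Θ :=
    fun S k => if Odd (x.d k) ∨ k ∈ S then θ k else 1
  have hS : ∀ S, ParFam x.d (θS S) := by
    intro S k
    simp only [θS]
    split_ifs with h
    · exact hθ k
    · rw [not_or] at h
      exact ⟨⟨fun _ => one_mem_evenPart, fun h' => absurd h' h.1⟩, isConst_one⟩
  have key : ∀ S, subst (arg (θS S) q) Empty.elim (nVal p) = epsSign x.e x.d • (oprod (θS S) *
        inj (fun i => i) (nCompVal x (p ⊗ₜ[ℚ] PiTensorProduct.tprod ℚ q))) := by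
    intro S
    induction S using Finset.induction_on with
    | empty =>
      -- With only the odd parameters present, the identity is a specialization of the universal
      -- one. The value `0` is assigned to variables that do not occur in `stdPar`.
      let ζ : Fin x.n → OddLam I Θ := fun k => if h : Odd (x.d k) then ⟨θ k, (hθ k).1.2 h⟩ else 0
      have hζ : ∀ k, IsPar (ζ k).1 := by
        intro k
        simp only [ζ]
        split_ifs
        · exact (hθ k).2
        · exact fun y => map_zero _
      have hstd : ∀ k, subst leafO ζ (stdPar (fun k => k) x.d k) = θS ∅ k := by
        intro k
        simp only [stdPar, θS]
        split_ifs with h1 h2 h2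
        · rw [subst_par]; simp [ζ, h1]
        · simp [h1] at h2
        · simp [h1] at h2
        · exact map_one _
      have h := congrArg (subst leafO ζ) (subst_arg_stdPar x p q)
      rw [subst_subst hζ, Units.smul_def, map_zsmul, ← Units.smul_def, map_mul, subst_inj hζ] at h
      have h2 := map_oprod (subst leafO ζ : Lam I (Fin x.n) →ₐ[ℚ] Lam I Θ).toMonoidHom
        (stdPar (I := I) (fun k => k) x.d)
      change subst leafO ζ _ = oprod fun k => subst leafO ζ _ at h2
      rw [h2, funext hstd] at h
      refine Eq.trans ?_ h
      congr 1
      congr 1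
      · funext k
        apply Subtype.ext
        rw [arg_val (hS _)]
        change _ = subst leafO ζ (arg _ q k).1
        rw [arg_val (parFam_stdPar _ _), map_mul, hstd, subst_inj hζ]
        rfl
      · funext e; exact e.elim
    | insert k₀ S hk ih =>
      by_cases hodd : Odd (x.d k₀)
      · have : θS (insert k₀ S) = θS S := by
          funext k
          simp only [θS, Finset.mem_insert]
          by_cases h : k = k₀
          · subst h; simp [hodd]
          · simp [h]
        rw [this, ih]
      · have heven := (hθ k₀).1.1 (Int.not_odd_iff_even.1 hodd)
        have h0 : θS S k₀ = 1 := if_neg (by simp [hodd, hk])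
        have h1 : θS (insert k₀ S) k₀ = θ k₀ := if_pos (by simp)
        have hne : ∀ k ≠ k₀, θS (insert k₀ S) k = θS S k := by
          intro k h
          simp [θS, h]
        rw [oprod_update_mul (θS S) (θS (insert k₀ S)) k₀ (θ k₀) (even_comm heven) hne
          (by rw [h0, h1, mul_one]), mul_assoc, ← mul_smul_comm, ← ih]
        refine subst_const_mul (hθ k₀).2 heven (k := k₀) (fun k h => ?_) ?_ nodup_full (mem_full k₀)
          (nVal_mem_wspan p)
        · rw [arg, arg, hne k h]
        · rw [arg_val (hS _), arg_val (hS _), h0, h1, one_mul]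
  have : θS Finset.univ = θ := by
    funext k
    simp [θS]
  rw [← this]
  exact key _

/-- The composition of trees on a summand. -/
def nComp (x : CompIdx D I) : CompSummand nSpecies nSpecies x →ₗ[ℚ] nSpecies.obj D I :=
  (nCompVal x).codRestrict (nSub D I) (nCompVal_mem x)

lemma nVal_nComp (x : CompIdx D I) (t : CompSummand nSpecies nSpecies x) :
    nVal (nComp x t) = nCompVal x t := rfl

/-- The composition of products of trees. -/
def nγ : Hom (Comp nSpecies nSpecies) nSpecies :=
  Comp.lift (fun _ _ _ x => nComp x)
    (by
      intro D I _ x a b hab p q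
      apply nVal_injective
      rw [Units.smul_def, map_zsmul, ← Units.smul_def, nVal_nComp, nVal_nComp]
      apply eq_nCompVal
      set s := Equiv.swap a b with hs
      set std' : Fin x.n → Lam I (Fin x.n) := stdPar (fun k => k) (x.perm s).d with hstd
      have hpar : ParFam (x.perm s).d std' := parFam_stdPar _ _
      -- The parameters of the permuted data, read through `s`, are admissible for `x`. Both
      -- compositions thus come from the same substitution, and their ordered products of parameters
      -- differ by one exchange of neighbours, which is the Koszul sign.
      have hθ : ParFam x.d (fun k => std' (s k)) := by
        intro k
        have := hpar (s k)
        simpa using! this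
      have h1 := subst_arg x p q hθ
      rw [nVal_map, subst_mapLeaf (fun e => e.elim)]
      have h2 : (fun k => arg std' (fun k => nSpecies.map _ (x.permFib s k) (q (s.symm k))) (s k))
          = arg (fun k => std' (s k)) q := by
        funext k
        apply Subtype.ext
        rw [arg_val hθ]
        refine (arg_val hpar _ _).trans ?_
        change std' (s k) * inj Subtype.val (mapLeaf (x.permFib s (s k))
          (nVal (q (s.symm (s k))))) = _
        have hq : ∀ k k', k' = k → (inj Subtype.val (nVal (q k')) : Lam I (Fin x.n))
            = inj Subtype.val (nVal (q k)) := by rintro k _ rfl; rfl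
        rw [inj_mapLeaf]
        refine congrArg (std' (s k) * ·) ?_
        exact hq k _ (s.symm_apply_apply k)
      refine (congrArg (fun X => subst X Empty.elim (nVal p)) h2).trans (h1.trans ?_)
      have h3 : oprod (fun k => std' (s k)) = (x.d a * x.d b).negOnePow • oprod std' := by
        rw [oprod_fin, oprod_fin]
        apply list_ofFn_swap_prod _ _ a b hab
        have := (hpar a).1.comm (hpar b).1
        rw [this]
        congr 2
        change x.d (Equiv.swap a b a) * x.d (Equiv.swap a b b) = _
        rw [Equiv.swap_apply_left, Equiv.swap_apply_right, mul_comm]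
      have h4 : epsSign x.e (x.perm s).d = epsSign x.e x.d := by
        unfold epsSign
        rw [show esymm₂ (x.perm s).d = esymm₂ x.d from esymm₂_comp s.symm x.d,
          show ∑ k, (x.perm s).d k = ∑ k, x.d k from Equiv.sum_comp s.symm x.d]
      rw [h3]
      change _ = epsSign x.e (x.perm s).d • _
      rw [h4, Units.smul_def (x.d a * x.d b).negOnePow (nCompVal _ _), map_zsmul, ← Units.smul_def,
        smul_mul_assoc, mul_smul_comm])
    (by
      intro D I J _ _ u x p q
      apply nVal_injective
      rw [nVal_map, nVal_nComp, nVal_nComp]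
      apply eq_nCompVal
      have hstd : ∀ k, mapLeaf u (stdPar (I := I) (fun k => k) x.d k) = stdPar (fun k => k) x.d k := by
        intro k
        unfold stdPar
        split_ifs
        · exact mapLeaf_par _ _
        · exact map_one _
      have h := congrArg (mapLeaf u) (subst_arg_stdPar x p q)
      have h2 := map_oprod (mapLeaf u : Lam I (Fin x.n) →ₐ[ℚ] Lam J (Fin x.n)).toMonoidHom
        (stdPar (I := I) (fun k => k) x.d)
      change mapLeaf u _ = oprod fun k => mapLeaf u _ at h2
      rw [mapLeaf, subst_subst isPar_parO, ← mapLeaf, Units.smul_def, map_zsmul, ← Units.smul_def, map_mul,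
        mapLeaf_inj, h2, funext hstd] at h
      rw [← inj_empty, inj_inj]
      refine Eq.trans ?_ h
      congr 2
      · funext k
        apply Subtype.ext
        refine (arg_val (parFam_stdPar _ _) _ _).trans ?_
        change _ = mapLeaf u (arg _ q k).1
        rw [arg_val (parFam_stdPar _ _), map_mul, hstd, mapLeaf_inj, nVal_map, inj_mapLeaf]
        rfl
      · funext e; exact e.elim)

end

end BOperad

namespace BOperad

noncomputable section

variable {P Q R X Y Z : GrSpecies} {I J K K' L : Type}

/-! ### Transport of structure and reindexing in composite products. -/

lemma GrSpecies.map_map {d : ℤ} [Finite I] [Finite J] [Finite K] (u : I ≃ J) (v : J ≃ K)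
    (w : I ≃ K) (h : ∀ i, v (u i) = w i) (x : P.obj d I) :
    P.map d v (P.map d u x) = P.map d w x := by
  rw [← P.map_trans]
  congr 1
  exact congrArg _ (Equiv.ext h)

lemma GrSpecies.map_self {d : ℤ} [Finite I] (u : I ≃ I) (h : ∀ i, u i = i) (x : P.obj d I) :
    P.map d u x = x := by
  rw [show u = Equiv.refl I from Equiv.ext h]
  exact P.map_refl _ _ _

lemma Hom.id_app {d : ℤ} [Finite I] (x : P.obj d I) : (Hom.id P).app d I x = x := rfl

/-! ### Numberings of the inputs -/

lemma CompObj.inc_congr [Finite I] {D : ℤ} {n : ℕ} {f f' : I → Fin n} (hf : f = f') {c : ℤ}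
    {d : Fin n → ℤ} (h : c + ∑ k, d k = D) {p p' : P.obj c (Fin n)} (hp : p = p')
    (q : ∀ k, Q.obj (d k) {i // f i = k}) (q' : ∀ k, Q.obj (d k) {i // f' i = k})
    (hq : ∀ k, Q.map (d k) (Equiv.subtypeEquivRight fun i => by rw [hf]) (q k) = q' k) :
    CompObj.inc P Q ⟨n, f, c, d, h⟩ (p ⊗ₜ[ℚ] PiTensorProduct.tprod ℚ q) =
      CompObj.inc P Q ⟨n, f', c, d, h⟩ (p' ⊗ₜ[ℚ] PiTensorProduct.tprod ℚ q') := by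
  subst hf hp
  congr 3
  funext k
  rw [← hq]
  exact (Q.map_refl _ _ _).symm

/-- The element `(p; (q_k)_k)`, for a numbering `s` of the set of inputs. -/
def Comp.mkE [Finite I] [Fintype K] {n : ℕ} (s : Fin n ≃ K) (f : I → K) {e D : ℤ} {d : K → ℤ}
    (h : e + ∑ k, d k = D) (p : P.obj e K) (q : ∀ k, Q.obj (d k) {i // f i = k}) :
    (Comp P Q).obj D I :=
  CompObj.inc P Q
    ⟨n, s.symm ∘ f, e, d ∘ s, by rw [← h]; congr 1; exact Equiv.sum_comp s d⟩
    (P.map e s.symm p ⊗ₜ[ℚ] PiTensorProduct.tprod ℚ (fun k =>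
      Q.map (d (s k)) (Equiv.subtypeEquivRight (fun i => by simp [Equiv.symm_apply_eq])) (q (s k))))

lemma Comp.mk_eq_mkE [Finite I] [Fintype K] [LinearOrder K] (f : I → K) {e D : ℤ} {d : K → ℤ}
    (h : e + ∑ k, d k = D) (p : P.obj e K) (q : ∀ k, Q.obj (d k) {i // f i = k}) :
    Comp.mk f h p q = Comp.mkE (Fintype.orderIsoFinOfCardEq K rfl).toEquiv f h p q := rfl

lemma Comp.mkE_swap [Finite I] [Fintype K] {n : ℕ} (s : Fin n ≃ K) (a b : Fin n)
    (hab : a.val + 1 = b.val) (f : I → K) {e D : ℤ} {d : K → ℤ} (h : e + ∑ k, d k = D)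
    (p : P.obj e K) (q : ∀ k, Q.obj (d k) {i // f i = k}) :
    Comp.mkE ((Equiv.swap a b).trans s) f h p q =
      (d (s a) * d (s b)).negOnePow • Comp.mkE s f h p q := by
  refine Eq.trans ?_ (CompObj.inc_swap (P := P) (Q := Q)
    ⟨n, s.symm ∘ f, e, d ∘ s, by rw [← h]; congr 1; exact Equiv.sum_comp s d⟩ a b hab
    (P.map e s.symm p) (fun k => Q.map (d (s k))
      (Equiv.subtypeEquivRight (fun i => by simp [Equiv.symm_apply_eq])) (q (s k))))
  refine CompObj.inc_congr rfl _ ?_ _ _ (fun k => ?_)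
  · exact (P.map_map _ _ _ (fun _ => rfl) _).symm
  · refine (Q.map_map _ _ (Equiv.subtypeEquivRight fun i => ?_) (fun _ => rfl) _).trans
      (Q.map_map _ _ _ (fun _ => rfl) _).symm
    change f i = s (Equiv.swap a b k) ↔ Equiv.swap a b (s.symm (f i)) = k
    rw [← Equiv.symm_apply_eq s, ← Equiv.eq_symm_apply (Equiv.swap a b), Equiv.symm_swap]

/-- Adjacent transpositions generate the symmetric group, so every renumbering acts by a sign. The
sign depends only on the numbering and the degrees and is chosen before `P`, `Q`, `f` and the
elements; the same one can therefore be used on both sides of an identity. -/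
lemma Comp.mkE_trans [Fintype K] {n : ℕ} (u : Equiv.Perm (Fin n)) :
    ∀ (s : Fin n ≃ K) (d : K → ℤ), ∃ ε : ℤˣ, ((∀ k, Even (d k)) → ε = 1) ∧
    ∀ {P Q : GrSpecies} {I : Type} [Finite I] (f : I → K) {e D : ℤ} (h : e + ∑ k, d k = D)
      (p : P.obj e K) (q : ∀ k, Q.obj (d k) {i // f i = k}),
      Comp.mkE (u.trans s) f h p q = ε • Comp.mkE s f h p q := by
  rcases n with _ | n
  · intro s d
    refine ⟨1, fun _ => rfl, fun f _ _ h p q => ?_⟩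
    rw [one_smul, Subsingleton.elim u 1]; rfl
  have hu : u ∈ Submonoid.closure
      (Set.range fun i : Fin n ↦ Equiv.swap i.castSucc i.succ) := by
    rw [Equiv.Perm.mclosure_swap_castSucc_succ]; trivial
  induction hu using Submonoid.closure_induction with
  | mem u hu =>
    obtain ⟨i, rfl⟩ := hu
    intro s d
    refine ⟨_, fun hd => ?_, fun f _ _ h p q => Comp.mkE_swap s _ _ (by simp) f h p q⟩
    exact Int.negOnePow_even _ ((hd _).mul_right _)
  | one =>
    intro s d
    refine ⟨1, fun _ => rfl, fun f _ _ h p q => ?_⟩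
    rw [one_smul]; rfl
  | mul u v _ _ hu hv =>
    intro s d
    obtain ⟨ε, hε, h1⟩ := hu s d
    obtain ⟨ε', hε', h2⟩ := hv (Equiv.trans u s) d
    refine ⟨ε' * ε, fun hd => by rw [hε hd, hε' hd, one_mul], fun f _ _ h p q => ?_⟩
    rw [mul_smul, ← h1, ← h2]
    rfl

lemma Comp.mkE_map [Finite I] [Fintype K] [Fintype K'] {n : ℕ} (s : Fin n ≃ K) (σ : K ≃ K')
    {f : I → K} {f' : I → K'} (hf : ∀ i, f' i = σ (f i)) {e D : ℤ} {d' : K' → ℤ}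
    (h : e + ∑ k, d' (σ k) = D) (h' : e + ∑ k, d' k = D)
    (p : P.obj e K) (q : ∀ k, Q.obj (d' (σ k)) {i // f i = k})
    (q' : ∀ k, Q.obj (d' k) {i // f' i = k})
    (hq : ∀ k, q' (σ k) = Q.map _ (Equiv.subtypeEquivRight fun i => by simp [hf]) (q k)) :
    Comp.mkE (s.trans σ) f' h' (P.map e σ p) q' = Comp.mkE s f h p q := by
  unfold Comp.mkE
  refine CompObj.inc_congr ?_ _ ?_ _ _ (fun k => ?_)
  · funext i; simp [hf]
  · exact P.map_map _ _ _ (fun _ => by simp) _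
  · change Q.map _ _ (Q.map _ _ (q' (σ (s k)))) = _
    rw [hq]
    refine (congrArg _ (Q.map_map _ _ (Equiv.subtypeEquivRight fun i => ?_) (fun _ => rfl) _)).trans ?_
    · simp [hf, Equiv.symm_apply_eq]
    · exact Q.map_map _ _ _ (fun _ => rfl) _

/-- Change of the set of inputs. -/
lemma Comp.mk_relabel [Fintype K] [Fintype K'] [LinearOrder K] [LinearOrder K'] (σ : K ≃ K')
    (d' : K' → ℤ) : ∃ ε : ℤˣ, (StrictMono σ → ε = 1) ∧ ((∀ k, Even (d' k)) → ε = 1) ∧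
    ∀ {P Q : GrSpecies} {I : Type} [Finite I] {f : I → K} {f' : I → K'} (hf : ∀ i, f' i = σ (f i))
      {e D : ℤ} (h : e + ∑ k, d' (σ k) = D) (h' : e + ∑ k, d' k = D)
      (p : P.obj e K) (q : ∀ k, Q.obj (d' (σ k)) {i // f i = k})
      (q' : ∀ k, Q.obj (d' k) {i // f' i = k})
      (_ : ∀ k, q' (σ k) = Q.map _ (Equiv.subtypeEquivRight fun i => by simp [hf]) (q k)),
      Comp.mk f' h' (P.map e σ p) q' = ε • Comp.mk f h p q := by
  -- The number of inputs is a variable here so that the equality of the two cardinalities can be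
  -- substituted away.
  have key : ∀ n (_ : n = Fintype.card K) (o' : Fin n ≃o K'),
      ∃ ε : ℤˣ, (StrictMono σ → ε = 1) ∧ ((∀ k, Even (d' k)) → ε = 1) ∧
    ∀ {P Q : GrSpecies} {I : Type} [Finite I] {f : I → K} {f' : I → K'} (hf : ∀ i, f' i = σ (f i))
      {e D : ℤ} (h : e + ∑ k, d' (σ k) = D) (h' : e + ∑ k, d' k = D)
      (p : P.obj e K) (q : ∀ k, Q.obj (d' (σ k)) {i // f i = k})
      (q' : ∀ k, Q.obj (d' k) {i // f' i = k})
      (_ : ∀ k, q' (σ k) = Q.map _ (Equiv.subtypeEquivRight fun i => by simp [hf]) (q k)),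
      Comp.mkE o'.toEquiv f' h' (P.map e σ p) q' = ε • Comp.mk f h p q := by
    rintro _ rfl o'
    set o : Fin (Fintype.card K) ≃o K := Fintype.orderIsoFinOfCardEq K rfl
    by_cases hσ : StrictMono σ
    · refine ⟨1, fun _ => rfl, fun _ => rfl, fun hf _ _ h h' p q q' hq => ?_⟩
      have ho : o' = o.trans (StrictMono.orderIsoOfSurjective σ hσ σ.surjective) :=
        Subsingleton.elim _ _
      have ho' : o'.toEquiv = o.toEquiv.trans σ := by
        rw [ho]; ext; rfl
      rw [one_smul, ho', Comp.mkE_map o.toEquiv σ hf h h' p q q' hq]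
      rfl
    · obtain ⟨ε, hε, H⟩ := Comp.mkE_trans ((o'.toEquiv.trans σ.symm).trans o.toEquiv.symm)
        (o.toEquiv.trans σ) d'
      refine ⟨ε, fun h => absurd h hσ, hε, fun hf _ _ h h' p q q' hq => ?_⟩
      rw [Comp.mk_eq_mkE, ← Comp.mkE_map o.toEquiv σ hf h h' p q q' hq, ← H]
      congr 1
      ext; simp
  obtain ⟨ε, h1, h2, h3⟩ := key (Fintype.card K') (Fintype.card_congr σ).symm
    (Fintype.orderIsoFinOfCardEq K' rfl)
  exact ⟨ε, h1, h2, h3⟩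

lemma Comp.mk_strictMono [Finite I] [Fintype K] [Fintype K'] [LinearOrder K] [LinearOrder K']
    (σ : K ≃ K') (hσ : StrictMono σ) {d' : K' → ℤ} {f : I → K} {f' : I → K'}
    (hf : ∀ i, f' i = σ (f i)) {e D : ℤ} (h : e + ∑ k, d' (σ k) = D) (h' : e + ∑ k, d' k = D)
    (p : P.obj e K) (q : ∀ k, Q.obj (d' (σ k)) {i // f i = k})
    (q' : ∀ k, Q.obj (d' k) {i // f' i = k})
    (hq : ∀ k, q' (σ k) = Q.map _ (Equiv.subtypeEquivRight fun i => by simp [hf]) (q k)) :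
    Comp.mk f' h' (P.map e σ p) q' = Comp.mk f h p q := by
  obtain ⟨ε, h1, -, H⟩ := Comp.mk_relabel σ d'
  rw [H hf h h' p q q' hq, h1 hσ, one_smul]

lemma CompObj.inc_eq_mk [Finite I] {D : ℤ} (x : CompIdx D I) (p : P.obj x.e (Fin x.n))
    (q : ∀ k, Q.obj (x.d k) {i // x.f i = k}) :
    CompObj.inc P Q x (p ⊗ₜ[ℚ] PiTensorProduct.tprod ℚ q) = Comp.mk x.f x.deg p q := by
  have key : ∀ n (_ : n = x.n) (o : Fin n ≃o Fin x.n),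
      Comp.mkE o.toEquiv x.f x.deg p q =
        CompObj.inc P Q x (p ⊗ₜ[ℚ] PiTensorProduct.tprod ℚ q) := by
    rintro _ rfl o
    -- A finite linear order has no order automorphism other than the identity.
    have : o = OrderIso.refl _ := Subsingleton.elim _ _
    subst this
    unfold Comp.mkE
    refine CompObj.inc_congr rfl _ (P.map_refl _ _ _) _ _ (fun k => ?_)
    exact (Q.map_map _ _ (Equiv.refl _) (fun _ => rfl) _).trans (Q.map_refl _ _ _)
  exact (key _ (Fintype.card_fin _) _).symm

lemma Comp.map_mk [Finite I] [Finite J] [Fintype K] [LinearOrder K] (u : I ≃ J) (f : I → K)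
    (f' : J → K) (hf : ∀ i, f' (u i) = f i)
    {e D : ℤ} {d : K → ℤ} (h : e + ∑ k, d k = D) (p : P.obj e K)
    (q : ∀ k, Q.obj (d k) {i // f i = k}) :
    (Comp P Q).map D u (Comp.mk f h p q) =
      Comp.mk f' h p (fun k => Q.map (d k) (u.subtypeEquiv fun i => by rw [hf]) (q k)) := by
  refine (compMap_inc P Q u _ _ _).trans ?_
  refine CompObj.inc_congr ?_ _ rfl _ _ (fun k => ?_)
  · funext j
    simp [← hf]
  · refine (congrArg _ (Q.map_map _ _ (u.subtypeEquiv fun i => ?_) (fun _ => rfl) _)).trans ?_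
    · simp [OrderIso.symm_apply_eq]
    · refine (Q.map_map _ _ (u.subtypeEquiv fun i => ?_) (fun _ => rfl) _).trans
        (Q.map_map _ _ _ (fun _ => rfl) _).symm
      simp [← hf, OrderIso.symm_apply_eq]

/-! ### Functoriality of the composite product -/

/-- Composition of morphisms. -/
def Hom.comp (b : Hom Y Z) (a : Hom X Y) : Hom X Z where
  app d I _ := b.app d I ∘ₗ a.app d I
  naturality d I J _ _ u x := by
    rw [LinearMap.comp_apply, a.naturality, b.naturality]; rfl

lemma Comp.lift_app_inc (F : ∀ (D : ℤ) (I : Type) [Finite I] (x : CompIdx D I),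
    CompSummand P Q x →ₗ[ℚ] X.obj D I) (hF) (hnat) {D : ℤ} [Finite I] (x : CompIdx D I)
    (t : CompSummand P Q x) :
    (Comp.lift F hF hnat).app D I (CompObj.inc P Q x t) = F D I x t :=
  CompObj.lift_inc (F D I) (hF D I) x t

/-- Functoriality of the composite product on a summand. -/
def mapSummand (a : Hom P X) (b : Hom Q Y) [Finite I] {D : ℤ} (x : CompIdx D I) :
    CompSummand P Q x →ₗ[ℚ] CompObj X Y D I :=
  CompObj.inc X Y ⟨x.n, x.f, x.e, x.d, x.deg⟩ ∘ₗ TensorProduct.map (a.app _ _)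
      (PiTensorProduct.map fun k => b.app (x.d k) {i // x.f i = k})

lemma mapSummand_tmul (a : Hom P X) (b : Hom Q Y) [Finite I] {D : ℤ} (x : CompIdx D I)
    (p : P.obj x.e (Fin x.n)) (q : ∀ k, Q.obj (x.d k) {i // x.f i = k}) :
    mapSummand a b x (p ⊗ₜ[ℚ] PiTensorProduct.tprod ℚ q) =
      CompObj.inc X Y ⟨x.n, x.f, x.e, x.d, x.deg⟩
        (a.app _ _ p ⊗ₜ[ℚ] PiTensorProduct.tprod ℚ fun k => b.app _ _ (q k)) := by
  rw [mapSummand, LinearMap.comp_apply, TensorProduct.map_tmul, PiTensorProduct.map_tprod]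

/-- Functoriality of the composite product. -/
def Comp.map (a : Hom P X) (b : Hom Q Y) : Hom (Comp P Q) (Comp X Y) :=
  Comp.lift (fun _ _ _ x => mapSummand a b x)
    (by
      intro D I _ x s t hst p q
      refine (mapSummand_tmul a b (x.perm (Equiv.swap s t)) _ _).trans (Eq.trans ?_
        ((CompObj.inc_swap x s t hst (a.app _ _ p) fun k => b.app _ _ (q k)).trans
        (congrArg _ (mapSummand_tmul a b x p q).symm)))
      refine CompObj.inc_congr rfl _ (a.naturality _ _ _) _ _ (fun k => ?_)
      exact (Y.map_self _ (fun _ => rfl) _).trans (b.naturality _ _ _))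
    (by
      intro D I J _ _ u x p q
      refine (mapSummand_tmul a b (x.map u) _ _).trans (Eq.trans ?_
        ((compMap_inc X Y u x (a.app _ _ p) fun k => b.app _ _ (q k)).symm.trans
        (congrArg _ (mapSummand_tmul a b x p q).symm)))
      refine CompObj.inc_congr rfl _ rfl _ _ (fun k => ?_)
      exact (Y.map_self _ (fun _ => rfl) _).trans (b.naturality _ _ _))

lemma Comp.map_app_mk (a : Hom P X) (b : Hom Q Y) [Finite I] [Fintype K] [LinearOrder K]
    (f : I → K) {e D : ℤ} {d : K → ℤ} (h : e + ∑ k, d k = D) (p : P.obj e K)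
    (q : ∀ k, Q.obj (d k) {i // f i = k}) :
    (Comp.map a b).app D I (Comp.mk f h p q) =
      Comp.mk f h (a.app e K p) (fun k => b.app (d k) _ (q k)) := by
  refine (Comp.lift_app_inc _ _ _ _ _).trans ((mapSummand_tmul _ _ _ _ _).trans ?_)
  refine CompObj.inc_congr rfl _ (a.naturality _ _ _) _ _ (fun k => ?_)
  exact (Y.map_self _ (fun _ => rfl) _).trans (b.naturality _ _ _)

lemma Hom.ext_mk {F G : Hom (Comp P Q) Z} (H : ∀ {I : Type} [Finite I] {n : ℕ} (f : I → Fin n)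
    {e D : ℤ} {d : Fin n → ℤ} (h : e + ∑ k, d k = D) (p : P.obj e (Fin n))
    (q : ∀ k, Q.obj (d k) {i // f i = k}),
    F.app D I (Comp.mk f h p q) = G.app D I (Comp.mk f h p q)) : F = G := by
  ext D I _ x
  refine LinearMap.congr_fun (CompObj.hom_ext fun x p q => ?_) x
  rw [CompObj.inc_eq_mk]
  exact H _ _ _ _

/-! ### Multilinearity -/

/-- The element `(p; (q_k)_k)` depends linearly on `p`. -/
def Comp.mkL [Finite I] [Fintype K] [LinearOrder K] (f : I → K)
    {e D : ℤ} {d : K → ℤ} (h : e + ∑ k, d k = D) (q : ∀ k, Q.obj (d k) {i // f i = k}) :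
    P.obj e K →ₗ[ℚ] (Comp P Q).obj D I where
  toFun p := Comp.mk f h p q
  map_add' p p' := by
    simp only [Comp.mk, map_add, TensorProduct.add_tmul]
    rfl
  map_smul' r p := by
    simp only [Comp.mk, map_smul, ← TensorProduct.smul_tmul', RingHom.id_apply]
    rfl

lemma Comp.mkL_apply [Finite I] [Fintype K] [LinearOrder K] (f : I → K)
    {e D : ℤ} {d : K → ℤ} (h : e + ∑ k, d k = D) (q : ∀ k, Q.obj (d k) {i // f i = k})
    (p : P.obj e K) : Comp.mkL f h q p = Comp.mk f h p q := rfl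

/-- The element `(p; (q_k)_k)` depends linearly on the tensor product of the `q_k`. -/
def Comp.mkT [Finite I] [Fintype K] [LinearOrder K] (f : I → K)
    {e D : ℤ} {d : K → ℤ} (h : e + ∑ k, d k = D) (p : P.obj e K) :
    (⨂[ℚ] k, Q.obj (d k) {i // f i = k}) →ₗ[ℚ] CompObj P Q D I :=
  let o : Fin (Fintype.card K) ≃o K := Fintype.orderIsoFinOfCardEq K rfl
  CompObj.inc P Q
      ⟨Fintype.card K, o.symm ∘ f, e, d ∘ o, by rw [← h]; congr 1; exact Equiv.sum_comp o.toEquiv d⟩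
      ∘ₗ TensorProduct.mk ℚ _ _ (P.map e o.symm.toEquiv p) ∘ₗ
      PiTensorProduct.map (fun k => Q.map (d (o k))
        (Equiv.subtypeEquivRight (fun i => by simp [OrderIso.symm_apply_eq]))) ∘ₗ
      (PiTensorProduct.reindex ℚ (fun k => Q.obj (d k) {i // f i = k}) o.symm.toEquiv).toLinearMap

lemma Comp.mkT_tprod [Finite I] [Fintype K] [LinearOrder K] (f : I → K)
    {e D : ℤ} {d : K → ℤ} (h : e + ∑ k, d k = D) (p : P.obj e K)
    (q : ∀ k, Q.obj (d k) {i // f i = k}) :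
    Comp.mkT f h p (PiTensorProduct.tprod ℚ q) = Comp.mk f h p q := by
  let o : Fin (Fintype.card K) ≃o K := Fintype.orderIsoFinOfCardEq K rfl
  have h1 := PiTensorProduct.reindex_tprod (R := ℚ) (s := fun k => Q.obj (d k) {i // f i = k})
    o.symm.toEquiv q
  have h2 := PiTensorProduct.map_tprod (R := ℚ) (fun k => Q.map (d (o k))
        (Equiv.subtypeEquivRight (fun i => by simp [OrderIso.symm_apply_eq]) :
          {i // f i = o k} ≃ {i // o.symm (f i) = k})) (fun k => q (o k))
  exact congrArg (fun t => CompObj.inc P Q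
      ⟨Fintype.card K, o.symm ∘ f, e, d ∘ o,
        (congrArg (e + ·) (Equiv.sum_comp o.toEquiv d)).trans h⟩
      (P.map e o.symm.toEquiv p ⊗ₜ[ℚ] t)) ((congrArg _ h1).trans h2)

/-- The element `(p; (q_k)_k)` depends multilinearly on the `q_k`. -/
def Comp.mkM [Finite I] [Fintype K] [LinearOrder K] (f : I → K)
    {e D : ℤ} {d : K → ℤ} (h : e + ∑ k, d k = D) (p : P.obj e K) :
    MultilinearMap ℚ (fun k => Q.obj (d k) {i // f i = k}) ((Comp P Q).obj D I) :=
  (Comp.mkT f h p).compMultilinearMap (PiTensorProduct.tprod ℚ)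

lemma Comp.mkM_apply [Finite I] [Fintype K] [LinearOrder K] (f : I → K)
    {e D : ℤ} {d : K → ℤ} (h : e + ∑ k, d k = D) (p : P.obj e K)
    (q : ∀ k, Q.obj (d k) {i // f i = k}) : Comp.mkM f h p q = Comp.mk f h p q :=
  Comp.mkT_tprod f h p q

end

end BOperad

namespace BOperad

noncomputable section

variable {P Q R X Y Z N : GrSpecies} {I J K K' L : Type}

/-! ### Generators of iterated composite products -/

lemma exists_monotone_perm [Fintype K] [LinearOrder K] [LinearOrder L] (g : K → L) :
    ∃ σ : Equiv.Perm K, Monotone fun k => g (σ k) := by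
  let o : Fin (Fintype.card K) ≃o K := Fintype.orderIsoFinOfCardEq K rfl
  refine ⟨(o.symm.toEquiv.trans (Tuple.sort (g ∘ o))).trans o.toEquiv, ?_⟩
  exact (Tuple.monotone_sort (g ∘ o)).comp o.symm.monotone

/-- Reordering of the inputs of the middle level. -/
lemma Comp.mk_mk_perm [Finite I] [Fintype K] [LinearOrder K] [Fintype L] [LinearOrder L]
    (σ : Equiv.Perm K) (f : I → K) (g : K → L) {c s D : ℤ} {a : L → ℤ} {b : K → ℤ}
    (h₁ : c + ∑ l, a l = s) (h₂ : s + ∑ k, b k = D) (h₂' : s + ∑ k, b (σ k) = D)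
    (p : P.obj c L) (q : ∀ l, Q.obj (a l) {k // g k = l}) (r : ∀ k, R.obj (b k) {i // f i = k}) :
    ∃ ε : ℤˣ, Comp.mk f h₂ (Comp.mk g h₁ p q) r =
      ε • Comp.mk (fun i => σ.symm (f i)) h₂' (Comp.mk (fun k => g (σ k)) h₁ p
        (fun l => Q.map (a l) (σ.symm.subtypeEquiv fun i => by simp) (q l)))
        (fun k => R.map _ (Equiv.subtypeEquivRight fun i => by simp [Equiv.symm_apply_eq])
          (r (σ k))) := by
  obtain ⟨ε, -, -, hε⟩ := Comp.mk_relabel σ b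
  refine ⟨ε, ?_⟩
  set p0 : (Comp P Q).obj s K := Comp.mk (fun k => g (σ k)) h₁ p
    (fun l => Q.map (a l) (σ.symm.subtypeEquiv fun i => by simp) (q l)) with hp0
  have hp : (Comp P Q).map s σ p0 = Comp.mk g h₁ p q := by
    rw [hp0, Comp.map_mk σ _ g (fun _ => rfl)]
    congr 1
    funext l
    refine (Q.map_map _ _ (Equiv.refl _) (fun i => ?_) _).trans (Q.map_refl _ _ _)
    exact Subtype.ext (σ.apply_symm_apply i.1)
  rw [← hp, hε (f := fun i => σ.symm (f i)) (by simp) h₂' h₂ p0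
    (fun k => R.map _ (Equiv.subtypeEquivRight fun i => by simp [Equiv.symm_apply_eq]) (r (σ k)))
    r (fun k => (R.map_map _ _ (Equiv.refl _) (fun _ => rfl) _).trans (R.map_refl _ _ _) |>.symm)]

/-- Any middle level can be reordered so that `g` becomes monotone, at the price of a sign common to
both sides. Hence the elements on which `Interchange` is stated suffice. -/
lemma Hom.ext_left {F G : Hom (Comp (Comp P Q) R) Y}
    (H : ∀ {I K L : Type} [Finite I] [Fintype K] [LinearOrder K] [Fintype L] [LinearOrder L]
      (f : I → K) (g : K → L) (_ : Monotone g) {c s D : ℤ} {a : L → ℤ} {b : K → ℤ}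
      (h₁ : c + ∑ l, a l = s) (h₂ : s + ∑ k, b k = D)
      (p : P.obj c L) (q : ∀ l, Q.obj (a l) {k // g k = l}) (r : ∀ k, R.obj (b k) {i // f i = k}),
      F.app D I (Comp.mk f h₂ (Comp.mk g h₁ p q) r) =
        G.app D I (Comp.mk f h₂ (Comp.mk g h₁ p q) r)) : F = G := by
  apply Hom.ext_mk
  intro I _ n f s D b h₂ p' r
  have : F.app D I ∘ₗ Comp.mkL f h₂ r = G.app D I ∘ₗ Comp.mkL f h₂ r := by
    refine CompObj.hom_ext fun x p q => ?_
    rw [CompObj.inc_eq_mk]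
    change F.app D I (Comp.mk f h₂ _ r) = G.app D I (Comp.mk f h₂ _ r)
    obtain ⟨σ, hσ⟩ := exists_monotone_perm x.f
    have h₂' : s + ∑ k, b (σ k) = D := by rw [Equiv.sum_comp σ b, h₂]
    obtain ⟨ε, hε⟩ := Comp.mk_mk_perm σ f x.f x.deg h₂ h₂' p q r
    rw [hε, Units.smul_def, map_zsmul, map_zsmul]
    congr 1
    exact H _ _ hσ x.deg h₂' p _ _
  exact LinearMap.congr_fun this p'

/-- The map to the lexicographic sum of the sets of inputs. -/
def levelSum [Finite I] {h : I → L} {t : L → ℤ} (y : ∀ l, CompIdx (t l) {i // h i = l}) (i : I) :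
    Σₗ l, Fin (y l).n :=
  toLex ⟨h i, (y (h i)).f ⟨i, rfl⟩⟩

lemma levelSum_eq [Finite I] {h : I → L} {t : L → ℤ} (y : ∀ l, CompIdx (t l) {i // h i = l})
    (l : L) (i : {i // h i = l}) : levelSum y i.1 = toLex ⟨l, (y l).f i⟩ := by
  obtain ⟨i, rfl⟩ := i
  rfl

/-- The projection of the lexicographic sum. -/
def levelFst {n : L → ℕ} (k : Σₗ l, Fin (n l)) : L := (ofLex k).1

lemma levelFst_monotone [LinearOrder L] {n : L → ℕ} :
    Monotone (levelFst : (Σₗ l, Fin (n l)) → L) := by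
  intro a b hab
  rcases Sigma.Lex.le_def.1 hab with h | ⟨h, -⟩
  · exact h.le
  · exact h.le

/-- The fibres of the projection. -/
def levelFiber {n : L → ℕ} (l : L) : Fin (n l) ≃ {k : Σₗ l, Fin (n l) // levelFst k = l} where
  toFun j := ⟨toLex ⟨l, j⟩, rfl⟩
  invFun k := k.2 ▸ (ofLex k.1).2
  left_inv _ := rfl
  right_inv := by rintro ⟨⟨l, j⟩, rfl⟩; rfl

lemma levelFiber_strictMono [LinearOrder L] {n : L → ℕ} (l : L) :
    StrictMono (levelFiber (n := n) l) := by
  intro a b hab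
  exact Sigma.Lex.lt_def.2 (Or.inr ⟨rfl, hab⟩)

instance {n : L → ℕ} [Fintype L] : Fintype (Σₗ l, Fin (n l)) :=
  inferInstanceAs (Fintype (Σ l, Fin (n l)))

/-- The equivalence of the fibres. -/
def levelSumFib [Finite I] {h : I → L} {t : L → ℤ} (y : ∀ l, CompIdx (t l) {i // h i = l})
    (k : Σₗ l, Fin (y l).n) :
    {i // (y (ofLex k).1).f i = (ofLex k).2} ≃ {i // levelSum y i = k} where
  toFun i := ⟨i.1.1, by rw [levelSum_eq y _ i.1, i.2]; rfl⟩
  invFun i := ⟨⟨i.1, congrArg (fun k => (ofLex k).1) i.2⟩, by obtain ⟨i, rfl⟩ := i; rfl⟩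
  left_inv _ := rfl
  right_inv _ := rfl

lemma CompObj.span_inc [Finite I] {D : ℤ} : Submodule.span ℚ (Set.range
    fun z : Σ y : CompIdx D I, Q.obj y.e (Fin y.n) × (∀ k, R.obj (y.d k) {i // y.f i = k}) =>
      CompObj.inc Q R z.1 (z.2.1 ⊗ₜ[ℚ] PiTensorProduct.tprod ℚ z.2.2)) = ⊤ := by
  rw [← (Submodule.span ℚ _).ker_mkQ, LinearMap.ker_eq_top]
  refine CompObj.hom_ext fun y q r => ?_
  rw [LinearMap.zero_apply, Submodule.mkQ_apply, Submodule.Quotient.mk_eq_zero]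
  exact Submodule.subset_span ⟨⟨y, q, r⟩, rfl⟩

/-- The inner elements come with unrelated index sets `Fin n_l`. Their lexicographic sum is one
linearly ordered set `K` whose projection to `L` is monotone and whose fibres are the given index
sets in the given order, so the generators of `P ∘ (Q ∘ R)` take the form used in `Interchange`
without any sign. -/
lemma multilinear_ext_right [Finite I] [Fintype L] [LinearOrder L] {h : I → L} {t : L → ℤ}
    {M : Type} [AddCommGroup M] [Module ℚ M]
    {F G : MultilinearMap ℚ (fun l => (Comp Q R).obj (t l) {i // h i = l}) M}
    (H : ∀ (y : ∀ l, CompIdx (t l) {i // h i = l}) {a : L → ℤ} {b : (Σₗ l, Fin (y l).n) → ℤ}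
      (h₃ : ∀ l, a l + ∑ k : {k // levelFst k = l}, b k = t l)
      (q : ∀ l, Q.obj (a l) {k : Σₗ l, Fin (y l).n // levelFst k = l})
      (r : ∀ k, R.obj (b k) {i // levelSum y i = k}),
      F (fun l => Comp.mk (levelMap (levelSum y) levelFst l) (h₃ l) (q l)
          (fun k => R.map (b k) (levelFib (levelSum y) levelFst l k) (r k))) =
        G (fun l => Comp.mk (levelMap (levelSum y) levelFst l) (h₃ l) (q l)
          (fun k => R.map (b k) (levelFib (levelSum y) levelFst l k) (r k)))) : F = G := by
  refine MultilinearMap.ext_of_span_eq_top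
    (γ := fun l => Σ y : CompIdx (t l) {i // h i = l}, Q.obj y.e (Fin y.n) ×
      (∀ k, R.obj (y.d k) {i // y.f i = k}))
    (g := fun l z => CompObj.inc Q R z.1 (z.2.1 ⊗ₜ[ℚ] PiTensorProduct.tprod ℚ z.2.2)) ?_ ?_
  · exact fun l => CompObj.span_inc
  · intro z
    have h₃ : ∀ l, (z l).1.e + ∑ k : {k : Σₗ l, Fin (z l).1.n // levelFst k = l},
        (z (ofLex k.1).1).1.d (ofLex k.1).2 = t l := by
      intro l
      refine Eq.trans (congrArg ((z l).1.e + ·) ?_) (z l).1.deg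
      exact (Equiv.sum_comp (levelFiber l) _).symm
    have key := H (fun l => (z l).1) (a := fun l => (z l).1.e)
      (b := fun k => (z (ofLex k).1).1.d (ofLex k).2) h₃
      (fun l => Q.map _ (levelFiber l) (z l).2.1)
      (fun k => R.map _ (levelSumFib (fun l => (z l).1) k) ((z (ofLex k).1).2.2 (ofLex k).2))
    have e : ∀ l, Comp.mk (levelMap (levelSum fun l => (z l).1) levelFst l) (h₃ l)
        (Q.map _ (levelFiber l) (z l).2.1)
        (fun k => R.map _ (levelFib (levelSum fun l => (z l).1) levelFst l k)
          (R.map _ (levelSumFib (fun l => (z l).1) k.1) ((z (ofLex k.1).1).2.2 (ofLex k.1).2))) =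
        CompObj.inc Q R (z l).1 ((z l).2.1 ⊗ₜ[ℚ] PiTensorProduct.tprod ℚ (z l).2.2) := by
      intro l
      rw [CompObj.inc_eq_mk]
      refine Comp.mk_strictMono (levelFiber l) (levelFiber_strictMono l)
        (d' := fun k : {k : Σₗ l, Fin (z l).1.n // levelFst k = l} =>
          (z (ofLex k.1).1).1.d (ofLex k.1).2) ?_ _ _ _ _ _ ?_
      · intro i
        exact Subtype.ext (levelSum_eq (fun l => (z l).1) l i)
      · intro k
        exact R.map_map _ _ _ (fun _ => rfl) _
    rw [funext e] at key
    exact key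

lemma Hom.ext_right {F G : Hom (Comp P (Comp Q R)) Y}
    (H : ∀ {I K L : Type} [Finite I] [Fintype K] [LinearOrder K] [Fintype L] [LinearOrder L]
      (f : I → K) (g : K → L) (_ : Monotone g) {c D : ℤ} {a t : L → ℤ} {b : K → ℤ}
      (h₃ : ∀ l, a l + ∑ k : {k // g k = l}, b k = t l) (h₄ : c + ∑ l, t l = D)
      (p : P.obj c L) (q : ∀ l, Q.obj (a l) {k // g k = l}) (r : ∀ k, R.obj (b k) {i // f i = k}),
      F.app D I (Comp.mk (g ∘ f) h₄ p (fun l => Comp.mk (levelMap f g l) (h₃ l) (q l)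
        (fun k => R.map (b k) (levelFib f g l k) (r k)))) =
      G.app D I (Comp.mk (g ∘ f) h₄ p (fun l => Comp.mk (levelMap f g l) (h₃ l) (q l)
        (fun k => R.map (b k) (levelFib f g l k) (r k))))) : F = G := by
  apply Hom.ext_mk
  intro I _ n h c D t h₄ p z
  have : (F.app D I).compMultilinearMap (Comp.mkM h h₄ p) =
      (G.app D I).compMultilinearMap (Comp.mkM h h₄ p) := by
    apply multilinear_ext_right
    intro y a b h₃ q r
    change F.app D I (Comp.mkM h h₄ p _) = G.app D I (Comp.mkM h h₄ p _)
    refine (congrArg _ (Comp.mkM_apply h h₄ p _)).trans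
      (Eq.trans ?_ (congrArg _ (Comp.mkM_apply h h₄ p _)).symm)
    exact H (levelSum y) levelFst levelFst_monotone h₃ h₄ p q r
  have := congrArg (fun T => T z) this
  simpa only [LinearMap.compMultilinearMap_apply, Comp.mkM_apply] using this

/-! ### Morphisms compatible with compositions -/

/-- `x A = γ (a ∘ b)`. -/
def Intertwines (γ : Hom (Comp N N) N) (a : Hom P N) (b : Hom Q N) (x : Hom X N)
    (A : Hom (Comp P Q) X) : Prop :=
  ∀ (D : ℤ) (I : Type) [Finite I] (t : (Comp P Q).obj D I),
    x.app D I (A.app D I t) = γ.app D I ((Comp.map a b).app D I t)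

lemma Intertwines.mk {γ : Hom (Comp N N) N} {a : Hom P N} {b : Hom Q N} {x : Hom X N}
    {A : Hom (Comp P Q) X} (h : Intertwines γ a b x A) [Finite I] [Fintype K] [LinearOrder K]
    (f : I → K) {e D : ℤ} {d : K → ℤ} (h' : e + ∑ k, d k = D) (p : P.obj e K)
    (q : ∀ k, Q.obj (d k) {i // f i = k}) :
    x.app D I (A.app D I (Comp.mk f h' p q)) =
      γ.app D I (Comp.mk f h' (a.app e K p) (fun k => b.app (d k) _ (q k))) := by
  rw [h, Comp.map_app_mk]

lemma intertwines_of_mk {γ : Hom (Comp N N) N} {a : Hom P N} {b : Hom Q N} {x : Hom X N}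
    {A : Hom (Comp P Q) X} (H : ∀ {I : Type} [Finite I] {n : ℕ} (f : I → Fin n) {e D : ℤ}
    {d : Fin n → ℤ} (h' : e + ∑ k, d k = D) (p : P.obj e (Fin n))
    (q : ∀ k, Q.obj (d k) {i // f i = k}),
    x.app D I (A.app D I (Comp.mk f h' p q)) =
      γ.app D I (Comp.mk f h' (a.app e (Fin n) p) (fun k => b.app (d k) _ (q k)))) :
    Intertwines γ a b x A := by
  have : x.comp A = γ.comp (Comp.map a b) := by
    apply Hom.ext_mk
    intro I _ n f e D d h p q
    change x.app D I _ = γ.app D I ((Comp.map a b).app D I _)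
    rw [Comp.map_app_mk]
    exact H f h p q
  intro D I _ t
  exact congrArg (fun F => F.app D I t) this

/-- After applying the injective `y`, every composition involved is a composition in `N`, and the
claim is associativity there. This transports everything from the model to `Det`, `Gri` and `Det ∘
Gri`. -/
lemma Interchange.of_injective {γ : Hom (Comp N N) N} (hγ : Interchange γ γ γ γ)
    {a : Hom P N} {b : Hom Q N} {c : Hom R N} {x : Hom X N} {y : Hom Y N} {z : Hom Z N}
    {A : Hom (Comp P Q) X} {B : Hom (Comp X R) Y} {C : Hom (Comp Q R) Z} {E : Hom (Comp P Z) Y}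
    (hy : ∀ (D : ℤ) (I : Type) [Finite I], Function.Injective (y.app D I))
    (hA : Intertwines γ a b x A) (hB : Intertwines γ x c y B) (hC : Intertwines γ b c z C)
    (hE : Intertwines γ a z y E) : Interchange A B C E := by
  intro I K L _ _ _ _ _ f g hg e s D α t β h₁ h₂ h₃ h₄ p q r
  apply hy
  rw [hB.mk, hA.mk, hγ f g hg h₁ h₂ h₃ h₄, Units.smul_def, Units.smul_def, map_zsmul, hE.mk]
  congr 3
  funext l
  rw [hC.mk]
  congr 2
  funext k
  exact (c.naturality _ _ _).symm

lemma OperadData.isOperad_of_injective {N P : OperadData} (hN : N.IsOperad)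
    (j : Hom P.toGrSpecies N.toGrSpecies)
    (hj : ∀ (D : ℤ) (I : Type) [Finite I], Function.Injective (j.app D I))
    (h1 : j.app 0 Unit P.one = N.one) (hγ : Intertwines N.γ j j j P.γ) : P.IsOperad where
  one_comp x := by
    apply hj
    rw [insL, hγ.mk, h1]
    refine Eq.trans ?_ (hN.one_comp _)
    unfold insL
    congr 2
    funext k
    exact j.naturality _ _ _
  comp_one x := by
    apply hj
    rw [insR, hγ.mk]
    refine Eq.trans ?_ (hN.comp_one _)
    unfold insR
    congr 2
    funext k
    rw [j.naturality, h1]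
  assoc := Interchange.of_injective hN.assoc hj hγ hγ hγ hγ

end

end BOperad

namespace BOperad

noncomputable section

variable {I J K L Θ Θ' : Type}

/-! ### Associativity of the composition of products of trees. -/

lemma IsPar.units_smul {x : Lam I Θ} (hx : IsPar x) (ε : ℤˣ) : IsPar (ε • x) := by
  rcases Int.units_eq_one_or ε with rfl | rfl
  · rwa [one_smul]
  · have := IsConst.smul (-1) hx
    rwa [neg_one_smul] at this

lemma mapLeaf_stdPar (u : I → J) (π : K → Θ) (d : K → ℤ) (k : K) :
    mapLeaf u (stdPar (I := I) π d k) = stdPar π d k := by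
  unfold stdPar
  split_ifs
  · exact mapLeaf_par _ _
  · exact map_one _

lemma subst_stdPar (X : K → OddLam I Θ) (π : L → Θ) (d : L → ℤ) (l : L) :
    subst X parO (stdPar (I := K) π d l) = stdPar π d l := by
  unfold stdPar
  split_ifs
  · exact subst_par _ _ _
  · exact map_one _

lemma nγ_inc [Finite I] {D : ℤ} (x : CompIdx D I) (t : CompSummand nSpecies nSpecies x) :
    nγ.app D I (CompObj.inc nSpecies nSpecies x t) = nComp x t :=
  Comp.lift_app_inc _ _ _ x t

/-- The parametrized composition for inputs in a linearly ordered set. -/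
lemma subst_arg_mk [Finite I] [Fintype K] [LinearOrder K] (f : I → K) {e D : ℤ} {d : K → ℤ}
    (h : e + ∑ k, d k = D) (p : nSpecies.obj e K) (q : ∀ k, nSpecies.obj (d k) {i // f i = k})
    {θ : K → Lam I Θ} (hθ : ParFam d θ) :
    subst (arg θ q) Empty.elim (nVal p) = epsSign e d •
      (oprod θ * inj (fun i => i) (nVal (nγ.app D I (Comp.mk f h p q)))) := by
  let o : Fin (Fintype.card K) ≃o K := Fintype.orderIsoFinOfCardEq K rfl
  let x : CompIdx D I := ⟨Fintype.card K, o.symm ∘ f, e, d ∘ o,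
    (congrArg (e + ·) (Equiv.sum_comp o.toEquiv d)).trans h⟩
  let q' : ∀ k, nSpecies.obj (x.d k) {i // x.f i = k} := fun k =>
    nSpecies.map (d (o k)) (Equiv.subtypeEquivRight (fun i => by simp [x, OrderIso.symm_apply_eq]))
      (q (o k))
  have hθ' : ParFam x.d (fun k => θ (o k)) := fun k => hθ (o k)
  have key := subst_arg x (nSpecies.map e o.symm.toEquiv p) q' hθ'
  have h1 : (fun k => arg (fun k => θ (o k)) q' (o.symm k)) = arg θ q := by
    have hk : ∀ j, arg (fun k => θ (o k)) q' j = arg θ q (o j) := by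
      intro j
      apply Subtype.ext
      rw [arg_val hθ, arg_val hθ']
      refine congrArg (θ (o j) * ·) ?_
      exact inj_mapLeaf _ _ _
    funext k
    rw [hk, o.apply_symm_apply]
  have h2 : epsSign x.e x.d = epsSign e d := by
    unfold epsSign
    rw [show esymm₂ x.d = esymm₂ d from esymm₂_comp o.toEquiv d,
      show ∑ k, x.d k = ∑ k, d k from Equiv.sum_comp o.toEquiv d]
  rw [h2, oprod_orderIso o θ, nVal_map, subst_mapLeaf (fun e => e.elim)] at key
  refine (congrArg (fun X => subst X Empty.elim (nVal p)) h1).symm.trans (key.trans ?_)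
  rw [← nVal_nComp, ← nγ_inc]
  rfl

lemma oprod_stdPar_mul_cancel [Fintype K] [LinearOrder K] [Fintype L] [LinearOrder L]
    (a : L → ℤ) (b : K → ℤ) {y z : Lam I Empty}
    (h : oprod (stdPar (I := I) (Θ := L ⊕ K) Sum.inl a) * (oprod (stdPar Sum.inr b) *
        inj (fun i => i) y) = oprod (stdPar Sum.inl a) * (oprod (stdPar Sum.inr b) *
        inj (fun i => i) z)) : y = z := by
  classical
  rw [← mul_assoc, ← mul_assoc] at h
  have h1 : oprod (stdPar (I := I) (Θ := L ⊕ K) Sum.inl a) = _ :=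
    oprod_ite (fun l => Odd (a l)) (fun l => par (Sum.inl l))
  have h2 : oprod (stdPar (I := I) (Θ := L ⊕ K) Sum.inr b) = _ :=
    oprod_ite (fun k => Odd (b k)) (fun k => par (Sum.inr k))
  set lL := (Finset.univ.sort (· ≤ · : L → L → Prop)).filter fun l => Odd (a l)
  set lK := (Finset.univ.sort (· ≤ · : K → K → Prop)).filter fun l => Odd (b l)
  have h3 : oprod (stdPar (I := I) (Θ := L ⊕ K) Sum.inl a) * oprod (stdPar Sum.inr b) =
      ((lL.map Sum.inl ++ lK.map Sum.inr).map par).prod := by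
    rw [h1, h2, List.map_append, List.prod_append, List.map_map, List.map_map]
    rfl
  rw [h3] at h
  refine par_prod_mul_cancel (List.nodup_append.2 ⟨?_, ?_, ?_⟩) h
  · exact ((Finset.sort_nodup _ _).filter _).map Sum.inl_injective
  · exact ((Finset.sort_nodup _ _).filter _).map Sum.inr_injective
  · intro u hu v hv
    obtain ⟨l, -, rfl⟩ := List.mem_map.1 hu
    obtain ⟨k, -, rfl⟩ := List.mem_map.1 hv
    exact Sum.inl_ne_inr

/-- The left side is what moving blocks of parameters produces, one block per fibre of `g`; the
right side is the sign in `Interchange`. -/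
lemma koszul_eq [Fintype K] [Fintype L] [LinearOrder L] (g : K → L) (a : L → ℤ) (b : K → ℤ) :
    (∏ i, ∏ j, if j < i then (a i * ∑ k : {k // g k = j}, b k).negOnePow else 1) =
      ∏ l, ∏ k with g k < l, (a l * b k).negOnePow := by
  refine Finset.prod_congr rfl fun l _ => ?_
  rw [Finset.prod_filter, ← Equiv.prod_comp (Equiv.sigmaFiberEquiv g), Fintype.prod_sigma]
  refine Finset.prod_congr rfl fun j _ => ?_
  have : ∀ k : {k // g k = j}, (if g ((Equiv.sigmaFiberEquiv g) ⟨j, k⟩) < l then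
      (a l * b ((Equiv.sigmaFiberEquiv g) ⟨j, k⟩)).negOnePow else 1) =
      if j < l then (a l * b k).negOnePow else 1 := by
    intro k
    have : g ((Equiv.sigmaFiberEquiv g) ⟨j, k⟩) = j := k.2
    rw [this]; rfl
  rw [Finset.prod_congr rfl fun k _ => this k]
  split_ifs
  · rw [prod_negOnePow, Finset.mul_sum]
  · simp

/-- With independent parameters `θ_l` for the `q l` and `η_k` for the `r k`, the elements `η_k r_k`
are substituted into the elements `θ_l q_l`, and these into `p`. Since substitutions compose, this
may be evaluated from the outside, giving the left-hand composite, or from the inside, giving the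
right-hand one. Both carry the same parameters in different orders; comparing the orders yields the
Koszul sign, and the factors `epsSign` match by the cocycle identity. -/
lemma nγ_assoc : Interchange nγ nγ nγ nγ := by
  intro I K L _ _ _ _ _ f g hg c s D a t b h₁ h₂ h₃ h₄ p q r
  set η : K → Lam I (L ⊕ K) := stdPar Sum.inr b with hη
  set θ : L → Lam K (L ⊕ K) := stdPar Sum.inl a with hθ
  set θI : L → Lam I (L ⊕ K) := stdPar Sum.inl a with hθI
  have pη : ParFam b η := parFam_stdPar _ _
  have pθ : ParFam a θ := parFam_stdPar _ _
  have pθI : ParFam a θI := parFam_stdPar _ _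
  set X := arg η r with hX
  set C := fun l => nγ.app (t l) _ (Comp.mk (levelMap f g l) (h₃ l) (q l)
    (fun k => nSpecies.map (b k) (levelFib f g l k) (r k))) with hC
  set H : L → Lam I (L ⊕ K) := fun l => oprod fun k : {k // g k = l} => η k with hH
  set E : L → ℤˣ := fun l => epsSign (a l) (fun k : {k // g k = l} => b k) with hE
  -- The inner composition releases the parameters `η_k` of the fibre over `l`. Together with `θ_l`
  -- they form one composite parameter of parity `a l + ∑ b = t l`, admissible for the outer
  -- composition.
  set θ' : L → Lam I (L ⊕ K) := fun l => E l • (θI l * H l) with hθ'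
  have hHpar : ∀ l, HasPar (∑ k : {k // g k = l}, b k) (H l) := fun l =>
    hasPar_oprod fun k => (pη k).1
  have pθ' : ParFam t θ' := by
    intro l
    refine ⟨?_, ?_⟩
    · rw [← h₃ l]
      exact ((pθI l).1.mul (hHpar l)).units_smul _
    · exact IsPar.units_smul ((pθI l).2.mul (isConst_oprod fun k : {k // g k = l} => (pη k.1).2)) _
  have inner : ∀ l, subst (fun k : {k // g k = l} => X k) Empty.elim (nVal (q l)) =
      E l • (H l * inj Subtype.val (nVal (C l))) := by
    intro l
    set ηl : {k // g k = l} → Lam {i // (g ∘ f) i = l} (L ⊕ K) :=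
      stdPar (fun k => Sum.inr k.1) (fun k => b k) with hηl
    have pηl : ParFam (fun k : {k // g k = l} => b k) ηl := parFam_stdPar _ _
    have h := congrArg (mapLeaf Subtype.val) (subst_arg_mk (levelMap f g l) (h₃ l) (q l)
      (fun k => nSpecies.map (b k) (levelFib f g l k) (r k)) pηl)
    have h2 := map_oprod (mapLeaf Subtype.val :
      Lam {i // (g ∘ f) i = l} (L ⊕ K) →ₐ[ℚ] Lam I (L ⊕ K)).toMonoidHom ηl
    change mapLeaf _ _ = oprod fun k => mapLeaf _ _ at h2
    have h3 : ∀ k, mapLeaf Subtype.val (ηl k) = η k := fun k => mapLeaf_stdPar _ _ _ _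
    rw [mapLeaf, subst_subst isPar_parO, ← mapLeaf, Units.smul_def, map_zsmul, ← Units.smul_def,
      map_mul, mapLeaf_inj, h2, funext h3] at h
    refine Eq.trans ?_ h
    congr 2
    · funext k
      apply Subtype.ext
      change _ = mapLeaf Subtype.val (arg ηl _ k).1
      rw [arg_val pη, arg_val pηl, map_mul, h3, mapLeaf_inj, nVal_map, inj_mapLeaf]
      rfl
    · funext e; exact e.elim
  -- The parametrized composition of `p` and `q`, into which `r` is now substituted; its two sides
  -- are the two ways of evaluating.
  have outer := congrArg (subst X parO) (subst_arg_mk g h₁ p q pθ)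
  have h2 := map_oprod (subst X parO : Lam K (L ⊕ K) →ₐ[ℚ] Lam I (L ⊕ K)).toMonoidHom θ
  change subst _ _ _ = oprod fun k => subst _ _ _ at h2
  have h3 : ∀ l, subst X parO (θ l) = θI l := fun l => subst_stdPar _ _ _ _
  rw [subst_subst isPar_parO, Units.smul_def, map_zsmul, ← Units.smul_def, map_mul,
    subst_inj isPar_parO, h2, funext h3, subst_arg_mk f h₂ _ r pη] at outer
  have h4 : (fun l => substO X parO (arg θ q l)) = arg θ' C := by
    funext l
    apply Subtype.ext
    change subst X parO (arg θ q l).1 = _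
    rw [arg_val pθ, arg_val pθ', map_mul, h3, subst_inj isPar_parO, inner, mul_smul_comm,
      smul_mul_assoc, mul_assoc]
  have h5 : (fun ξ : Empty => substO X parO (Empty.elim ξ)) = Empty.elim := by
    funext e; exact e.elim
  rw [h4, h5, subst_arg_mk (g ∘ f) h₄ p C pθ'] at outer
  -- Separating the `θ_l` from the blocks of `η_k` moves each block past the later `θ_l`; the blocks
  -- then line up in the order of `K` because `g` is monotone.
  have h6 : oprod θ' = (∏ l, E l) • (∏ l, ∏ k with g k < l, (a l * b k).negOnePow) •
      (oprod θI * oprod η) := by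
    rw [hθ', oprod_units_smul, oprod_mul θI H a (fun l => ∑ k : {k // g k = l}, b k)
      (fun i j => (pθI i).1.comm (hHpar j)), koszul_eq, hH, oprod_fibers hg]
  rw [h6, smul_mul_assoc, smul_smul, mul_smul_comm, smul_smul, epsSign_mul g h₁ h₃,
    mul_comm (epsSign c t)] at outer
  have h7 := smul_left_cancel _ outer
  apply nVal_injective
  rw [Units.smul_def, map_zsmul, ← Units.smul_def]
  refine (oprod_stdPar_mul_cancel a b (h7.symm.trans ?_))
  rw [smul_mul_assoc, mul_assoc, Units.smul_def _ (nVal _), map_zsmul, ← Units.smul_def,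
    mul_smul_comm, mul_smul_comm]

/-! ### The operad of products of trees -/

lemma tree_leaf_mem_nSub : (tree (BinTree.leaf ()) : Lam Unit Empty) ∈ nSub 0 Unit := by
  rw [nSub, if_pos le_rfl, full_eq]
  simpa [wt] using! lamGen_mem_wspan (I := Unit) (Θ := Empty) (Sum.inl (BinTree.leaf ()))

/-- The unit tree. -/
def nOne : nSpecies.obj 0 Unit := ⟨tree (BinTree.leaf ()), tree_leaf_mem_nSub⟩

lemma nVal_one : nVal nOne = tree (BinTree.leaf ()) := rfl

/-- The universal parameters can be cancelled, so one parametrized identity is enough to identify a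
composite. -/
lemma nγ_eq [Finite I] [Fintype K] [LinearOrder K] (f : I → K) {e D : ℤ} {d : K → ℤ}
    (h : e + ∑ k, d k = D) (p : nSpecies.obj e K) (q : ∀ k, nSpecies.obj (d k) {i // f i = k})
    {y : nSpecies.obj D I}
    (hy : subst (arg (stdPar (Θ := K) (fun k => k) d) q) Empty.elim (nVal p) = epsSign e d •
      (oprod (stdPar (fun k => k) d) * inj (fun i => i) (nVal y))) :
    nγ.app D I (Comp.mk f h p q) = y := by
  classical
  rw [subst_arg_mk f h p q (parFam_stdPar _ _)] at hy
  apply nVal_injective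
  have h1 : oprod (stdPar (I := I) (Θ := K) (fun k => k) d) = _ :=
    oprod_ite (fun l => Odd (d l)) par
  rw [h1] at hy
  exact par_prod_mul_cancel ((Finset.sort_nodup _ _).filter _) (smul_left_cancel _ hy)

lemma esymm₂_unit (d : Unit → ℤ) : esymm₂ d = 0 := by simp [esymm₂]

lemma esymm₂_zero [Fintype K] : esymm₂ (fun _ : K => 0) = 0 := by simp [esymm₂]

lemma stdPar_zero (π : K → Θ) (k : K) : (stdPar π (fun _ => 0) k : Lam I Θ) = 1 := by
  simp [stdPar]

lemma oprod_one [Fintype K] [LinearOrder K] {A : Type} [Monoid A] :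
    oprod (fun _ : K => (1 : A)) = 1 := by simp [oprod]

lemma oprod_unit {A : Type} [Monoid A] (v : Unit → A) : oprod v = v () := by
  simp [oprod]

lemma nγ_one_comp {d : ℤ} [Finite I] (x : nSpecies.obj d I) :
    nγ.app d _ (insL nOne x) = x := by
  refine nγ_eq _ _ _ _ ?_
  rw [nVal_one, subst_tree, ev_leaf, arg_val (parFam_stdPar _ _), oprod_unit, epsSign,
    esymm₂_unit]
  simp only [zero_mul, zero_add, Int.negOnePow_zero, one_smul]
  exact congrArg (_ * ·) (inj_mapLeaf _ _ _)

lemma nγ_comp_one {d : ℤ} [Fintype K] [LinearOrder K] (x : nSpecies.obj d K) :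
    nγ.app d _ (insR nOne x) = x := by
  refine nγ_eq _ _ _ _ ?_
  have h1 : oprod (stdPar (I := K) (Θ := K) (fun k => k) fun _ => 0) = 1 := by
    rw [show stdPar (I := K) (Θ := K) (fun k => k) (fun _ => 0) = fun _ => 1 from
      funext fun k => stdPar_zero _ k, oprod_one]
  rw [h1, one_mul, epsSign, esymm₂_zero]
  simp only [Finset.sum_const_zero, mul_zero, add_zero, Int.negOnePow_zero, one_smul]
  unfold inj
  congr 2
  funext k
  apply Subtype.ext
  rw [arg_val (parFam_stdPar _ _), stdPar_zero, one_mul, nVal_map, inj_mapLeaf]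
  exact subst_tree _ _ _

/-- The operad of products of trees. -/
def nOperad : OperadData where
  toGrSpecies := nSpecies
  one := nOne
  γ := nγ

lemma nOperad_isOperad : nOperad.IsOperad where
  one_comp x := nγ_one_comp x
  comp_one x := nγ_comp_one x
  assoc := nγ_assoc

end

end BOperad

namespace BOperad

noncomputable section

variable {I J K L Θ : Type}

/-! ### Families of trees with disjoint leaves -/

lemma BinTree.exists_relabel (t : BinTree I) (P : I → Prop) (h : ∀ i ∈ t.leaves, P i) :
    ∃ t' : BinTree {i // P i}, t'.relabel Subtype.val = t := by
  induction t using BinTree.induct with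
  | leaf i => exact ⟨leaf ⟨i, h i (by simp)⟩, rfl⟩
  | mul s t hs ht =>
    obtain ⟨s', rfl⟩ := hs fun i hi => h i (by simp [hi])
    obtain ⟨t', rfl⟩ := ht fun i hi => h i (by simp [hi])
    exact ⟨s' * t', graft_mul _ _ _⟩

lemma BinTree.leaves_ne_zero (t : BinTree I) : t.leaves ≠ 0 := by
  induction t using BinTree.induct with
  | leaf i => simp
  | mul s t hs ht => simp [hs]

lemma BinTree.relabel_injective {u : I → J} (hu : Function.Injective u) :
    Function.Injective (relabel u) := by
  intro s t h
  obtain ⟨i, -⟩ := Multiset.exists_mem_of_ne_zero s.leaves_ne_zero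
  have : Nonempty I := ⟨i⟩
  have key : ∀ t : BinTree I, (t.relabel u).relabel (Function.invFun u) = t := by
    intro t
    rw [relabel, relabel, graft_graft]
    simp only [graft_leaf, Function.leftInverse_invFun hu _]
    exact graft_leaf_right t
  rw [← key s, h, key]

lemma BinTree.leaf_injective : Function.Injective (leaf : I → BinTree I) := by
  intro i j h
  have := congrArg leaves h
  simpa using this

lemma LTree.leaves_eq_full [Finite I] {d : ℤ} (T : LTree d I) : T.1.leaves = full I :=
  eq_full T.2.1 T.2.2.1

/-- A partition of `I` into `n` blocks, with a tree on each block. -/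
structure TreeDec (n : ℕ) (I : Type) where
  f : I → Fin n
  T : ∀ k, LTree 0 {i // f i = k}

/-- The trees with leaves in `I`. -/
def TreeDec.val {n : ℕ} (x : TreeDec n I) (k : Fin n) : BinTree I := (x.T k).1.relabel Subtype.val

lemma TreeDec.mem_leaves {n : ℕ} (x : TreeDec n I) (k : Fin n) (i : I) :
    i ∈ (x.val k).leaves ↔ x.f i = k := by
  rw [TreeDec.val, BinTree.leaves_relabel, Multiset.mem_map]
  exact ⟨by rintro ⟨a, _, rfl⟩; exact a.2, fun h => ⟨⟨i, h⟩, (x.T k).2.2.1 _, rfl⟩⟩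

lemma TreeDec.val_injective {n : ℕ} : Function.Injective (TreeDec.val (n := n) (I := I)) := by
  rintro ⟨f, T⟩ ⟨f', T'⟩ h
  obtain rfl : f = f' := by
    funext i
    have h1 := (TreeDec.mem_leaves ⟨f, T⟩ (f i) i).2 rfl
    rw [h] at h1
    exact ((TreeDec.mem_leaves ⟨f', T'⟩ (f i) i).1 h1).symm
  congr 1
  funext k
  exact Subtype.ext (BinTree.relabel_injective Subtype.val_injective (congrFun h k))

/-- Each label occurs in exactly one of the trees, because `full I` contains it exactly once. The
block map records which tree it is. -/
lemma TreeDec.exists_val [Finite I] {n : ℕ} {l : Fin n → BinTree I}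
    (hl : ∑ k, (l k).leaves = full I) : ∃ x : TreeDec n I, x.val = l := by
  have hex : ∀ i, ∃ k, i ∈ (l k).leaves := by
    intro i
    have := mem_full i
    rw [← hl, Multiset.mem_sum] at this
    simpa using this
  choose f hf using hex
  have hle : ∀ k, (l k).leaves ≤ full I := fun k => by
    rw [← hl]
    exact Finset.single_le_sum (f := fun k => (l k).leaves) (fun _ _ => Multiset.zero_le _) (Finset.mem_univ k)
  have huniq : ∀ k i, i ∈ (l k).leaves → f i = k := by
    intro k i hi
    by_contra hne
    have h2 : (l (f i)).leaves + (l k).leaves ≤ full I := by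
      rw [← hl, ← Finset.sum_pair (f := fun k => (l k).leaves) hne]
      exact Finset.sum_le_sum_of_subset (Finset.subset_univ _)
    have := Multiset.nodup_of_le h2 nodup_full
    exact Multiset.disjoint_left.1 ((Multiset.nodup_add.1 this).2.2) (hf i) hi
  choose T hT using fun k => (l k).exists_relabel (fun i => f i = k) (huniq k)
  refine ⟨⟨f, fun k => ⟨T k, ?_, ?_, rfl⟩⟩, funext hT⟩
  · have := Multiset.nodup_of_le (hle k) nodup_full
    rw [← hT, BinTree.leaves_relabel] at this
    exact this.of_map _
  · rintro ⟨i, rfl⟩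
    have := hf i
    rw [← hT, BinTree.leaves_relabel, Multiset.mem_map] at this
    obtain ⟨a, ha, hai⟩ := this
    rwa [show (⟨i, rfl⟩ : {j // f j = f i}) = a from Subtype.ext hai.symm]

/-! ### The operad of trees inside the operad of products of trees -/

lemma tree_mem_nSub [Finite I] {d : ℤ} (T : LTree d I) : (tree T.1 : Lam I Empty) ∈ nSub d I := by
  obtain ⟨T, h1, h2, rfl⟩ := T
  rw [nSub, if_pos le_rfl]
  simpa [wt, eq_full h1 h2] using! lamGen_mem_wspan (I := I) (Θ := Empty) (Sum.inl T)

/-- Linear combinations of trees as elements of the exterior algebra. -/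
def griVal (d : ℤ) (I : Type) [Finite I] : griSpecies.obj d I →ₗ[ℚ] Lam I Empty :=
  ExteriorAlgebra.ι ℚ ∘ₗ Finsupp.lmapDomain ℚ ℚ (fun T : LTree d I => Sum.inl T.1) ∘ₗ
    (griEquiv d I).toLinearMap

lemma griVal_griTree [Finite I] {d : ℤ} (T : LTree d I) : griVal d I (griTree T) = tree T.1 := by
  simp only [griVal, LinearMap.comp_apply, LinearEquiv.coe_coe, griEquiv_griTree,
    Finsupp.lmapDomain_apply, Finsupp.mapDomain_single]
  rfl

lemma griVal_injective [Finite I] {d : ℤ} : Function.Injective (griVal d I) := by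
  have h1 : Function.Injective (ExteriorAlgebra.ι ℚ (M := GenSp I Empty)) := fun u v h => by
    simpa using h
  refine h1.comp (Function.Injective.comp ?_ (griEquiv d I).injective)
  refine Finsupp.mapDomain_injective ?_
  exact Sum.inl_injective.comp Subtype.val_injective

lemma gri_linear_ext [Finite I] {d : ℤ} {M : Type} [AddCommGroup M] [Module ℚ M]
    {F G : griSpecies.obj d I →ₗ[ℚ] M} (h : ∀ T : LTree d I, F (griTree T) = G (griTree T)) :
    F = G := by
  apply Finsupp.lhom_ext'
  intro T
  apply LinearMap.ext_ring
  exact h T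

lemma griVal_mem [Finite I] {d : ℤ} (x : griSpecies.obj d I) : griVal d I x ∈ nSub d I := by
  have : (nSub d I).mkQ ∘ₗ griVal d I = 0 := by
    apply gri_linear_ext
    intro T
    rw [LinearMap.comp_apply, griVal_griTree, LinearMap.zero_apply, Submodule.mkQ_apply,
      Submodule.Quotient.mk_eq_zero]
    exact tree_mem_nSub T
  have h := LinearMap.congr_fun this x
  rwa [LinearMap.comp_apply, LinearMap.zero_apply, Submodule.mkQ_apply,
      Submodule.Quotient.mk_eq_zero] at h

/-- The inclusion of trees. -/
def griN : Hom griSpecies nSpecies where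
  app d I _ := (griVal d I).codRestrict (nSub d I) griVal_mem
  naturality d I J _ _ u x := by
    apply nVal_injective
    have : griVal d J ∘ₗ griSpecies.map d u = (mapLeaf u).toLinearMap ∘ₗ griVal d I := by
      apply gri_linear_ext
      intro T
      simp only [LinearMap.comp_apply, griSpecies_map_griTree, griVal_griTree,
        AlgHom.toLinearMap_apply, mapLeaf_tree]
      rfl
    exact LinearMap.congr_fun this x

lemma nVal_griN [Finite I] {d : ℤ} (x : griSpecies.obj d I) :
    nVal (griN.app d I x) = griVal d I x := rfl

lemma griN_injective (d : ℤ) (I : Type) [Finite I] : Function.Injective (griN.app d I) := by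
  intro x y h
  apply griVal_injective
  rw [← nVal_griN, h, nVal_griN]

lemma Hom.ext_inc {P Q Z : GrSpecies} {F G : Hom (Comp P Q) Z}
    (H : ∀ (D : ℤ) (I : Type) [Finite I] (x : CompIdx D I),
      F.app D I ∘ₗ CompObj.inc P Q x = G.app D I ∘ₗ CompObj.inc P Q x) : F = G := by
  ext D I _ x
  refine LinearMap.congr_fun (CompObj.hom_ext fun x p q => ?_) x
  exact LinearMap.congr_fun (H D I x) _

/-- Composition with trees as inputs. -/
lemma nγ_trees [Finite I] [Fintype K] [LinearOrder K] (f : I → K) {e D : ℤ} {d : K → ℤ}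
    (h : e + ∑ k, d k = D) (p : nSpecies.obj e K) (S : ∀ k, LTree (d k) {i // f i = k}) :
    nVal (nγ.app D I (Comp.mk f h p fun k => griN.app _ _ (griTree (S k)))) =
      subst (fun k => treeO ((S k).1.relabel Subtype.val)) Empty.elim (nVal p) := by
  -- Trees have degree `0` and are already odd: all parameters can be taken to be `1`, and the sign
  -- is trivial.
  have hd : d = fun _ => 0 := funext fun k => (S k).2.2.2
  have hm := subst_arg_mk (Θ := Empty) f h p (fun k => griN.app _ _ (griTree (S k)))
    (θ := fun _ => 1) (fun k => by rw [hd]; exact ⟨hasPar_one, isConst_one⟩)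
  have h1 : epsSign e d = 1 := by
    rw [hd, epsSign, esymm₂_zero]; simp
  rw [h1, one_smul, oprod_one, one_mul, inj_empty, mapLeaf_id] at hm
  rw [← hm]
  congr 2
  funext k
  apply Subtype.ext
  rw [arg_val (fun k => by rw [hd]; exact ⟨hasPar_one, isConst_one⟩), one_mul, nVal_griN,
    griVal_griTree, inj_tree]
  rfl

lemma griN_intertwines : Intertwines nγ griN griN griN Gri.γ := by
  have : griN.comp Gri.γ = nγ.comp (Comp.map griN griN) := by
    apply Hom.ext_inc
    intro D I _ x
    apply gri_ext x
    intro T S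
    change griN.app D I (griOperadComp.app D I (CompObj.inc _ _ x _)) =
      nγ.app D I ((Comp.map griN griN).app D I (CompObj.inc _ _ x _))
    rw [griOperadComp, Comp.lift_app_inc, griComp_griTree, CompObj.inc_eq_mk, Comp.map_app_mk]
    apply nVal_injective
    rw [nVal_griN, griVal_griTree]
    refine Eq.trans ?_ (nγ_trees x.f x.deg _ S).symm
    rw [nVal_griN, griVal_griTree, subst_tree, ev_treeO]
    rfl
  intro D I _ t
  exact congrArg (fun F => F.app D I t) this

lemma griN_one : griN.app 0 Unit Gri.one = nOne := by
  apply nVal_injective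
  exact griVal_griTree _

lemma gri_isOperad : Gri.IsOperad :=
  OperadData.isOperad_of_injective nOperad_isOperad griN griN_injective griN_one griN_intertwines

end

end BOperad

namespace BOperad

noncomputable section

variable {I J K L Θ : Type}

/-! ### Top exterior powers -/

/-- The product of the basis vectors `o 0, …, o (n-1)`. -/
def vol {n : ℕ} (o : Fin n → I) : ExteriorAlgebra ℚ (I →₀ ℚ) :=
  (List.ofFn fun k => ExteriorAlgebra.ι ℚ (Finsupp.single (o k) 1)).prod

lemma vol_eq {n : ℕ} (o : Fin n → I) :
    vol o = ExteriorAlgebra.ιMulti ℚ n fun k => Finsupp.single (o k) 1 :=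
  (ExteriorAlgebra.ιMulti_apply _).symm

lemma extMap_vol {n : ℕ} (o : Fin n → I) (u : I → J) : extMap u (vol o) = vol (u ∘ o) := by
  rw [vol, map_list_prod, List.map_ofFn, vol]
  congr 2
  funext k
  simp [extMap]

lemma vol_mem {n : ℕ} (o : Fin n → I) : vol o ∈ ⋀[ℚ]^n (I →₀ ℚ) := by
  rw [vol_eq, ← ExteriorAlgebra.ιMulti_span_fixedDegree]
  exact Submodule.subset_span ⟨_, rfl⟩

lemma volCoeff_vol (n : ℕ) : volCoeff n (vol fun k => k) = 1 := by
  rw [vol_eq, volCoeff, ExteriorAlgebra.liftAlternating_apply_ιMulti, Pi.single_eq_same]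
  exact (Finsupp.basisSingleOne (R := ℚ) (ι := Fin n)).det_self

/-- The top exterior power is a line: an alternating map in `n` arguments is determined by its value
on the basis, and `volCoeff` is the determinant on it. -/
lemma eq_volCoeff_smul_vol {n : ℕ} {x : ExteriorAlgebra ℚ (Fin n →₀ ℚ)}
    (hx : x ∈ ⋀[ℚ]^n (Fin n →₀ ℚ)) : x = volCoeff n x • vol fun k => k := by
  rw [← ExteriorAlgebra.ιMulti_span_fixedDegree] at hx
  have key : (ExteriorAlgebra.ιMulti ℚ n : (Fin n →₀ ℚ) [⋀^Fin n]→ₗ[ℚ] _) =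
      (LinearMap.toSpanSingleton ℚ _ (vol fun k => k)).compAlternatingMap
        (Finsupp.basisSingleOne (R := ℚ) (ι := Fin n)).det := by
    refine Module.Basis.ext_alternating Finsupp.basisSingleOne fun v hv => ?_
    let σ : Equiv.Perm (Fin n) := Equiv.ofBijective v (Finite.injective_iff_bijective.1 hv)
    change ExteriorAlgebra.ιMulti ℚ n (Finsupp.basisSingleOne (R := ℚ) (ι := Fin n) ∘ σ) =
      (LinearMap.toSpanSingleton ℚ _ (vol fun k => k))
        ((Finsupp.basisSingleOne (R := ℚ) (ι := Fin n)).det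
          (Finsupp.basisSingleOne (R := ℚ) (ι := Fin n) ∘ σ))
    rw [AlternatingMap.map_perm, AlternatingMap.map_perm, Module.Basis.det_self,
      LinearMap.toSpanSingleton_apply, vol_eq, Units.smul_def, Units.smul_def, smul_assoc, one_smul]
    congr 2
  induction hx using Submodule.span_induction with
  | mem x hx =>
    obtain ⟨v, rfl⟩ := hx
    conv_lhs => rw [key]
    rw [volCoeff, ExteriorAlgebra.liftAlternating_apply_ιMulti, Pi.single_eq_same]
    rfl
  | zero => simp
  | add x y _ _ hx hy => rw [map_add, add_smul, ← hx, ← hy]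
  | smul c x _ hx => rw [map_smul, smul_assoc, ← hx]

lemma exists_smul_vol {n : ℕ} (o : Fin n ≃ I) {x : ExteriorAlgebra ℚ (I →₀ ℚ)}
    (hx : x ∈ ⋀[ℚ]^n (I →₀ ℚ)) : ∃ c : ℚ, x = c • vol o := by
  refine ⟨volCoeff n (extMap o.symm x), ?_⟩
  have h := congrArg (extMap o) (eq_volCoeff_smul_vol (extMap_mem_pow o.symm n hx))
  rw [extMap_comp, map_smul, extMap_vol, o.self_comp_symm] at h
  exact (extMap_id x).symm.trans h

lemma vol_ne_zero {n : ℕ} (o : Fin n ≃ I) : vol o ≠ 0 := by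
  intro h
  have h1 := congrArg (fun x => volCoeff n (extMap o.symm x)) h
  simp only [extMap_vol, o.symm_comp_self, map_zero] at h1
  exact one_ne_zero ((volCoeff_vol n).symm.trans h1)

/-- The generator of `Det(I)` given by an ordering of `I`. -/
def detTop {n : ℕ} {d : ℤ} (hn : 0 < n) (hd : d + 1 = n) [Finite I] (o : Fin n ≃ I) :
    detSpecies.obj d I :=
  ⟨vol o, by
    have hc : Nat.card I = n := by rw [← Nat.card_congr o, Nat.card_fin]
    rw [detSub, hc, if_pos ⟨hn, hd⟩]
    exact vol_mem _⟩

lemma detVal_detTop {n : ℕ} {d : ℤ} (hn : 0 < n) (hd : d + 1 = n) [Finite I] (o : Fin n ≃ I) :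
    detVal d I (detTop hn hd o) = vol o := rfl

lemma det_eq_zero_or [Finite I] {d : ℤ} (x : detSpecies.obj d I) :
    x = 0 ∨ (0 < Nat.card I ∧ d + 1 = Nat.card I) := by
  rcases detVal_cases x with h | h
  · exact Or.inr ⟨h.1, h.2.1⟩
  · exact Or.inl (detVal_injective (h.trans (map_zero _).symm))

lemma exists_smul_detTop {n : ℕ} {d : ℤ} (hn : 0 < n) (hd : d + 1 = n) [Finite I] (o : Fin n ≃ I)
    (x : detSpecies.obj d I) : ∃ c : ℚ, x = c • detTop hn hd o := by
  have hc : Nat.card I = n := by rw [← Nat.card_congr o, Nat.card_fin]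
  rcases detVal_cases x with ⟨-, -, h⟩ | h
  · rw [hc] at h
    obtain ⟨c, hc⟩ := exists_smul_vol o h
    exact ⟨c, detVal_injective (by rw [map_smul, detVal_detTop, hc])⟩
  · exact ⟨0, detVal_injective (by rw [h, zero_smul, map_zero])⟩

/-! ### The operad `Det` inside the operad of products of trees -/

/-- Products of leaves. -/
def leafMap (I : Type) : ExteriorAlgebra ℚ (I →₀ ℚ) →ₐ[ℚ] Lam I Empty :=
  ExteriorAlgebra.map (Finsupp.lmapDomain ℚ ℚ fun i => Sum.inl (BinTree.leaf i))

lemma leafMap_single (i : I) :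
    leafMap I (ExteriorAlgebra.ι ℚ (Finsupp.single i 1)) = tree (BinTree.leaf i) := by
  rw [leafMap, ExteriorAlgebra.map_apply_ι, Finsupp.lmapDomain_apply, Finsupp.mapDomain_single]
  rfl

lemma leafMap_vol {n : ℕ} (o : Fin n → I) :
    leafMap I (vol o) = (List.ofFn fun k => (tree (BinTree.leaf (o k)) : Lam I Empty)).prod := by
  rw [vol, map_list_prod, List.map_ofFn]
  congr 2
  funext k
  exact leafMap_single _

lemma leafMap_injective : Function.Injective (leafMap I) := by
  apply ExteriorAlgebra.map_injective_field
  rw [LinearMap.ker_eq_bot]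
  exact Finsupp.mapDomain_injective (Sum.inl_injective.comp BinTree.leaf_injective)

lemma inj_leafMap (u : I → J) (x : ExteriorAlgebra ℚ (I →₀ ℚ)) :
    (inj u (leafMap I x) : Lam J Θ) = inj (fun i => i) (leafMap J (extMap u x)) := by
  have : ((inj u : Lam I Empty →ₐ[ℚ] Lam J Θ).comp (leafMap I)) =
      ((inj (fun i => i)).comp (leafMap J)).comp (extMap u) := by
    apply ExteriorAlgebra.hom_ext
    apply Finsupp.lhom_ext'
    intro i
    apply LinearMap.ext_ring
    simp only [LinearMap.comp_apply, AlgHom.toLinearMap_apply, AlgHom.comp_apply,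
      Finsupp.lsingle_apply, leafMap_single, inj_tree, extMap, ExteriorAlgebra.map_apply_ι,
      Finsupp.lmapDomain_apply, Finsupp.mapDomain_single]
    rfl
  exact congrArg (fun F => F x) this

lemma mapLeaf_leafMap (u : I → J) (x : ExteriorAlgebra ℚ (I →₀ ℚ)) :
    mapLeaf u (leafMap I x) = leafMap J (extMap u x) := by
  rw [← inj_empty, inj_leafMap, inj_empty, mapLeaf_id]

lemma leafMap_mem [Finite I] {d : ℤ} (x : detSpecies.obj d I) : leafMap I (detVal d I x) ∈ nSub d I := by
  rcases det_eq_zero_or x with rfl | ⟨h0, hd⟩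
  · rw [map_zero, map_zero]; exact zero_mem _
  obtain ⟨c, rfl⟩ := exists_smul_detTop h0 hd (Finite.equivFin I).symm x
  rw [map_smul, map_smul, detVal_detTop, leafMap_vol]
  refine Submodule.smul_mem _ _ ?_
  rw [nSub, if_pos (by omega)]
  refine Submodule.subset_span ⟨List.ofFn fun k => Sum.inl (BinTree.leaf
    ((Finite.equivFin I).symm k)), ?_, ?_, ?_⟩
  · rw [List.length_ofFn, hd]
  · rw [List.map_ofFn, List.sum_ofFn, ← full_map (Finite.equivFin I).symm, full_eq,
      Multiset.map_map, ← Multiset.sum_map_singleton (Multiset.map _ _), Multiset.map_map,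
      Finset.sum_eq_multiset_sum]
    congr 2
  · rw [List.map_ofFn]; rfl

/-- The inclusion of products of leaves. -/
def detN : Hom detSpecies nSpecies where
  app d I _ := ((leafMap I).toLinearMap ∘ₗ detVal d I).codRestrict (nSub d I) leafMap_mem
  naturality d I _ _ _ u x := nVal_injective (mapLeaf_leafMap u (detVal d I x)).symm

lemma nVal_detN [Finite I] {d : ℤ} (x : detSpecies.obj d I) :
    nVal (detN.app d I x) = leafMap I (detVal d I x) := rfl

lemma detN_injective (d : ℤ) (I : Type) [Finite I] : Function.Injective (detN.app d I) := by
  intro x y h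
  exact detVal_injective (leafMap_injective (congrArg nVal h))

lemma detN_one : detN.app 0 Unit Det.one = nOne := by
  apply nVal_injective
  exact leafMap_single ()

lemma subst_vol [Finite K] {n : ℕ} (X : K → OddLam I Θ) (o : Fin n → K) :
    subst X Empty.elim (leafMap K (vol o)) = (List.ofFn fun k => (X (o k)).1).prod := by
  rw [leafMap_vol, map_list_prod, List.map_ofFn]
  congr 2
  funext k
  exact subst_tree _ _ _

/-- The left side is the sign for separating parameters of parity `d i` from inputs of parity `d i +
1`. The terms `d i * d j` form the symmetric function in `epsSign`, the terms `d i` add up to `∑ k *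
d k`; with `e = n - 1` the latter differs from the sign of `Det` by `e * ∑ d`, the other part of
`epsSign`. The definition of `epsSign` is dictated by this comparison. -/
lemma detN_sign {n : ℕ} {e : ℤ} (he : e + 1 = n) (d : Fin n → ℤ) :
    (∏ i, ∏ j, if j < i then (d i * (d j + 1)).negOnePow else 1) =
      epsSign e d * (∑ k : Fin n, ((n : ℤ) - 1 - k) * d k).negOnePow := by
  have h1 : ∀ i j, (if j < i then (d i * (d j + 1)).negOnePow else 1) =
      (if j < i then (d i * d j).negOnePow else 1) * (if j < i then (d i).negOnePow else 1) := by
    intro i j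
    split_ifs
    · rw [← Int.negOnePow_add]; congr 1; ring
    · rw [one_mul]
  simp only [h1, Finset.prod_mul_distrib]
  rw [prod_ite_negOnePow]
  have h2 : ∀ i : Fin n, (∏ j, if j < i then (d i).negOnePow else 1) = ((i : ℤ) * d i).negOnePow := by
    intro i
    rw [← Finset.prod_filter, prod_negOnePow (d := fun _ => d i), Finset.sum_const,
      Finset.filter_gt_eq_Iio, Fin.card_Iio, nsmul_eq_mul]
  rw [Finset.prod_congr rfl fun i _ => h2 i, prod_negOnePow, epsSign, ← Int.negOnePow_add,
    ← Int.negOnePow_add, Int.negOnePow_eq_iff]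
  refine ⟨-(e * ∑ k, d k) + ∑ k : Fin n, (k : ℤ) * d k, ?_⟩
  have h3 : ∑ k : Fin n, ((n : ℤ) - 1 - k) * d k = e * ∑ k, d k - ∑ k : Fin n, (k : ℤ) * d k := by
    rw [Finset.mul_sum, ← Finset.sum_sub_distrib]
    refine Finset.sum_congr rfl fun k _ => ?_
    rw [← he]; ring
  rw [h3]
  ring

lemma det_γ_inc [Finite I] {D : ℤ} (x : CompIdx D I) (t : CompSummand detSpecies detSpecies x) :
    detOperadComp.app D I (CompObj.inc detSpecies detSpecies x t) = detComp x t :=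
  Comp.lift_app_inc _ _ _ x t

/-- Since `Det` is a line in each arity, `p` may be taken to be the product of the leaves in order.
Substitution turns it into the ordered product of the `θ_k q_k`, and separating the parameters from
the inputs leaves the exterior product of the inputs. -/
lemma detN_intertwines : Intertwines nγ detN detN detN Det.γ := by
  apply intertwines_of_mk
  intro I _ n f e D d h p q
  symm
  apply nγ_eq
  change subst (arg _ fun k => detN.app _ _ (q k)) _ _ = _ • (_ * inj _ (nVal (detN.app D I
    (detOperadComp.app D I _))))
  let x : CompIdx D I := ⟨n, f, e, d, h⟩
  have hx : Comp.mk f h p q = CompObj.inc _ _ x (p ⊗ₜ[ℚ] PiTensorProduct.tprod ℚ q) :=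
    (CompObj.inc_eq_mk x p q).symm
  rw [hx, det_γ_inc, nVal_detN, nVal_detN, detVal_detComp, detCompVal_tmul]
  have pθ := parFam_stdPar (I := I) (fun k : Fin n => k) d
  set θ : Fin n → Lam I (Fin n) := stdPar (fun k => k) d with hθ
  rcases det_eq_zero_or p with rfl | ⟨h0, he⟩
  · rw [map_zero, map_zero, map_zero, map_zero, zero_smul, smul_zero, map_zero, map_zero, mul_zero,
      smul_zero]
  rw [Nat.card_fin] at h0 he
  obtain ⟨c, rfl⟩ := exists_smul_detTop h0 he (Equiv.refl (Fin n)) p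
  have hsub : subst (arg θ fun k => detN.app _ _ (q k)) Empty.elim
      (leafMap (Fin n) (vol (Equiv.refl (Fin n)))) =
      oprod fun k => θ k * inj (fun i => i) (leafMap I (extMap Subtype.val (detVal _ _ (q k)))) := by
    rw [subst_vol, oprod_fin]
    congr 2
    funext k
    change (arg θ _ k).1 = _
    rw [arg_val pθ, nVal_detN, inj_leafMap]
  have hpar : ∀ k, HasPar (d k + 1) (inj (fun i => i) (leafMap I (extMap Subtype.val
      (detVal _ _ (q k)))) : Lam I (Fin n)) := by
    intro k
    rw [← inj_leafMap, ← nVal_detN]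
    exact (hasPar_nVal _).map _ (subst_ι_mem _ _)
  have hv : volCoeff n (vol (Equiv.refl (Fin n))) = 1 := volCoeff_vol n
  have hprod : (oprod fun k => (inj (fun i => i) (leafMap I (extMap Subtype.val
      (detVal _ _ (q k)))) : Lam I (Fin n))) = inj (fun i => i) (leafMap I (List.ofFn fun k =>
        extMap Subtype.val (detVal (d k) {i // f i = k} (q k))).prod) := by
    rw [map_list_prod, map_list_prod, List.map_ofFn, List.map_ofFn, oprod_fin]
    rfl
  have hc : volCoeff x.n (detVal e (Fin n) (c • detTop h0 he (Equiv.refl (Fin n)))) = c := by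
    rw [map_smul, detVal_detTop]
    change volCoeff n (c • vol (Equiv.refl (Fin n))) = c
    rw [map_smul, hv, smul_eq_mul, mul_one]
  rw [hc, map_smul, map_smul, map_smul, detVal_detTop, hsub,
    oprod_mul _ _ d (fun k => d k + 1) (fun i j => (pθ i).1.comm (hpar j)), detN_sign he d, hprod]
  change _ = epsSign e d • (oprod θ * inj (fun i => i) (leafMap I
    ((∑ k : Fin n, ((n : ℤ) - 1 - k) * d k).negOnePow • c • (List.ofFn fun k =>
        extMap Subtype.val (detVal (d k) {i // f i = k} (q k))).prod)))
  rw [Units.smul_def (∑ k : Fin n, ((n : ℤ) - 1 - k) * d k).negOnePow (c • _), map_zsmul, map_zsmul,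
    ← Units.smul_def, map_smul, map_smul, mul_smul_comm, mul_smul_comm, mul_smul,
    smul_comm c, smul_comm c]

lemma det_isOperad : Det.IsOperad :=
  OperadData.isOperad_of_injective nOperad_isOperad detN detN_injective detN_one detN_intertwines

end

end BOperad

namespace BOperad

noncomputable section

variable {I J K L Θ : Type}

/-! ### The underlying species of `Det ∘ Gri` -/

/-- The map from the composite product to the products of trees. -/
def compN : Hom (Comp detSpecies griSpecies) nSpecies := nγ.comp (Comp.map detN griN)

lemma compN_mk [Finite I] [Fintype K] [LinearOrder K] (f : I → K) {e D : ℤ} {d : K → ℤ}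
    (h : e + ∑ k, d k = D) (p : detSpecies.obj e K) (q : ∀ k, griSpecies.obj (d k) {i // f i = k}) :
    compN.app D I (Comp.mk f h p q) =
      nγ.app D I (Comp.mk f h (detN.app _ _ p) fun k => griN.app _ _ (q k)) :=
  congrArg (nγ.app D I) (Comp.map_app_mk detN griN f h p q)

/-! ### Ordered partitions into trees, and the inverse of `compN` in a fixed degree. -/

section Top

variable [Finite I] {n : ℕ} {D : ℤ} (hn : 0 < n) (hD : D + 1 = n)

/-- The element of the composite product given by an ordered partition with a tree on each block. -/
def TreeDec.elt (x : TreeDec n I) : (Comp detSpecies griSpecies).obj D I :=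
  Comp.mk x.f (e := D) (d := fun _ => 0) (by simp) (detTop hn hD (Equiv.refl (Fin n)))
    fun k => griTree (x.T k)

lemma nVal_compN_elt (x : TreeDec n I) :
    nVal (compN.app D I (x.elt hn hD)) =
      (List.ofFn fun k => (tree (x.val k) : Lam I Empty)).prod := by
  rw [TreeDec.elt, compN_mk, nγ_trees, nVal_detN, detVal_detTop, subst_vol]
  rfl

lemma detTop_swap {a b : Fin n} (hab : a ≠ b) :
    detSpecies.map D (Equiv.swap a b) (detTop hn hD (Equiv.refl (Fin n))) =
      - detTop hn hD (Equiv.refl (Fin n)) := by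
  obtain ⟨c, hc⟩ := exists_smul_detTop hn hD (Equiv.refl (Fin n))
    (detSpecies.map D (Equiv.swap a b) (detTop hn hD (Equiv.refl (Fin n))))
  have h1 := congrArg (fun x => volCoeff n (detVal _ _ x)) hc
  simp only [detVal_map, map_smul] at h1
  rw [volCoeff_swap _ _ _ hab] at h1
  have h2 : volCoeff n (detVal D (Fin n) (detTop hn hD (Equiv.refl (Fin n)))) = 1 := volCoeff_vol n
  rw [h2, smul_eq_mul, mul_one] at h1
  rw [hc, ← h1, neg_smul, one_smul]

/-- Exchange of two blocks. -/
def TreeDec.swap (x : TreeDec n I) (a b : Fin n) : TreeDec n I where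
  f i := Equiv.swap a b (x.f i)
  T k := (x.T (Equiv.swap a b k)).map (Equiv.subtypeEquivRight fun i => by
    rw [← Equiv.eq_symm_apply (Equiv.swap a b), Equiv.symm_swap])

lemma TreeDec.swap_val (x : TreeDec n I) (a b : Fin n) :
    (x.swap a b).val = x.val ∘ Equiv.swap a b := by
  funext k
  simp only [TreeDec.val, TreeDec.swap, LTree.map, BinTree.relabel, BinTree.graft_graft,
    BinTree.graft_leaf, Function.comp_apply]
  rfl

/-- Trees have degree `0`, so exchanging two of them costs no Koszul sign. The sign comes from the
top exterior form that indexes the blocks. -/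
lemma TreeDec.swap_elt (x : TreeDec n I) {a b : Fin n} (hab : a ≠ b) :
    (x.swap a b).elt hn hD = - x.elt hn hD := by
  obtain ⟨ε, -, hε, H⟩ := Comp.mk_relabel (Equiv.swap a b) (fun _ : Fin n => (0 : ℤ))
  have h := H (P := detSpecies) (Q := griSpecies) (I := I) (f := x.f) (f' := (x.swap a b).f)
    (fun _ => rfl) (e := D) (D := D) (by simp) (by simp) (detTop hn hD (Equiv.refl (Fin n)))
    (fun k => griTree (x.T k)) (fun k => griTree ((x.swap a b).T k)) (fun k => by
      rw [griSpecies_map_griTree]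
      congr 1
      have : ∀ k' (h : k' = k), (x.T k').map (Equiv.subtypeEquivRight fun i => by
          rw [h, ← (Equiv.swap a b).apply_eq_iff_eq]; rfl) = (x.T k).map
          (Equiv.subtypeEquivRight fun i => by rw [← (Equiv.swap a b).apply_eq_iff_eq]; rfl :
            {i // x.f i = k} ≃ {i // (x.swap a b).f i = Equiv.swap a b k}) := by
        rintro _ rfl; rfl
      exact this _ (Equiv.swap_apply_self a b k))
  rw [hε (by simp), one_smul, detTop_swap hn hD hab] at h
  rw [TreeDec.elt, TreeDec.elt, ← h]
  have h2 := (Comp.mkL (P := detSpecies) (Q := griSpecies) (x.swap a b).f (e := D) (D := D)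
    (d := fun _ => 0) (by simp) (fun k => griTree ((x.swap a b).T k))).map_neg
    (detTop hn hD (Equiv.refl (Fin n)))
  simp only [Comp.mkL_apply] at h2
  rw [h2, neg_neg]

open Classical in
/-- The element of the composite product corresponding to a product of trees. -/
def treesElt (l : Fin n → BinTree I) : (Comp detSpecies griSpecies).obj D I :=
  if h : ∃ x : TreeDec n I, x.val = l then h.choose.elt hn hD else 0

lemma treesElt_val (x : TreeDec n I) : treesElt hn hD x.val = x.elt hn hD := by
  have h : ∃ y : TreeDec n I, y.val = x.val := ⟨x, rfl⟩
  rw [treesElt, dif_pos h, TreeDec.val_injective h.choose_spec]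

lemma treesElt_swap (l : Fin n → BinTree I) {a b : Fin n} (hab : a ≠ b) :
    treesElt hn hD (l ∘ Equiv.swap a b) = - treesElt hn hD l := by
  by_cases h : ∃ x : TreeDec n I, x.val = l
  · obtain ⟨x, rfl⟩ := h
    rw [← x.swap_val, treesElt_val, treesElt_val, x.swap_elt hn hD hab]
  · have h' : ¬ ∃ x : TreeDec n I, x.val = l ∘ Equiv.swap a b := by
      rintro ⟨x, hx⟩
      refine h ⟨x.swap a b, ?_⟩
      rw [x.swap_val, hx]
      funext k
      simp
    rw [treesElt, dif_neg h', treesElt, dif_neg h, neg_zero]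

open Classical in
/-- The multilinear extension of `treesElt`. -/
def treesMulti : MultilinearMap ℚ (fun _ : Fin n => GenSp I Empty)
    ((Comp detSpecies griSpecies).obj D I) :=
  (Finsupp.linearCombination ℚ (fun g : Fin n → BinTree I ⊕ Empty =>
    treesElt hn hD fun k => Sum.elim id Empty.elim (g k)) ∘ₗ
    (PiTensorProduct.ofFinsuppEquiv' (R := ℚ) (κ := fun _ : Fin n => BinTree I ⊕ Empty)).toLinearMap).compMultilinearMap
      (PiTensorProduct.tprod ℚ)

lemma treesMulti_single (g : Fin n → BinTree I ⊕ Empty) :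
    treesMulti hn hD (fun k => Finsupp.single (g k) 1) =
      treesElt hn hD fun k => Sum.elim id Empty.elim (g k) := by
  classical
  simp only [treesMulti, LinearMap.compMultilinearMap_apply, LinearMap.comp_apply,
    LinearEquiv.coe_coe]
  rw [PiTensorProduct.ofFinsuppEquiv'_tprod_single, Finsupp.linearCombination_single,
    Finset.prod_const_one, one_smul]

lemma treesMulti_swap (v : Fin n → GenSp I Empty) {a b : Fin n} (hab : a ≠ b) :
    treesMulti hn hD (v ∘ Equiv.swap a b) = - treesMulti hn hD v := by
  have : (treesMulti (I := I) hn hD).domDomCongr (Equiv.swap a b) = - treesMulti hn hD := by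
    apply Module.Basis.ext_multilinear (fun _ => Finsupp.basisSingleOne (R := ℚ)
      (ι := BinTree I ⊕ Empty))
    intro g
    simp only [Finsupp.coe_basisSingleOne, MultilinearMap.domDomCongr_apply,
      neg_apply]
    rw [treesMulti_single hn hD g, treesMulti_single hn hD fun k => g (Equiv.swap a b k)]
    exact treesElt_swap hn hD (fun k => Sum.elim id Empty.elim (g k)) hab
  exact congrArg (fun M => M v) this

/-- The alternating extension of `treesElt`. -/
def treesAlt : (GenSp I Empty) [⋀^Fin n]→ₗ[ℚ] (Comp detSpecies griSpecies).obj D I where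
  __ := treesMulti hn hD
  map_eq_zero_of_eq' v a b hv hab := by
    have h := treesMulti_swap hn hD v hab
    have h2 : v ∘ Equiv.swap a b = v := by
      funext k
      rw [Function.comp_apply, Equiv.swap_apply_def]
      split_ifs with h h'
      · rw [h, hv]
      · rw [h', hv]
      · rfl
    rw [h2] at h
    have h3 : (2 : ℚ) • treesMulti hn hD v = 0 := by
      rw [two_smul]
      nth_rewrite 1 [h]
      exact neg_add_cancel _
    exact (smul_eq_zero.1 h3).resolve_left two_ne_zero

lemma treesAlt_apply (v : Fin n → GenSp I Empty) : treesAlt hn hD v = treesMulti hn hD v := rfl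

/-- The inverse of `compN`. -/
def compNInv : Lam I Empty →ₗ[ℚ] (Comp detSpecies griSpecies).obj D I :=
  ExteriorAlgebra.liftAlternating
    (Pi.single (M := fun i => (GenSp I Empty) [⋀^Fin i]→ₗ[ℚ] _) n (treesAlt hn hD))

lemma compNInv_elt (x : TreeDec n I) :
    compNInv hn hD (nVal (compN.app D I (x.elt hn hD))) = x.elt hn hD := by
  have h : (List.ofFn fun k => (tree (x.val k) : Lam I Empty)).prod =
      ExteriorAlgebra.ιMulti ℚ n fun k => Finsupp.single (Sum.inl (x.val k)) 1 :=
    (ExteriorAlgebra.ιMulti_apply _).symm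
  rw [nVal_compN_elt, h, compNInv, ExteriorAlgebra.liftAlternating_apply_ιMulti, Pi.single_eq_same,
    treesAlt_apply, treesMulti_single hn hD fun k => Sum.inl (x.val k)]
  exact treesElt_val hn hD x

end Top

lemma comp_gri_ext [Finite I] {P : GrSpecies} {D : ℤ} {M : Type} [AddCommGroup M] [Module ℚ M]
    {F G : (Comp P griSpecies).obj D I →ₗ[ℚ] M}
    (H : ∀ {n : ℕ} (f : I → Fin n) {e : ℤ} {d : Fin n → ℤ} (h : e + ∑ k, d k = D)
      (p : P.obj e (Fin n)) (T : ∀ k, LTree (d k) {i // f i = k}),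
      F (Comp.mk f h p fun k => griTree (T k)) = G (Comp.mk f h p fun k => griTree (T k))) :
    F = G := by
  refine CompObj.hom_ext fun x p q => ?_
  rw [CompObj.inc_eq_mk]
  have : F.compMultilinearMap (Comp.mkM x.f x.deg p) = G.compMultilinearMap (Comp.mkM x.f x.deg p) := by
    apply Module.Basis.ext_multilinear (fun k => Finsupp.basisSingleOne (R := ℚ)
      (ι := LTree (x.d k) {i // x.f i = k}))
    intro S
    simp only [Finsupp.coe_basisSingleOne]
    change F (Comp.mkM x.f x.deg p _) = G (Comp.mkM x.f x.deg p _)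
    refine (congrArg _ (Comp.mkM_apply x.f x.deg p _)).trans
      (Eq.trans ?_ (congrArg _ (Comp.mkM_apply x.f x.deg p _)).symm)
    exact H x.f x.deg p S
  have := congrArg (fun T => T q) this
  exact (congrArg F (Comp.mkM_apply x.f x.deg p q)).symm.trans
    (this.trans (congrArg G (Comp.mkM_apply x.f x.deg p q)))

/-- Only trees of degree `0` occur and `Det` is a line concentrated in degree `n - 1`, so in degree
`D` the only generators are ordered partitions into `n = D + 1` blocks with a tree on each. -/
lemma det_gri_ext [Finite I] {D : ℤ} {M : Type} [AddCommGroup M] [Module ℚ M]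
    {F G : (Comp detSpecies griSpecies).obj D I →ₗ[ℚ] M}
    (H : ∀ {n : ℕ} (hn : 0 < n) (hD : D + 1 = n) (x : TreeDec n I),
      F (x.elt hn hD) = G (x.elt hn hD)) : F = G := by
  apply comp_gri_ext
  intro n f e d h p T
  obtain rfl : d = fun _ => 0 := funext fun k => (T k).2.2.2
  obtain rfl : e = D := by simpa using h
  rcases det_eq_zero_or p with rfl | ⟨hn, he⟩
  · rw [← Comp.mkL_apply, map_zero, map_zero, map_zero]
  · rw [Nat.card_fin] at hn he
    obtain ⟨c, rfl⟩ := exists_smul_detTop hn he (Equiv.refl (Fin n)) p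
    rw [← Comp.mkL_apply, map_smul, map_smul, map_smul]
    congr 1
    exact H hn he ⟨f, T⟩

/-- A left inverse exists: the generator attached to an ordered partition into trees changes sign
under exchange of two blocks, so it extends to an alternating map on `D + 1` vectors and hence to
the exterior algebra. -/
lemma compN_injective (D : ℤ) (I : Type) [Finite I] : Function.Injective (compN.app D I) := by
  by_cases hD : 0 ≤ D
  · obtain ⟨m, rfl⟩ := Int.eq_ofNat_of_zero_le hD
    have h : compNInv (I := I) (n := m + 1) (D := m) (Nat.succ_pos m) (by simp) ∘ₗ nVal ∘ₗ
        compN.app m I = LinearMap.id := by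
      apply det_gri_ext
      intro n hn hD' x
      obtain rfl : n = m + 1 := by omega
      exact compNInv_elt _ _ x
    intro x y hxy
    have h1 := LinearMap.congr_fun h x
    have h2 := LinearMap.congr_fun h y
    simp only [LinearMap.comp_apply, LinearMap.id_apply] at h1 h2
    rw [← h1, hxy, h2]
  · have h : (LinearMap.id : (Comp detSpecies griSpecies).obj D I →ₗ[ℚ] _) = 0 := by
      apply det_gri_ext
      -- In negative degree there are no generators, since `D + 1 = n > 0` is impossible.
      intro n hn hD' x
      omega
    intro x y _
    exact (LinearMap.congr_fun h x).trans (LinearMap.congr_fun h y).symm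

/-- A product of trees of full weight uses each label once, so its factors form an ordered partition
of `I` with a tree on each block. -/
lemma compN_surjective (D : ℤ) (I : Type) [Finite I] : Function.Surjective (compN.app D I) := by
  intro y
  by_cases hD : 0 ≤ D
  swap
  · exact ⟨0, by rw [map_zero, eq_zero_of_neg hD y]⟩
  have key : nVal y ∈ LinearMap.range (nVal ∘ₗ compN.app D I) := by
    have := wspan_linear (LinearMap.range (nVal ∘ₗ compN.app D I)) LinearMap.id ?_ (nVal_mem_wspan y)
    · exact this
    intro l hl hw
    obtain ⟨n, g, rfl⟩ : ∃ (n : ℕ) (g : Fin n → BinTree I ⊕ Empty), l = List.ofFn g :=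
      ⟨_, _, (List.ofFn_get l).symm⟩
    rw [List.length_ofFn] at hl
    have hn : 0 < n := by omega
    obtain ⟨t, rfl⟩ : ∃ t : Fin n → BinTree I, g = fun k => Sum.inl (t k) := by
      have hg : ∀ w : BinTree I ⊕ Empty, w = Sum.inl (Sum.elim id Empty.elim w) := by
        rintro (s | s)
        · rfl
        · exact s.elim
      exact ⟨fun k => Sum.elim id Empty.elim (g k), funext fun k => hg _⟩
    have hsum : ∑ k, (t k).leaves = full I := by
      have h1 : (∑ k, (t k).leaves).map (Sum.inl : I → I ⊕ Empty) = (full I).map Sum.inl := by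
        rw [← hw, List.map_ofFn, List.sum_ofFn]
        exact map_sum (Multiset.mapAddMonoidHom Sum.inl) _ _
      exact Multiset.map_injective Sum.inl_injective h1
    obtain ⟨x, hx⟩ := TreeDec.exists_val hsum
    refine ⟨x.elt hn hl.symm, ?_⟩
    rw [LinearMap.comp_apply, nVal_compN_elt, LinearMap.id_apply, hx, List.map_ofFn]
    rfl
  obtain ⟨x, hx⟩ := key
  exact ⟨x, nVal_injective hx⟩

lemma compN_bijective (D : ℤ) (I : Type) [Finite I] : Function.Bijective (compN.app D I) :=
  ⟨compN_injective D I, compN_surjective D I⟩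

end

end BOperad

namespace BOperad

noncomputable section

/-! ### The distributive law and the operad on `Det ∘ Gri`, transported from the model. -/

variable {P Q R X Y Z N : GrSpecies} {I J K L : Type}

/-- The inverse of a bijective morphism. -/
def Hom.inv (j : Hom X Y) (hj : ∀ (D : ℤ) (I : Type) [Finite I], Function.Bijective (j.app D I)) :
    Hom Y X where
  app D I _ := (LinearEquiv.ofBijective (j.app D I) (hj D I)).symm.toLinearMap
  naturality D I J _ _ u y := by
    apply (hj D J).1
    rw [j.naturality]
    refine ((LinearEquiv.ofBijective (j.app D J) (hj D J)).apply_symm_apply _).trans ?_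
    exact congrArg _ ((LinearEquiv.ofBijective (j.app D I) (hj D I)).apply_symm_apply _).symm

lemma Hom.app_inv (j : Hom X Y) (hj) (D : ℤ) (I : Type) [Finite I] (y : Y.obj D I) :
    j.app D I ((j.inv hj).app D I y) = y :=
  (LinearEquiv.ofBijective (j.app D I) (hj D I)).apply_symm_apply y

/-- The composition `j⁻¹ γ (a ∘ b)`. -/
def pull (a : Hom P nSpecies) (b : Hom Q nSpecies) :
    Hom (Comp P Q) (Comp detSpecies griSpecies) :=
  (compN.inv compN_bijective).comp (nγ.comp (Comp.map a b))

lemma pull_intertwines (a : Hom P nSpecies) (b : Hom Q nSpecies) :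
    Intertwines nγ a b compN (pull a b) := fun D I _ _ =>
  compN.app_inv compN_bijective D I _

lemma compN_intertwines :
    Intertwines nγ detN griN compN (Hom.id (Comp detSpecies griSpecies)) := fun _ _ _ _ => rfl

lemma compN_insL_one [Finite I] {d : ℤ} (y : griSpecies.obj d I) :
    compN.app d I (insL Det.one y) = griN.app d I y := by
  refine (compN_mk _ _ _ _).trans (Eq.trans ?_ (nγ_one_comp _))
  rw [insL]
  rw [detN_one]
  congr 2
  funext k
  exact griN.naturality _ _ _

lemma compN_insR_one [Fintype K] [LinearOrder K] {d : ℤ} (x : detSpecies.obj d K) :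
    compN.app d K (insR Gri.one x) = detN.app d K x := by
  refine (compN_mk _ _ _ _).trans (Eq.trans ?_ (nγ_comp_one _))
  rw [insR]
  congr 2
  funext k
  rw [← griN_one]
  exact griN.naturality _ _ _

/-- This statement and the six that follow it are all the associativity of `nγ`, for three arguments
taken among `detN`, `griN` and `compN` and seen through the injection `compN`. They differ only in
the choice of the three. -/
lemma tree_R : Interchange (Hom.id (Comp detSpecies griSpecies)) (pull compN griN)
    (griOperadComp) (Hom.id (Comp detSpecies griSpecies)) :=
  Interchange.of_injective nγ_assoc (a := detN) (b := griN) (c := griN) (x := compN) (y := compN)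
    (z := griN) compN_injective compN_intertwines (pull_intertwines _ _)
    griN_intertwines compN_intertwines

lemma tree_L : Interchange (detOperadComp) (Hom.id (Comp detSpecies griSpecies))
    (Hom.id (Comp detSpecies griSpecies)) (pull detN compN) :=
  Interchange.of_injective nγ_assoc (a := detN) (b := detN) (c := griN) (x := detN) (y := compN)
    (z := compN) compN_injective detN_intertwines compN_intertwines
    compN_intertwines (pull_intertwines _ _)

lemma tree_Φ : Interchange (pull griN detN) (pull compN griN)
    (Hom.id (Comp detSpecies griSpecies)) (pull griN compN) :=
  Interchange.of_injective nγ_assoc (a := griN) (b := detN) (c := griN) (x := compN) (y := compN)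
    (z := compN) compN_injective (pull_intertwines _ _) (pull_intertwines _ _)
    compN_intertwines (pull_intertwines _ _)

lemma tree_Ψ : Interchange (Hom.id (Comp detSpecies griSpecies)) (pull compN detN)
    (pull griN detN) (pull detN compN) :=
  Interchange.of_injective nγ_assoc (a := detN) (b := griN) (c := detN) (x := compN) (y := compN)
    (z := compN) compN_injective compN_intertwines (pull_intertwines _ _)
    (pull_intertwines _ _) (pull_intertwines _ _)

lemma tree_interchange_comp_left : Interchange (griOperadComp) (pull griN detN)
    (pull griN detN) (pull griN compN) :=
  Interchange.of_injective nγ_assoc (a := griN) (b := griN) (c := detN) (x := griN) (y := compN)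
    (z := compN) compN_injective griN_intertwines (pull_intertwines _ _)
    (pull_intertwines _ _) (pull_intertwines _ _)

lemma tree_interchange_comp_right : Interchange (pull griN detN) (pull compN detN)
    (detOperadComp) (pull griN detN) :=
  Interchange.of_injective nγ_assoc (a := griN) (b := detN) (c := detN) (x := compN) (y := compN)
    (z := detN) compN_injective (pull_intertwines _ _) (pull_intertwines _ _)
    detN_intertwines (pull_intertwines _ _)

lemma tree_interchange_induced : Interchange (Hom.id (Comp detSpecies griSpecies)) (pull compN compN)
    (pull griN compN) (pull detN compN) :=
  Interchange.of_injective nγ_assoc (a := detN) (b := griN) (c := compN) (x := compN) (y := compN)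
    (z := compN) compN_injective compN_intertwines (pull_intertwines _ _)
    (pull_intertwines _ _) (pull_intertwines _ _)

lemma tree_one_left {d : ℤ} [Fintype K] [LinearOrder K] (x : detSpecies.obj d K) :
    (pull griN detN).app d K (insL (P := griSpecies) Gri.one x) = insR (Q := griSpecies) Gri.one x := by
  apply compN_injective
  refine ((pull_intertwines griN detN).mk _ _ _ _).trans (Eq.trans ?_ (compN_insR_one x).symm)
  refine Eq.trans ?_ (nγ_one_comp (detN.app d K x))
  rw [insL]
  rw [griN_one]
  congr 2
  funext k
  exact detN.naturality _ _ _

lemma tree_one_right {d : ℤ} [Fintype K] [LinearOrder K] (y : griSpecies.obj d K) :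
    (pull griN detN).app d K (insR (Q := detSpecies) Det.one y) = insL (P := detSpecies) Det.one y := by
  apply compN_injective
  refine ((pull_intertwines griN detN).mk _ _ _ _).trans (Eq.trans ?_ (compN_insL_one y).symm)
  refine Eq.trans ?_ (nγ_comp_one (griN.app d K y))
  rw [insR]
  congr 2
  funext k
  rw [← detN_one]
  exact detN.naturality _ _ _

set_option maxHeartbeats 2000000 in
/-- The distributive law between `Det` and `Gri`. -/
def treeLaw : DistributiveLaw Det Gri where
  law := pull griN detN
  R := pull compN griN
  L := pull detN compN
  Φ := pull griN compN
  Ψ := pull compN detN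
  R_spec := tree_R
  L_spec := tree_L
  Φ_spec := tree_Φ
  Ψ_spec := tree_Ψ
  law_one_left := tree_one_left
  law_one_right := tree_one_right
  law_comp_left := tree_interchange_comp_left
  law_comp_right := tree_interchange_comp_right

/-- The composition of `Det ∘ Gri`. -/
def treeComp : Hom (Comp (Comp detSpecies griSpecies) (Comp detSpecies griSpecies))
    (Comp detSpecies griSpecies) := pull compN compN

lemma treeComp_isInduced : treeLaw.IsInducedComposition treeComp := tree_interchange_induced

/-- The composition is that of `N` read through `compN`, so the axioms are inherited from `N`. -/
lemma composite_isOperad : (compositeOperadData Det Gri treeComp).IsOperad :=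
  OperadData.isOperad_of_injective nOperad_isOperad compN compN_injective
    ((compN_insL_one _).trans griN_one) (pull_intertwines _ _)

/-! ### Uniqueness of the morphisms determined by an interchange -/

lemma exists_fiber_degrees [Fintype K] [Fintype L] [DecidableEq L] (g : K → L) {c s D : ℤ}
    {a : L → ℤ} {b : K → ℤ} (h₁ : c + ∑ l, a l = s) (h₂ : s + ∑ k, b k = D) :
    ∃ t : L → ℤ, (∀ l, a l + ∑ k : {k // g k = l}, b k = t l) ∧ c + ∑ l, t l = D := by
  refine ⟨_, fun l => rfl, ?_⟩
  rw [Finset.sum_add_distrib, ← add_assoc, h₁, ← h₂, ← Equiv.sum_comp (Equiv.sigmaFiberEquiv g),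
    Fintype.sum_sigma]
  rfl

/-- When `A` is the identity, the equation prescribes `B` on generators of the iterated product. The
intermediate degrees `t` that it requires always exist. -/
lemma Interchange.unique_left {A : Hom (Comp P Q) (Comp P Q)} (hA : A = Hom.id _)
    {B B' : Hom (Comp (Comp P Q) R) Y} {C : Hom (Comp Q R) Z} {E : Hom (Comp P Z) Y}
    (h : Interchange A B C E) (h' : Interchange A B' C E) : B = B' := by
  subst hA
  apply Hom.ext_left
  intro I K L _ _ _ _ _ f g hg c s D a b h₁ h₂ p q r
  obtain ⟨t, h₃, h₄⟩ := exists_fiber_degrees g h₁ h₂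
  exact (h f g hg h₁ h₂ h₃ h₄ p q r).trans (h' f g hg h₁ h₂ h₃ h₄ p q r).symm

/-- When `C` is the identity, the equation prescribes `E` on generators up to an invertible sign. -/
lemma Interchange.unique_right {A : Hom (Comp P Q) X} {B : Hom (Comp X R) Y}
    {C : Hom (Comp Q R) (Comp Q R)} (hC : C = Hom.id _) {E E' : Hom (Comp P (Comp Q R)) Y}
    (h : Interchange A B C E) (h' : Interchange A B C E') : E = E' := by
  subst hC
  apply Hom.ext_right
  intro I K L _ _ _ _ _ f g hg c D a t b h₃ h₄ p q r
  have h₂ : c + ∑ l, a l + ∑ k, b k = D := by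
    rw [← h₄, add_assoc, ← Finset.sum_congr rfl fun l _ => h₃ l, Finset.sum_add_distrib,
      ← Equiv.sum_comp (Equiv.sigmaFiberEquiv g), Fintype.sum_sigma]
    rfl
  have e1 := @h I K L _ _ _ _ _ f g hg c _ D a t b rfl h₂ h₃ h₄ p q r
  have e2 := @h' I K L _ _ _ _ _ f g hg c _ D a t b rfl h₂ h₃ h₄ p q r
  exact smul_left_cancel _ (e1.symm.trans e2)

/-- The specifications of `R` and `L` do not involve the law, and `Φ` and `Ψ` are determined by the
law together with `R` and `L`. -/
lemma DistributiveLaw.ext_of_law {P Q : OperadData} {Δ Δ' : DistributiveLaw P Q}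
    (h : Δ.law = Δ'.law) : Δ = Δ' := by
  have hR : Δ.R = Δ'.R := Interchange.unique_left rfl Δ.R_spec Δ'.R_spec
  have hL : Δ.L = Δ'.L := Interchange.unique_right rfl Δ.L_spec Δ'.L_spec
  have hΦ : Interchange Δ'.law Δ'.R (Hom.id _) Δ'.Φ := Δ'.Φ_spec
  have hΨ : Interchange (Hom.id _) Δ'.Ψ Δ'.law Δ'.L := Δ'.Ψ_spec
  rw [← h, ← hR] at hΦ
  rw [← h, ← hL] at hΨ
  exact DistributiveLaw.ext h hR hL (Interchange.unique_right rfl Δ.Φ_spec hΦ)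
    (Interchange.unique_left rfl Δ.Ψ_spec hΨ)

end

end BOperad

namespace BOperad

noncomputable section

variable {I J K L Θ : Type}

/-! ### The rewriting rule -/

lemma oprod_bool {A : Type} [Monoid A] (v : Bool → A) : oprod v = v false * v true := by
  rw [oprod, sort_eq_of_pairwise (l := [false, true]) (by simp) (by simp) (by simp)]
  simp

lemma detVal_eGen [Finite I] (i j : I) (h : IsPair i j) :
    leafMap I (detVal 1 I (eGen i j h)) =
      tree (BinTree.leaf i) * tree (BinTree.leaf j) := by
  rw [← leafMap_single, ← leafMap_single, ← map_mul]
  rfl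

lemma inj_map_eq {P : GrSpecies} (F : Hom P nSpecies) {d : ℤ} [Finite J] [Finite K] (e : K ≃ J)
    (u : J → I) (x : P.obj d K) {z : Lam K Empty} (hx : nVal (F.app d K x) = z) :
    (inj u (nVal (F.app d J (P.map d e x))) : Lam I Θ) = inj (u ∘ e) z := by
  rw [F.naturality, nVal_map, inj_mapLeaf, hx]

lemma inj_detN_one [Finite J] (e : Unit ≃ J) (u : J → I) :
    (inj u (nVal (detN.app 0 J (detSpecies.map 0 e Det.one))) : Lam I Θ) =
      tree (BinTree.leaf (u (e ()))) :=
  (inj_map_eq detN e u _ (congrArg nVal detN_one)).trans (inj_tree _ _)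

lemma inj_detN_eGen [Finite J] [Finite K] (e : K ≃ J) (u : J → I) (j k : K) (h : IsPair j k) :
    (inj u (nVal (detN.app 1 J (detSpecies.map 1 e (eGen j k h)))) : Lam I Θ) =
      tree (BinTree.leaf (u (e j))) * tree (BinTree.leaf (u (e k))) := by
  refine (inj_map_eq detN e u _ (detVal_eGen j k h)).trans ?_
  rw [map_mul, inj_tree, inj_tree]
  rfl

lemma inj_griN_one [Finite J] (e : Unit ≃ J) (u : J → I) :
    (inj u (nVal (griN.app 0 J (griSpecies.map 0 e Gri.one))) : Lam I Θ) =
      tree (BinTree.leaf (u (e ()))) :=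
  (inj_map_eq griN e u _ (congrArg nVal griN_one)).trans (inj_tree _ _)

lemma inj_griN_omegaGen [Finite J] [Finite K] (e : K ≃ J) (u : J → I) (j k : K) (h : IsPair j k) :
    (inj u (nVal (griN.app 0 J (griSpecies.map 0 e (omegaGen j k h)))) : Lam I Θ) =
      tree (BinTree.leaf (u (e j)) * BinTree.leaf (u (e k))) :=
  (inj_map_eq griN e u _ (griVal_griTree _)).trans (inj_tree _ _)

lemma nVal_nγ_pair [Finite I] (f : I → Bool) {s t : BinTree I} {d : Bool → ℤ} (h0 : d false = 0)
    (h1 : d true = 0) {e D : ℤ} (h : e + ∑ b, d b = D) {p : nSpecies.obj e Bool}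
    (hp : nVal p = tree (BinTree.leaf false) * tree (BinTree.leaf true))
    (q : ∀ b, nSpecies.obj (d b) {a // f a = b})
    (hq0 : (inj Subtype.val (nVal (q false)) : Lam I Empty) = tree s)
    (hq1 : (inj Subtype.val (nVal (q true)) : Lam I Empty) = tree t) :
    nVal (nγ.app D I (Comp.mk f h p q)) = tree s * tree t := by
  have hd : d = fun _ => 0 := by funext b; cases b <;> assumption
  have pθ : ParFam d (fun _ => 1 : Bool → Lam I Empty) := fun k => by
    rw [hd]; exact ⟨hasPar_one, isConst_one⟩
  have hm := subst_arg_mk (Θ := Empty) f h p q pθ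
  have h1 : epsSign e d = 1 := by
    rw [hd, epsSign, esymm₂_zero]; simp
  rw [h1, one_smul, oprod_one, one_mul, inj_empty, mapLeaf_id] at hm
  rw [← hm, hp, map_mul, subst_tree, subst_tree, ev_leaf, ev_leaf, arg_val pθ, arg_val pθ, hq0, hq1,
    one_mul, one_mul]

lemma nVal_compN_twoStep [Finite I] {i j k : I} {hi : i ≠ j} {hk : k ≠ j}
    (h : IsPair (⟨i, hi⟩ : {a // a ≠ j}) ⟨k, hk⟩) :
    nVal (compN.app 1 I (twoStep (P := detSpecies) (Q := griSpecies) Gri.one (add_zero 1) j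
      (eGen false true isPair_bool) (omegaGen ⟨i, hi⟩ ⟨k, hk⟩ h))) =
      tree (BinTree.leaf j) * tree (BinTree.leaf i * BinTree.leaf k) :=
  (congrArg nVal (compN_mk _ _ _ _)).trans (nVal_nγ_pair _ rfl rfl _ (detVal_eGen _ _ isPair_bool) _
    (inj_griN_one _ _) (inj_griN_omegaGen _ _ _ _ h))

lemma epsSign_bool (d : Bool → ℤ) (h : d false = 0) : epsSign 0 d = 1 := by
  simp [epsSign, esymm₂, h]

/-- The Leibniz rule for `{i, θ j k}`, where the parameter `θ` comes out because the bracket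
annihilates it. The two terms are `θ {i, j} k` and `θ j {i, k}`. -/
lemma nγ_node [Finite I] (f : I → Bool) {i j k : I} {d : Bool → ℤ} (h0 : d false = 0) {D : ℤ} (h : 0 + ∑ b, d b = D)
    (q : ∀ b, nSpecies.obj (d b) {a // f a = b})
    (hq0 : (inj Subtype.val (nVal (q false)) : Lam I Bool) = tree (BinTree.leaf i))
    (hq1 : (inj Subtype.val (nVal (q true)) : Lam I Bool) =
      tree (BinTree.leaf j) * tree (BinTree.leaf k)) {y : nSpecies.obj D I}
    (hy : nVal y = tree (BinTree.leaf j) * tree (BinTree.leaf i * BinTree.leaf k) -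
      tree (BinTree.leaf k) * tree (BinTree.leaf i * BinTree.leaf j)) :
    nγ.app D I (Comp.mk f h (griN.app 0 Bool (omegaGen false true isPair_bool)) q) = y := by
  refine nγ_eq _ _ _ _ ?_
  have pθ := parFam_stdPar (I := I) (fun b : Bool => b) d
  set X := arg (stdPar (fun b : Bool => b) d) q with hX
  have hs0 : (stdPar (fun b : Bool => b) d false : Lam I Bool) = 1 := by simp [stdPar, h0]
  have e0 : X false = treeO (BinTree.leaf i) := by
    apply Subtype.ext
    rw [hX, arg_val pθ, hq0, hs0, one_mul]
    rfl
  have e1 : (X true).1 = stdPar (fun b : Bool => b) d true *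
      (tree (BinTree.leaf j) * tree (BinTree.leaf k)) := by
    rw [hX, arg_val pθ, hq1]
  have hω : nVal (griN.app 0 Bool (omegaGen false true isPair_bool)) =
      tree (BinTree.leaf false * BinTree.leaf true) := griVal_griTree _
  have hbr : ∀ s t : BinTree I, brDer (join I Bool) (treeO s) (tree t) = tree (t * s) := fun s t =>
    (congrArg Subtype.val (treeO_mul (Θ := Bool) t s)).symm
  rw [hω, subst_tree, ev_mul, ev_leaf, ev_leaf, mul_comm, oddLam_mul, br_val, e1, e0, brDer_mul,
    (pθ true).2, zero_mul, zero_add, brDer_mul, hbr, hbr, epsSign_bool d h0, one_smul, oprod_bool,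
    hs0, one_mul, hy, map_sub, map_mul, map_mul]
  simp only [inj_tree]
  have hr : ∀ t : BinTree I, t.relabel (fun i => i) = t := BinTree.graft_leaf_right
  simp only [hr]
  -- The minus sign of the rule: two odd trees anticommute.
  have ha : (tree (BinTree.leaf k) * tree (BinTree.leaf i * BinTree.leaf j) : Lam I Bool) =
      -(tree (BinTree.leaf i * BinTree.leaf j) * tree (BinTree.leaf k)) :=
    odd_anticomm (lamGen_mem _) (lamGen_mem _)
  rw [ha, sub_neg_eq_add, mul_comm (BinTree.leaf j), mul_comm (BinTree.leaf k), add_comm]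

lemma extendsRule_treeLaw : ExtendsRule treeLaw.law := by
  intro I _ i j k h
  apply compN_injective
  refine ((pull_intertwines griN detN).mk _ _ _ _).trans ?_
  refine nγ_node (i := i) (j := j) (k := k) _ rfl _ _ ?_ ?_ ?_
  · exact inj_detN_one _ _
  · exact inj_detN_eGen _ _ _ _ h.pair₁
  · exact (map_sub (nVal ∘ₗ compN.app 1 I) _ _).trans
      (congrArg₂ (· - ·) (nVal_compN_twoStep h.pair₂) (nVal_compN_twoStep h.pair₃))

end

end BOperad

namespace BOperad

noncomputable section

variable {I J K L Θ : Type}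

/-! ### Composites of generators of `Det` -/

/-- The product of the basis vectors in a list. -/
def volList (l : List I) : ExteriorAlgebra ℚ (I →₀ ℚ) :=
  (l.map fun i => ExteriorAlgebra.ι ℚ (Finsupp.single i 1)).prod

lemma vol_eq_volList {n : ℕ} (o : Fin n → I) : vol o = volList (List.ofFn o) := by
  rw [vol, volList, List.map_ofFn]; rfl

lemma volList_flatten (ls : List (List I)) : volList ls.flatten = (ls.map volList).prod := by
  rw [volList, List.map_flatten, List.prod_flatten, List.map_map]; rfl

lemma volList_ne_zero {l : List I} (h : l.Nodup) (h' : ∀ i, i ∈ l) : volList l ≠ 0 := by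
  classical
  have := vol_ne_zero (h.getEquivOfForallMemList l h')
  rw [vol_eq_volList] at this
  convert this
  exact (List.ofFn_get l).symm

lemma exists_smul_of_ne_zero [Finite I] {d : ℤ} {y : detSpecies.obj d I} (hy : y ≠ 0)
    (x : detSpecies.obj d I) : ∃ c : ℚ, x = c • y := by
  obtain ⟨h0, hd⟩ := (det_eq_zero_or y).resolve_left hy
  obtain ⟨a, rfl⟩ := exists_smul_detTop h0 hd (Finite.equivFin I).symm y
  obtain ⟨b, rfl⟩ := exists_smul_detTop h0 hd (Finite.equivFin I).symm x
  have ha : a ≠ 0 := fun h => hy (by rw [h, zero_smul])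
  exact ⟨b / a, by rw [smul_smul, div_mul_cancel₀ _ ha]⟩

lemma exists_det_ne_zero [Finite I] [Nonempty I] :
    ∃ x : Det.obj (Nat.card I - 1) I, x ≠ 0 := by
  refine ⟨detTop (n := Nat.card I) Nat.card_pos (by ring) (Finite.equivFin I).symm, fun h => ?_⟩
  exact vol_ne_zero (Finite.equivFin I).symm (congrArg (detVal _ I) h)

lemma volCoeff_detVal_ne_zero {n : ℕ} {e : ℤ} {p : detSpecies.obj e (Fin n)} (hp : p ≠ 0) :
    volCoeff n (detVal e (Fin n) p) ≠ 0 := by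
  intro h
  rcases detVal_cases p with ⟨-, -, h1⟩ | h1
  · rw [Nat.card_fin] at h1
    have := eq_volCoeff_smul_vol h1
    rw [h, zero_smul] at this
    exact hp (detVal_injective this)
  · exact hp (detVal_injective h1)

/-- Up to a nonzero scalar the composite is the product of the basis vectors in the concatenation of
enumerations of the fibres, in which every element of `I` appears once. -/
lemma detComp_ne_zero [Finite I] {D : ℤ} (x : CompIdx D I) {p : detSpecies.obj x.e (Fin x.n)}
    (hp : p ≠ 0) {q : ∀ k, detSpecies.obj (x.d k) {i // x.f i = k}} (hq : ∀ k, q k ≠ 0) :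
    detComp x (p ⊗ₜ[ℚ] PiTensorProduct.tprod ℚ q) ≠ 0 := by
  intro h
  have h1 := congrArg (detVal D I) h
  rw [detVal_detComp, detCompVal_tmul, map_zero, smul_eq_zero_iff_eq, smul_eq_zero] at h1
  have h2 := h1.resolve_left (volCoeff_detVal_ne_zero hp)
  have hd := fun k => (det_eq_zero_or (q k)).resolve_left (hq k)
  choose c hc using fun k => exists_smul_detTop (hd k).1 (hd k).2 (Finite.equivFin _).symm (q k)
  have hc0 : ∀ k, c k ≠ 0 := fun k h0 => hq k (by rw [hc k, h0, zero_smul])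
  let l : Fin x.n → List I := fun k => List.ofFn fun j => ((Finite.equivFin {i // x.f i = k}).symm j).1
  have hl : ∀ k i, i ∈ l k ↔ x.f i = k := by
    intro k i
    rw [List.mem_ofFn]
    exact ⟨by rintro ⟨j, rfl⟩; exact ((Finite.equivFin {i // x.f i = k}).symm j).2, fun h =>
      ⟨Finite.equivFin _ ⟨i, h⟩, by rw [Equiv.symm_apply_apply]⟩⟩
  have h3 : ∀ k, extMap Subtype.val (detVal (x.d k) {i // x.f i = k} (q k)) = c k • volList (l k) := by
    intro k
    rw [hc k, map_smul, map_smul, detVal_detTop, extMap_vol, vol_eq_volList]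
    rfl
  have h4 : ∀ {n : ℕ} (c : Fin n → ℚ) (v : Fin n → ExteriorAlgebra ℚ (I →₀ ℚ)),
      (List.ofFn fun k => c k • v k).prod = (∏ k, c k) • (List.ofFn v).prod := by
    intro n c v
    induction n with
    | zero => simp
    | succ n ih =>
      rw [List.ofFn_succ, List.prod_cons, ih, List.ofFn_succ (f := v), List.prod_cons,
        Fin.prod_univ_succ, smul_mul_smul_comm]
  simp only [h3] at h2
  rw [h4, smul_eq_zero] at h2
  have h5 := h2.resolve_left (Finset.prod_ne_zero_iff.2 fun k _ => hc0 k)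
  rw [show (List.ofFn fun k => volList (l k)) = (List.ofFn l).map volList by
    rw [List.map_ofFn]; rfl, ← volList_flatten] at h5
  refine volList_ne_zero ?_ ?_ h5
  · rw [List.nodup_flatten]
    refine ⟨fun m hm => ?_, ?_⟩
    · obtain ⟨k, rfl⟩ := (List.mem_ofFn).1 hm
      exact List.nodup_ofFn.2 (Subtype.val_injective.comp (Equiv.injective _))
    · rw [List.pairwise_ofFn]
      intro a b hab
      rw [List.disjoint_left]
      intro i hi hi'
      exact hab.ne (((hl _ _).1 hi).symm.trans ((hl _ _).1 hi'))
  · intro i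
    rw [List.mem_flatten]
    exact ⟨l (x.f i), List.mem_ofFn.2 ⟨_, rfl⟩, (hl _ _).2 rfl⟩

lemma GrSpecies.map_ne_zero {P : GrSpecies} [Finite I] [Finite J] {d : ℤ} (u : I ≃ J)
    {x : P.obj d I} (hx : x ≠ 0) : P.map d u x ≠ 0 := by
  intro h
  have := congrArg (P.map d u.symm) h
  rw [map_zero, ← P.map_trans, P.map_self _ (by simp)] at this
  exact hx this

/-- Since `Det` is a line on each nonempty set, a nonzero composite spans it. Values of a law need
only be compared on such composites. -/
lemma det_γ_mk_ne_zero [Finite I] [Fintype K] [LinearOrder K] (f : I → K) {e D : ℤ} {d : K → ℤ}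
    (h : e + ∑ k, d k = D) {p : detSpecies.obj e K} (hp : p ≠ 0)
    {q : ∀ k, detSpecies.obj (d k) {i // f i = k}} (hq : ∀ k, q k ≠ 0) :
    Det.γ.app D I (Comp.mk f h p q) ≠ 0 := by
  refine ne_of_eq_of_ne (det_γ_inc _ _) (detComp_ne_zero _ (GrSpecies.map_ne_zero _ hp) fun k => ?_)
  exact GrSpecies.map_ne_zero _ (hq _)

end

end BOperad

namespace BOperad

noncomputable section

variable {I J K K' L Θ : Type}

/-! ### Comparison of distributive laws -/

section Agree

variable {P Q : OperadData} {Δ₁ Δ₂ : DistributiveLaw P Q}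

/-- Two distributive laws agree on the elements `(p; q)` with given `f` and `p`. -/
def Agree (Δ₁ Δ₂ : DistributiveLaw P Q) {I K : Type} [Finite I] [Fintype K] [LinearOrder K]
    (f : I → K) {e : ℤ} (p : Q.obj e K) : Prop :=
  ∀ ⦃D : ℤ⦄ ⦃d : K → ℤ⦄ (h : e + ∑ k, d k = D) (q : ∀ k, P.obj (d k) {i // f i = k}),
    Δ₁.law.app D I (Comp.mk f h p q) = Δ₂.law.app D I (Comp.mk f h p q)

/-- Renaming the inputs costs a sign that does not depend on the law, so agreement is preserved. -/
lemma Agree.relabel [Finite I] [Fintype K] [LinearOrder K] [Fintype K'] [LinearOrder K']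
    (σ : K ≃ K') {f : I → K} {f' : I → K'} (hf : ∀ i, f' i = σ (f i)) {e : ℤ} {p : Q.obj e K}
    (hp : Agree Δ₁ Δ₂ f p) : Agree Δ₁ Δ₂ f' (Q.map e σ p) := by
  intro D d' h' q'
  obtain ⟨ε, -, -, H⟩ := Comp.mk_relabel σ d'
  have h : e + ∑ k, d' (σ k) = D := by rw [Equiv.sum_comp σ d', h']
  have e1 := H (P := Q.toGrSpecies) (Q := P.toGrSpecies) hf h h' p
    (fun k => P.map _ (Equiv.subtypeEquivRight fun i => by simp [hf]) (q' (σ k))) q'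
    (fun k => ((P.map_map _ _ (Equiv.refl _) (fun _ => rfl) _).trans (P.map_refl _ _ _)).symm)
  rw [e1, Units.smul_def, map_zsmul, map_zsmul, hp h]

lemma Hom.app_mk_sub {X R Y : GrSpecies} (F : Hom (Comp X R) Y) [Finite I] [Fintype K]
    [LinearOrder K] (f : I → K) {e D : ℤ} {d : K → ℤ} (h : e + ∑ k, d k = D) (x y : X.obj e K)
    (r : ∀ k, R.obj (d k) {i // f i = k}) :
    F.app D I (Comp.mk f h (x - y) r) = F.app D I (Comp.mk f h x r) - F.app D I (Comp.mk f h y r) :=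
  map_sub (F.app D I ∘ₗ Comp.mkL f h r) x y

lemma DistributiveLaw.Ψ_mk (Δ : DistributiveLaw P Q) [Finite I] [Fintype K] [LinearOrder K]
    [Fintype L] [LinearOrder L] (f : I → K) (g : K → L) (hg : Monotone g)
    {c s D : ℤ} {a t : L → ℤ} {b : K → ℤ} (h₁ : c + ∑ l, a l = s) (h₂ : s + ∑ k, b k = D)
    (h₃ : ∀ l, a l + ∑ k : {k // g k = l}, b k = t l) (h₄ : c + ∑ l, t l = D)
    (p : P.obj c L) (q : ∀ l, Q.obj (a l) {k // g k = l}) (r : ∀ k, P.obj (b k) {i // f i = k}) :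
    Δ.Ψ.app D I (Comp.mk f h₂ (Comp.mk g h₁ p q) r) =
      (∏ l, ∏ k with g k < l, (a l * b k).negOnePow) •
        Δ.L.app D I (Comp.mk (g ∘ f) h₄ p (fun l => Δ.law.app (t l) _ (Comp.mk (levelMap f g l) (h₃ l)
          (q l) (fun k => P.map (b k) (levelFib f g l k) (r k))))) :=
  Δ.Ψ_spec f g hg h₁ h₂ h₃ h₄ p q r

/-- `Ψ` on `((p; q); r)` applies the law over each fibre of `g ∘ f` and then `L`. Agreement of the
laws on sets of these sizes is enough. -/
lemma Ψ_congr (hL : Δ₁.L = Δ₂.L) [Finite I] [Fintype K] [LinearOrder K] [Fintype L] [LinearOrder L]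
    (f : I → K) (g : K → L)
    (hlaw : ∀ l {I' K' : Type} [Finite I'] [Fintype K'] [LinearOrder K']
      (_ : Nat.card I' = Nat.card {i // g (f i) = l}) (f' : I' → K') {e : ℤ}
      (p : Q.obj e K'), Agree Δ₁ Δ₂ f' p)
    {c s D : ℤ} {a : L → ℤ} {b : K → ℤ} (h₁ : c + ∑ l, a l = s) (h₂ : s + ∑ k, b k = D)
    (p : P.obj c L) (q : ∀ l, Q.obj (a l) {k // g k = l}) (r : ∀ k, P.obj (b k) {i // f i = k}) :
    Δ₁.Ψ.app D I (Comp.mk f h₂ (Comp.mk g h₁ p q) r) =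
      Δ₂.Ψ.app D I (Comp.mk f h₂ (Comp.mk g h₁ p q) r) := by
  obtain ⟨σ, hσ⟩ := exists_monotone_perm g
  have h₂' : s + ∑ k, b (σ k) = D := by rw [Equiv.sum_comp σ b, h₂]
  obtain ⟨ε, hε⟩ := Comp.mk_mk_perm σ f g h₁ h₂ h₂' p q r
  obtain ⟨t, h₃, h₄⟩ := exists_fiber_degrees (fun k => g (σ k)) h₁ h₂'
  rw [hε, Units.smul_def, map_zsmul, map_zsmul]
  congr 1
  rw [Δ₁.Ψ_mk (fun i => σ.symm (f i)) (fun k => g (σ k)) hσ h₁ h₂' h₃ h₄,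
    Δ₂.Ψ_mk (fun i => σ.symm (f i)) (fun k => g (σ k)) hσ h₁ h₂' h₃ h₄, hL]
  refine congrArg _ (congrArg _ (congrArg _ (funext fun l => ?_)))
  refine hlaw l ?_ _ _ _ _
  refine Nat.card_congr (Equiv.subtypeEquivRight fun i => ?_)
  simp

/-- `Φ` on `(p; (q; r))` applies the law to `(p; q)`, whose labels are the inputs of the middle
level, and then `R`. When no block of labels is empty there are at most as many such inputs as
labels in `I`. -/
lemma Φ_congr (hR : Δ₁.R = Δ₂.R) (hQ : ∀ {d : ℤ} {I : Type} [Finite I] [IsEmpty I] (x : Q.obj d I), x = 0)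
    [Finite I] [Fintype L] [LinearOrder L] (h : I → L) {c : ℤ} (p : Q.obj c L)
    (hlaw : ∀ {J : Type} [Finite J] (_ : Nat.card J ≤ Nat.card I) (g : J → L), Agree Δ₁ Δ₂ g p)
    {D : ℤ} {t : L → ℤ} (h₄ : c + ∑ l, t l = D)
    (z : ∀ l, (Comp P.toGrSpecies Q.toGrSpecies).obj (t l) {i // h i = l}) :
    Δ₁.Φ.app D I (Comp.mk h h₄ p z) = Δ₂.Φ.app D I (Comp.mk h h₄ p z) := by
  have : (Δ₁.Φ.app D I).compMultilinearMap (Comp.mkM h h₄ p) =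
      (Δ₂.Φ.app D I).compMultilinearMap (Comp.mkM h h₄ p) := by
    apply multilinear_ext_right
    intro y a b h₃ q r
    refine (congrArg _ (Comp.mkM_apply h h₄ p _)).trans
      (Eq.trans ?_ (congrArg _ (Comp.mkM_apply h h₄ p _)).symm)
    have h₂ : (c + ∑ l, a l) + ∑ k, b k = D := by
      rw [← h₄, add_assoc, ← Finset.sum_congr rfl fun l _ => h₃ l, Finset.sum_add_distrib,
        ← Equiv.sum_comp (Equiv.sigmaFiberEquiv levelFst) b, Fintype.sum_sigma]
      rfl
    have e1 := @DistributiveLaw.Φ_spec _ _ Δ₁ I _ L _ _ _ _ _ (levelSum y) levelFst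
      levelFst_monotone c _ D a t b rfl h₂ h₃ h₄ p q r
    have e2 := @DistributiveLaw.Φ_spec _ _ Δ₂ I _ L _ _ _ _ _ (levelSum y) levelFst
      levelFst_monotone c _ D a t b rfl h₂ h₃ h₄ p q r
    refine smul_left_cancel _ (e1.symm.trans (Eq.trans ?_ e2))
    rw [hR]
    -- A middle input without labels carries an element of `Q(∅)`, which is zero by `hQ`, so both
    -- sides vanish.
    by_cases hs : Function.Surjective (levelSum y)
    · rw [hlaw (Nat.card_le_card_of_surjective _ hs) levelFst rfl q]
    · obtain ⟨k, hk⟩ := not_forall.1 hs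
      have : IsEmpty {i // levelSum y i = k} := ⟨fun i => hk ⟨i.1, i.2⟩⟩
      have hr : r k = 0 := hQ _
      have hz : ∀ x, Comp.mk (P := Comp P.toGrSpecies Q.toGrSpecies) (levelSum y) h₂ x r = 0 := by
        intro x
        rw [← Comp.mkM_apply]
        exact MultilinearMap.map_coord_zero _ k hr
      rw [hz, hz]
  have e := congrArg (fun F => F z) this
  refine (congrArg _ (Comp.mkM_apply h h₄ p z).symm).trans
    (Eq.trans e (congrArg _ (Comp.mkM_apply h h₄ p z)))

/-- Beck's diagram for the composition of `Q` applies the law first to the upper trees `q l` and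
then, inside `Φ`, to the root operation `p`; the two steps are compared separately. -/
lemma Agree.comp_left (hR : Δ₁.R = Δ₂.R)
    (hQ : ∀ {d : ℤ} {I : Type} [Finite I] [IsEmpty I] (x : Q.obj d I), x = 0)
    [Finite I] [Fintype K] [LinearOrder K] [Fintype L] [LinearOrder L] (f : I → K) (g : K → L)
    {c s : ℤ} {a : L → ℤ} (h₁ : c + ∑ l, a l = s) (p : Q.obj c L)
    (q : ∀ l, Q.obj (a l) {k // g k = l})
    (hp : ∀ {J : Type} [Finite J] (_ : Nat.card J ≤ Nat.card I) (g' : J → L), Agree Δ₁ Δ₂ g' p)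
    (hq : ∀ l {I' K' : Type} [Finite I'] [Fintype K'] [LinearOrder K']
      (_ : Nat.card I' ≤ Nat.card I) (_ : Nat.card K' = Nat.card {k // g k = l})
      (f' : I' → K') {e : ℤ} (p : Q.obj e K'), Agree Δ₁ Δ₂ f' p) :
    Agree Δ₁ Δ₂ f (Q.γ.app s K (Comp.mk g h₁ p q)) := by
  intro D b h₂ r
  obtain ⟨σ, hσ⟩ := exists_monotone_perm g
  have h₂' : s + ∑ k, b (σ k) = D := by rw [Equiv.sum_comp σ b, h₂]
  obtain ⟨ε, hε⟩ := Comp.mk_mk_perm σ f g h₁ h₂ h₂' p q r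
  obtain ⟨t, h₃, h₄⟩ := exists_fiber_degrees (fun k => g (σ k)) h₁ h₂'
  have e1 := congrArg ((Comp.map Q.γ (Hom.id P.toGrSpecies)).app D I) hε
  rw [Units.smul_def, map_zsmul, Comp.map_app_mk, Comp.map_app_mk] at e1
  simp only [Hom.id_app] at e1
  rw [e1, map_zsmul, map_zsmul]
  congr 1
  refine (Δ₁.law_comp_left (fun i => σ.symm (f i)) (fun k => g (σ k)) hσ h₁ h₂' h₃ h₄ p _ _).trans
    (Eq.trans ?_
      (Δ₂.law_comp_left (fun i => σ.symm (f i)) (fun k => g (σ k)) hσ h₁ h₂' h₃ h₄ p _ _).symm)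
  congr 1
  refine Eq.trans ?_ (Φ_congr hR hQ _ p hp h₄ _)
  congr 2
  funext l
  refine hq l (Finite.card_subtype_le _) ?_ _ _ _ _
  exact Nat.card_congr (σ.subtypeEquiv fun i => Iff.rfl)

/-- Beck's diagram for the composition of `P`: once the law on `(p; q)` is known to be `w` for both
laws, the value on the composite is decided by `Ψ` on `(w; r)`. -/
lemma Agree.comp_right [Finite I] [Fintype K] [LinearOrder K] [Fintype L] [LinearOrder L]
    (f : I → K) (g : K → L) (hg : Monotone g) {c s D : ℤ} {a t : L → ℤ} {b : K → ℤ}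
    (h₁ : c + ∑ l, a l = s) (h₂ : s + ∑ k, b k = D)
    (h₃ : ∀ l, a l + ∑ k : {k // g k = l}, b k = t l) (h₄ : c + ∑ l, t l = D)
    (p : Q.obj c L) (q : ∀ l, P.obj (a l) {k // g k = l}) (r : ∀ k, P.obj (b k) {i // f i = k})
    {w : (Comp P.toGrSpecies Q.toGrSpecies).obj s K}
    (hw₁ : Δ₁.law.app s K (Comp.mk g h₁ p q) = w) (hw₂ : Δ₂.law.app s K (Comp.mk g h₁ p q) = w)
    (hw : Δ₁.Ψ.app D I (Comp.mk f h₂ w r) = Δ₂.Ψ.app D I (Comp.mk f h₂ w r)) :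
    Δ₁.law.app D I (Comp.mk (g ∘ f) h₄ p (fun l => P.γ.app (t l) _
        (Comp.mk (levelMap f g l) (h₃ l) (q l) (fun k => P.map (b k) (levelFib f g l k) (r k))))) =
      Δ₂.law.app D I (Comp.mk (g ∘ f) h₄ p (fun l => P.γ.app (t l) _
        (Comp.mk (levelMap f g l) (h₃ l) (q l)
          (fun k => P.map (b k) (levelFib f g l k) (r k))))) := by
  have e1 := Δ₁.law_comp_right f g hg h₁ h₂ h₃ h₄ p q r
  have e2 := Δ₂.law_comp_right f g hg h₁ h₂ h₃ h₄ p q r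
  rw [hw₁] at e1
  rw [hw₂] at e2
  exact smul_left_cancel _ (e1.symm.trans (hw.trans e2))

end Agree

end

end BOperad

namespace BOperad

noncomputable section

variable {I J K K' L Θ : Type}

/-! ### Agreement of two laws on units. -/

section Unit

variable {P Q : OperadData} {Δ₁ Δ₂ : DistributiveLaw P Q}

lemma Agree.one [Finite I] (f : I → Unit) : Agree Δ₁ Δ₂ f Q.one := by
  intro D d h q
  obtain rfl : D = d () := by simpa using h.symm
  have e : Comp.mk f h Q.one q = insL Q.one (P.map _ (Equiv.subtypeUnivEquiv fun _ => rfl) (q ())) := by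
    unfold insL
    congr 1
    funext k
    exact ((P.map_map _ _ (Equiv.refl _) (fun _ => rfl) _).trans (P.map_refl _ _ _)).symm
  -- The unit axiom is stated for linearly ordered label sets; any order on `I` serves.
  let _ : Fintype I := Fintype.ofFinite I
  let _ : LinearOrder I := LinearOrder.lift' (Finite.equivFin I) (Finite.equivFin I).injective
  rw [e, Δ₁.law_one_left, Δ₂.law_one_left]

/-- The units in the fibres of a bijection. -/
def fiberOne (P : OperadData) [Finite I] (u : K ≃ I) {f : I → K} (hf : ∀ k, f (u k) = k) (k : K) :
    P.obj 0 {i // f i = k} :=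
  P.map 0 (⟨fun _ => ⟨u k, hf k⟩, fun _ => (), fun _ => rfl, fun i => Subtype.ext
    (by have h := hf (u.symm i.1); rw [u.apply_symm_apply, i.2] at h; exact u.eq_symm_apply.1 h)⟩ :
      Unit ≃ {i // f i = k}) P.one

lemma Agree.mk_fiberOne [Finite I] [Fintype K] [LinearOrder K] (u : K ≃ I) {f : I → K}
    (hf : ∀ k, f (u k) = k) {e D : ℤ} (h : e + ∑ _ : K, (0 : ℤ) = D) (p : Q.obj e K) :
    Δ₁.law.app D I (Comp.mk f h p (fiberOne P u hf)) =
      Δ₂.law.app D I (Comp.mk f h p (fiberOne P u hf)) := by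
  obtain rfl : e = D := by simpa using h
  have e : Comp.mk f h p (fiberOne P u hf) =
      (Comp Q.toGrSpecies P.toGrSpecies).map e u (insR P.one p) := by
    rw [insR, Comp.map_mk u (fun k => k) f hf]
    congr 1
    funext k
    exact (P.map_map _ _ _ (fun _ => rfl) _).symm
  rw [e, Δ₁.law.naturality, Δ₂.law.naturality, Δ₁.law_one_right, Δ₂.law_one_right]

end Unit

/-! ### Separation of one label from the others. -/

section Two

/-- The map `I → {false, true}` that separates `i` from the other elements. -/
def twoMap (i a : I) : Bool := by classical exact decide (a ≠ i)

lemma twoMap_eq_false {i a : I} : twoMap i a = false ↔ a = i := by simp [twoMap]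

/-- The degrees `0`, `e`. -/
def twoDeg (e : ℤ) (b : Bool) : ℤ := match b with
  | false => 0
  | true => e

lemma twoStep_eq_mk {P Q : GrSpecies} (o : Q.obj 0 Unit) {c e D : ℤ} (h : c + e = D) [Finite I]
    (i : I) (x : P.obj c Bool) (y : Q.obj e {a : I // a ≠ i}) :
    ∃ q : ∀ b, Q.obj (twoDeg e b) {a // twoMap i a = b}, (o ≠ 0 → y ≠ 0 → ∀ b, q b ≠ 0) ∧
      twoStep o h i x y = Comp.mk (twoMap i) (by simpa [twoDeg] using h) x q := by
  refine ⟨_, ?_, rfl⟩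
  rintro ho hy (_ | _)
  · exact GrSpecies.map_ne_zero _ ho
  · exact GrSpecies.map_ne_zero _ hy

lemma twoMap_zero_monotone : Monotone (twoMap (0 : Fin 3)) := by
  intro a b hab
  rcases Bool.eq_false_or_eq_true (twoMap 0 b) with h | h
  · rw [h]; exact Bool.le_true _
  · rw [twoMap_eq_false] at h
    rw [h] at hab
    rw [h, Fin.le_zero_iff.1 hab]

lemma twoMap_surjective {i a : I} (h : a ≠ i) : Function.Surjective (twoMap i) := by
  rintro (_ | _)
  · exact ⟨i, twoMap_eq_false.2 rfl⟩
  · refine ⟨a, ?_⟩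
    rw [← Bool.not_eq_false, twoMap_eq_false]
    exact h

end Two

/-! ### Uniqueness of the law satisfying the rewriting rule. -/

section Generators

variable {Δ₁ Δ₂ : DistributiveLaw Det Gri}

lemma det_eq_zero {d : ℤ} [Finite I] [IsEmpty I] (x : Det.obj d I) : x = 0 := by
  refine (det_eq_zero_or x).resolve_right fun h => ?_
  rw [Nat.card_of_isEmpty] at h
  exact lt_irrefl _ h.1

lemma gri_eq_zero {d : ℤ} [Finite I] [IsEmpty I] (x : Gri.obj d I) : x = 0 := by
  have : (LinearMap.id : griSpecies.obj d I →ₗ[ℚ] griSpecies.obj d I) = 0 := by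
    apply gri_linear_ext
    intro T
    obtain ⟨i, -⟩ := Multiset.exists_mem_of_ne_zero T.1.leaves_ne_zero
    exact isEmptyElim i
  exact LinearMap.congr_fun this x

lemma det_one_ne_zero : Det.one ≠ 0 := by
  intro h
  have h1 : ExteriorAlgebra.ι ℚ (Finsupp.single () (1 : ℚ)) = 0 := congrArg (detVal 0 Unit) h
  rw [ExteriorAlgebra.ι_eq_zero_iff, Finsupp.single_eq_zero] at h1
  exact one_ne_zero h1

lemma eGen_ne_zero [Finite I] (i j : I) (h : IsPair i j) : eGen i j h ≠ 0 := by
  intro h0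
  have h1 : ExteriorAlgebra.ι ℚ (Finsupp.single i (1 : ℚ)) * ExteriorAlgebra.ι ℚ (Finsupp.single j 1)
      = 0 := congrArg (detVal 1 I) h0
  refine volList_ne_zero (l := [i, j]) (by simpa using h.1) (by simpa using h.2) ?_
  simpa [volList] using h1

/-- Nonzero elements of `Det` on a given fibre have the same degree and are proportional. By
multilinearity one family of nonzero inputs decides the agreement, and the other families with
nonzero entries are multiples of it. -/
lemma Agree.of_ne_zero [Finite I] [Fintype K] [LinearOrder K] {f : I → K} {e : ℤ} {p : Gri.obj e K}
    {d₀ : K → ℤ} {q₀ : ∀ k, Det.obj (d₀ k) {i // f i = k}} (hq₀ : ∀ k, q₀ k ≠ 0)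
    (H : ∀ {D : ℤ} (h : e + ∑ k, d₀ k = D),
      Δ₁.law.app D I (Comp.mk f h p q₀) = Δ₂.law.app D I (Comp.mk f h p q₀)) :
    Agree Δ₁ Δ₂ f p := by
  intro D d h q
  by_cases hz : ∃ k, q k = 0
  · obtain ⟨k, hk⟩ := hz
    have : Comp.mk f h p q = 0 := by
      rw [← Comp.mkM_apply]
      exact MultilinearMap.map_coord_zero _ k hk
    rw [this, map_zero, map_zero]
  · push Not at hz
    obtain rfl : d = d₀ := by
      funext k
      have h1 := (det_eq_zero_or (q k)).resolve_left (hz k)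
      have h2 := (det_eq_zero_or (q₀ k)).resolve_left (hq₀ k)
      have := h1.2.trans h2.2.symm
      omega
    choose c hc using fun k => exists_smul_of_ne_zero (hq₀ k) (q k)
    have : Comp.mk f h p q = (∏ k, c k) • Comp.mk f h p q₀ := by
      rw [← Comp.mkM_apply, ← Comp.mkM_apply]
      exact (congrArg _ (funext hc)).trans (MultilinearMap.map_smul_univ _ c q₀)
    rw [this, map_smul, map_smul, H]

lemma Agree.of_not_surjective [Finite I] [Fintype K] [LinearOrder K] {f : I → K}
    (hf : ¬ Function.Surjective f) {e : ℤ} (p : Gri.obj e K) : Agree Δ₁ Δ₂ f p := by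
  intro D d h q
  obtain ⟨k, hk⟩ := not_forall.1 hf
  have : IsEmpty {i // f i = k} := ⟨fun i => hk ⟨i.1, i.2⟩⟩
  have : Comp.mk f h p q = 0 := by
    rw [← Comp.mkM_apply]
    exact MultilinearMap.map_coord_zero _ k (det_eq_zero _)
  rw [this, map_zero, map_zero]

lemma Agree.of_bijective [Finite I] [Fintype K] [LinearOrder K] {f : I → K}
    (hf : Function.Bijective f) {e : ℤ} (p : Gri.obj e K) : Agree Δ₁ Δ₂ f p := by
  have h1 : ∀ k, f ((Equiv.ofBijective f hf).symm k) = k := (Equiv.ofBijective f hf).apply_symm_apply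
  exact Agree.of_ne_zero (q₀ := fiberOne Det (Equiv.ofBijective f hf).symm h1)
    (fun k => GrSpecies.map_ne_zero _ det_one_ne_zero) fun h => Agree.mk_fiberOne _ _ h p

lemma card_fiber_lt [Finite I] {f : I → Bool} (hf : Function.Surjective f) (b : Bool) :
    Nat.card {i // f i = b} < Nat.card I := by
  obtain ⟨i, hi⟩ := hf (!b)
  exact Finite.card_subtype_lt (x := i) (by simp [hi])

lemma isTriple_fin : IsTriple (0 : Fin 3) 1 2 := ⟨by decide, by decide, by decide, by decide⟩

/-- The inputs from `Det` may be chosen as composites of a unit and `e` on three points with nonzero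
elements on the fibres of `f`. On the three points both laws are given by the rule, and what remains
is `Ψ` on its two terms. -/
lemma Agree.omega_of_three (hr₁ : ExtendsRule Δ₁.law) (hr₂ : ExtendsRule Δ₂.law)
    (hL : Δ₁.L = Δ₂.L) [Finite I]
    (ih : ∀ {I' K' : Type} [Finite I'] [Fintype K'] [LinearOrder K'] (_ : Nat.card I' < Nat.card I)
      (f : I' → K') {e : ℤ} (p : Gri.obj e K'), Agree Δ₁ Δ₂ f p)
    (f : I → Fin 3) (hf : Function.Surjective f) :
    Agree Δ₁ Δ₂ (twoMap 0 ∘ f) (omegaGen false true isPair_bool) := by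
  have hne : ∀ k, Nonempty {i // f i = k} := fun k => ⟨⟨_, (hf k).choose_spec⟩⟩
  choose r hr using fun k => exists_det_ne_zero (I := {i // f i = k})
  obtain ⟨q, hq, hq'⟩ := twoStep_eq_mk (P := Gri.toGrSpecies) (Q := Det.toGrSpecies) Det.one (zero_add 1) (0 : Fin 3)
    (omegaGen false true isPair_bool) (eGen _ _ isTriple_fin.pair₁)
  obtain ⟨t, h₃, h₄⟩ := exists_fiber_degrees (twoMap (0 : Fin 3)) (c := 0) (a := twoDeg 1)
    (b := fun k => (Nat.card {i // f i = k} : ℤ) - 1) (by simp [twoDeg]; rfl) rfl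
  refine Agree.of_ne_zero (q₀ := fun l => Det.γ.app (t l) _
        (Comp.mk (levelMap f (twoMap 0) l) (h₃ l) (q l)
          (fun k => Det.map _ (levelFib f (twoMap 0) l k) (r k))))
    (fun l => det_γ_mk_ne_zero _ _ (hq det_one_ne_zero (eGen_ne_zero _ _ _) l)
      fun k => GrSpecies.map_ne_zero _ (hr _)) ?_
  intro D h
  obtain rfl := h₄.symm.trans h
  have hw : ∀ Δ : DistributiveLaw Det Gri, ExtendsRule Δ.law → _ := fun Δ h =>
    (congrArg _ hq'.symm).trans (h _ _ _ isTriple_fin)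
  refine Agree.comp_right f _ twoMap_zero_monotone _ rfl h₃ _ _ q r (hw Δ₁ hr₁) (hw Δ₂ hr₂) ?_
  have key : ∀ (j : Fin 3) (x : Det.obj 1 Bool) (y : Gri.obj 0 {a // a ≠ j}) {D : ℤ} (h),
      Δ₁.Ψ.app D I (Comp.mk f h (twoStep Gri.one (add_zero 1) j x y) r) =
        Δ₂.Ψ.app D I (Comp.mk f h (twoStep Gri.one (add_zero 1) j x y) r) := by
    intro j x y D h
    obtain ⟨q', -, hq'⟩ := twoStep_eq_mk (P := Det.toGrSpecies) (Q := Gri.toGrSpecies) Gri.one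
      (add_zero 1) j x y
    rw [hq']
    obtain ⟨a, ha⟩ := exists_ne j
    -- In each term of the rule the root is now an operation of `Det` with two inputs, and both
    -- blocks of labels are nonempty; each is therefore strictly smaller than `I`.
    refine Ψ_congr hL f _ (fun l _ _ _ _ _ hc => ih ?_) _ _ _ _ _
    rw [hc]
    exact card_fiber_lt ((twoMap_surjective ha).comp hf) l
  exact (Hom.app_mk_sub _ _ _ _ _ _).trans ((congrArg₂ (· - ·) (key _ _ _ _) (key _ _ _ _)).trans
    (Hom.app_mk_sub _ _ _ _ _ _).symm)

/-- If a block is empty the input is zero, and if both are single points the unit axiom applies.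
Otherwise some block has two elements; it may be assumed to be the block `true`, since `ω` is
symmetric, and splitting it gives a map to three points. -/
lemma Agree.omega (hr₁ : ExtendsRule Δ₁.law) (hr₂ : ExtendsRule Δ₂.law)
    (hL : Δ₁.L = Δ₂.L) [Finite I]
    (ih : ∀ {I' K' : Type} [Finite I'] [Fintype K'] [LinearOrder K'] (_ : Nat.card I' < Nat.card I)
      (f : I' → K') {e : ℤ} (p : Gri.obj e K'), Agree Δ₁ Δ₂ f p)
    (f : I → Bool) : Agree Δ₁ Δ₂ f (omegaGen false true isPair_bool) := by
  classical
  by_cases hs : Function.Surjective f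
  swap
  · exact Agree.of_not_surjective hs _
  by_cases hi : Function.Injective f
  · exact Agree.of_bijective ⟨hi, hs⟩ _
  obtain ⟨j, j', hjj, hne⟩ := Function.not_injective_iff.1 hi
  have key : ∀ f : I → Bool, Function.Surjective f → f j = f j' → f j = true →
      Agree Δ₁ Δ₂ f (omegaGen false true isPair_bool) := by
    intro f hs hjj hj
    -- The block `true` is split into `{j}` and the rest, which contains `j'`.
    let f' : I → Fin 3 := fun i => if f i = false then 0 else if i = j then 1 else 2
    have hf : f = twoMap 0 ∘ f' := by
      funext i
      rcases hi : f i with _ | _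
      · simp [f', twoMap, hi]
      · by_cases hij : i = j <;> simp [f', twoMap, hi, hij, hj]
    rw [hf]
    refine Agree.omega_of_three hr₁ hr₂ hL ih f' ?_
    intro a
    fin_cases a
    · obtain ⟨i, hi⟩ := hs false
      exact ⟨i, by simp [f', hi]⟩
    · exact ⟨j, by simp [f', hj]⟩
    · exact ⟨j', by simp [f', ← hjj, hj, hne.symm]⟩
  rcases Bool.eq_false_or_eq_true (f j) with h | h
  · exact key f hs hjj h
  · have h1 := (key (fun i => !(f i)) (Equiv.boolNot.surjective.comp hs) (by simp [hjj])
      (by simp [h])).relabel Equiv.boolNot (f' := f) (by simp)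
    have h2 : Gri.map 0 Equiv.boolNot (omegaGen false true isPair_bool) =
        omegaGen false true isPair_bool := by
      refine (griSpecies_map_griTree _ _).trans (congrArg griTree (Subtype.ext ?_))
      exact mul_comm (BinTree.leaf true) (BinTree.leaf false)
    rwa [h2] at h1

lemma gri_γ_mk [Finite I] {n : ℕ} {D e : ℤ} {d : Fin n → ℤ} (f : I → Fin n) (h : e + ∑ k, d k = D)
    (T : LTree e (Fin n)) (S : ∀ k, LTree (d k) {i // f i = k}) :
    Gri.γ.app D I (Comp.mk f h (griTree T) fun k => griTree (S k)) =
      griTree (LTree.graft ⟨n, f, e, d, h⟩ T S) := by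
  have e1 := CompObj.inc_eq_mk (P := griSpecies) (Q := griSpecies) ⟨n, f, e, d, h⟩ (griTree T)
    fun k => griTree (S k)
  have e2 : griOperadComp.app D I (CompObj.inc griSpecies griSpecies ⟨n, f, e, d, h⟩ (griTree T ⊗ₜ[ℚ]
      PiTensorProduct.tprod ℚ fun k => griTree (S k))) = griTree (LTree.graft ⟨n, f, e, d, h⟩ T S) := by
    rw [griOperadComp, Comp.lift_app_inc, griComp_griTree]
  exact (congrArg _ e1.symm).trans e2

/-- The tree with two leaves `0` and `1`. -/
def pairTree : LTree 0 (Fin 2) :=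
  LTree.map finTwoEquiv.symm ⟨BinTree.leaf false * BinTree.leaf true, by simp⟩

/-- Cutting at the root: the two subtrees are grafted on the tree with two leaves. Both have leaves,
so each block is strictly smaller than `I`. -/
lemma griTree_mul [Finite I] {s t : BinTree I} (T : LTree 0 I) (hT : T.1 = s * t) :
    ∃ x : TreeDec 2 I, (∀ l, Nat.card {i // x.f i = l} < Nat.card I) ∧
      griTree T = Gri.γ.app 0 I (Comp.mk x.f (d := fun _ => 0) (by simp) (griTree pairTree)
        fun k => griTree (x.T k)) := by
  obtain ⟨x, hx⟩ := TreeDec.exists_val (l := ![s, t]) (by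
    rw [← T.leaves_eq_full, hT, Fin.sum_univ_two, BinTree.leaves_mul]; rfl)
  have hs : Function.Surjective x.f := by
    intro l
    obtain ⟨i, hi⟩ := Multiset.exists_mem_of_ne_zero (x.val l).leaves_ne_zero
    exact ⟨i, (x.mem_leaves l i).1 hi⟩
  refine ⟨x, fun l => ?_, ?_⟩
  · obtain ⟨l', hl⟩ := exists_ne l
    obtain ⟨i, hi⟩ := hs l'
    exact Finite.card_subtype_lt (x := i) (by rw [hi]; exact hl)
  · refine Eq.trans ?_ (gri_γ_mk _ _ _ _).symm
    refine congrArg griTree (Subtype.ext ?_)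
    have h0 : s = x.val 0 := by rw [hx]; rfl
    have h1 : t = x.val 1 := by rw [hx]; rfl
    rw [hT, h0, h1]
    rfl

/-- Two nested inductions. The outer one, on the size of the label set, serves the tree with two
leaves, where the rule leads to smaller sets. The inner one, on the number of inputs of the tree,
serves the cutting at the root, where the label sets need not shrink but the subtrees do. A single
leaf is settled by the unit axiom. -/
lemma agree_of_extendsRule (hr₁ : ExtendsRule Δ₁.law) (hr₂ : ExtendsRule Δ₂.law)
    (hL : Δ₁.L = Δ₂.L) (hR : Δ₁.R = Δ₂.R) (n : ℕ) : ∀ {I K : Type} [Finite I] [Fintype K]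
    [LinearOrder K] (_ : Nat.card I ≤ n) (f : I → K) {e : ℤ} (p : Gri.obj e K),
    Agree Δ₁ Δ₂ f p := by
  induction n using Nat.strong_induction_on with | _ n ih
  -- The size `n` itself is allowed here: cutting a tree at its root needs the two-leaf tree on
  -- label sets as large as the given one.
  have hω : ∀ {J : Type} [Finite J] (_ : Nat.card J ≤ n) (g : J → Fin 2),
      Agree Δ₁ Δ₂ g (griTree pairTree : griSpecies.obj 0 (Fin 2)) := by
    intro J _ hJ g
    have h1 := (Agree.omega hr₁ hr₂ hL (fun hlt f _ p => ih _ (hlt.trans_le hJ) le_rfl f p)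
      (fun j => finTwoEquiv (g j))).relabel finTwoEquiv.symm (f' := g) (by simp)
    have h2 : Gri.map 0 finTwoEquiv.symm (omegaGen false true isPair_bool) = griTree pairTree :=
      griSpecies_map_griTree _ _
    rwa [h2] at h1
  have hN : ∀ (m : ℕ) {I K : Type} [Finite I] [Fintype K] [LinearOrder K] (_ : Nat.card I ≤ n)
      (_ : Nat.card K = m) (f : I → K) {e : ℤ} (p : Gri.obj e K), Agree Δ₁ Δ₂ f p := by
    intro m
    induction m using Nat.strong_induction_on with | _ m ihm
    intro I K _ _ _ hI hK f e p D d h q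
    have : Δ₁.law.app D I ∘ₗ Comp.mkL f h q = Δ₂.law.app D I ∘ₗ Comp.mkL f h q := by
      apply gri_linear_ext
      intro T
      -- Passing to all inputs `q` at once permits the renaming of `K` and the cutting of `T` below.
      suffices hT : Agree Δ₁ Δ₂ f (griTree T : griSpecies.obj e K) from hT h q
      obtain rfl : e = 0 := T.2.2.2
      have hcases : (∃ k, T.1 = BinTree.leaf k) ∨ ∃ s t, T.1 = s * t := by
        generalize T.1 = t
        induction t using BinTree.induct with
        | leaf k => exact Or.inl ⟨k, rfl⟩
        | mul s t => exact Or.inr ⟨s, t, rfl⟩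
      rcases hcases with ⟨k, hk⟩ | ⟨s, t, hst⟩
      · have hall : ∀ i, i = k := fun i => by
          have := T.2.2.1 i
          rwa [hk, BinTree.leaves_leaf, Multiset.mem_singleton] at this
        let σ : Unit ≃ K := ⟨fun _ => k, fun _ => (), fun _ => rfl, fun i => (hall i).symm⟩
        have h1 := (Agree.one (Δ₁ := Δ₁) (Δ₂ := Δ₂) (fun _ : I => ())).relabel σ (f' := f)
          (fun i => hall _)
        have h2 : Gri.map 0 σ Gri.one = griTree T :=
          (griSpecies_map_griTree _ _).trans (congrArg griTree (Subtype.ext hk.symm))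
        rwa [h2] at h1
      · obtain ⟨x, hx, e1⟩ := griTree_mul T hst
        rw [e1]
        refine Agree.comp_left hR gri_eq_zero f x.f _ _ _ (fun hJ g' => hω (hJ.trans hI) g') ?_
        intro l I' K' _ _ _ hI' hK' f' e p
        exact ihm _ (by rw [← hK]; exact hx l) (hI'.trans hI) hK' f' p
    exact LinearMap.congr_fun this p
  intro I K _ _ _ hI f e p
  exact hN _ hI rfl f p

lemma DistributiveLaw.eq_of_extendsRule (hr₁ : ExtendsRule Δ₁.law) (hr₂ : ExtendsRule Δ₂.law) :
    Δ₁ = Δ₂ := by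
  apply DistributiveLaw.ext_of_law
  have hR : Δ₁.R = Δ₂.R := Interchange.unique_left rfl Δ₁.R_spec Δ₂.R_spec
  have hL : Δ₁.L = Δ₂.L := Interchange.unique_right rfl Δ₁.L_spec Δ₂.L_spec
  apply Hom.ext_mk
  intro I _ n f e D d h p q
  exact agree_of_extendsRule hr₁ hr₂ hL hR _ le_rfl f p h q

end Generators

end

end BOperad

/-! ### The theorem. -/

theorem mainTheorem3 :
    Det.IsOperad ∧ Gri.IsOperad ∧
    ∃ Δ : DistributiveLaw Det Gri,
      ExtendsRule Δ.law ∧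
      (∀ Δ' : DistributiveLaw Det Gri, ExtendsRule Δ'.law → Δ' = Δ) ∧
      ∃ γ : Hom (Comp (Comp Det.toGrSpecies Gri.toGrSpecies) (Comp Det.toGrSpecies Gri.toGrSpecies))
          (Comp Det.toGrSpecies Gri.toGrSpecies),
        Δ.IsInducedComposition γ ∧
        (∀ γ', Δ.IsInducedComposition γ' → γ' = γ) ∧
        (compositeOperadData Det Gri γ).IsOperad :=
  ⟨det_isOperad, gri_isOperad, treeLaw, extendsRule_treeLaw,
    fun _ h => DistributiveLaw.eq_of_extendsRule h extendsRule_treeLaw, treeComp, treeComp_isInduced,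
    fun _ h => Interchange.unique_left rfl h treeComp_isInduced, composite_isOperad⟩
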